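/- \textbf{Theorem (global regularity).} Let $\alpha\in(0,1)$ and $c>0$. There is a constant $C$, depending only on $\alpha$ and $c$, with the following property. Let $n\ge 1$, $z_0,\dots,z_n\in\mathbb R^2$, $r_0,\dots,r_n>0$ and $d>0$ be such that the closed disks $\overline{B(z_k,r_k)}$, $1\le k\le n$, are pairwise disjoint and contained in $B(z_0,r_0)$, that $\operatorname{dist}(\partial B(z_j,r_j),\partial B(z_k,r_k))\ge 2d$ for all $j\ne k$ in $\{0,\dots,n\}$, and that $r_k\ge c\,d$ for $1\le k\le n$. Put $$E=B(z_0,r_0)\setminus\bigcup_{k=1}^n\overline{B(z_k,r_k)},\qquad B=|E|^{1/2}\,C_P(E)\,\bigl(d^{-1/2}C_P(E)+1\bigr)\,n^{1/2}\,r_0^{1/2},$$ where $$C_P(E)=\sup\Bigl\{\|\phi\|_{L^2(E)}:\ \phi\in H^1(E),\ \|D\phi\|_{L^2(E)}=1,\ \int_E\phi=0\Bigr\}\in[0,\infty].$$ Let $g\in C^{1,\alpha}(\partial E)$ and let $u\in H^1(E)$ be harmonic in $E$, with $\int_E u\,dx=0$ and $\partial u/\partial\nu=g$ on $\partial E$,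 where $\nu$ is the outward unit normal of $E$ and the boundary condition is understood in the weak sense: $\int_E Du\cdot D\varphi\,dx=\int_{\partial E}g\varphi\,dS$ for all $\varphi\in C^\infty(\mathbb R^2)$ (every classical solution of class $C^2(E)\cap C^1(\overline E)$ satisfies this). Then $Du$ and $D^2u$ are bounded and $\alpha$-Hölder continuous on $E$, and $$\|Du\|_{\infty(E)}\le C\,(1+Bd^{-4}r_0)\,\|g\|_\infty+C\,r_0^{\alpha}\,[g]_{0,\alpha},$$ $$[Du]_{0,\alpha(E)}\le C\,(d^{-\alpha}+Bd^{-5}r_0^{2-\alpha})\,\|g\|_\infty+C\,[g]_{0,\alpha},$$ $$\|D^2u\|_{\infty(E)}\le C\,(d^{-1}+Bd^{-5}r_0)\,\|g\|_\infty+C\,d^{\alpha-1}[g]_{0,\alpha}+C\,\|g'\|_\infty+C\,r_0^{\alpha}\,[g']_{0,\alpha},$$ $$[D^2u]_{0,\alpha(E)}\le C\,(d^{-1-\alpha}+Bd^{-6}r_0^{2-\alpha})\,\|g\|_\infty+C\,d^{-1}[g]_{0,\alpha}+C\,d^{-\alpha}\|g'\|_\infty+C\,[g']_{0,\alpha}.$$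 Here $[f]_{0,\alpha(S)}=\sup_{x\ne y\in S}|f(x)-f(y)|/|x-y|^{\alpha}$, $g'$ is the derivative of $g$ with respect to arc length along the boundary circles, $\|g\|_\infty$ and $\|g'\|_\infty$ are suprema over $\partial E$, and $[g]_{0,\alpha}$ and $[g']_{0,\alpha}$ denote the largest of the seminorms on the single circles $\partial B(z_k,r_k)$, $0\le k\le n$. -/

import Mathlib

open MeasureTheory InnerProductSpace
open scoped NNReal ENNReal ContDiff

noncomputable section

namespace PerforatedDisk

/-- The Euclidean plane is identified with `ℂ`, as a real inner product space. The index `0` refers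
to the outer disk `B(z 0, r 0)`, the indices `1, …, n` to the holes `B(z k, r k)`. The domain is the
open outer disk without the closed holes. -/
def domain {n : ℕ} (z : Fin (n + 1) → ℂ) (r : Fin (n + 1) → ℝ) : Set ℂ :=
  Metric.ball (z 0) (r 0) \ ⋃ k : Fin n, Metric.closedBall (z k.succ) (r k.succ)

/-- The union of the outer circle and of the circles that bound the holes. -/
def bdry {n : ℕ} (z : Fin (n + 1) → ℂ) (r : Fin (n + 1) → ℝ) : Set ℂ :=
  ⋃ k : Fin (n + 1), Metric.sphere (z k) (r k)

/-- The assumptions on the geometry: the closed holes are pairwise disjoint and lie in the outer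
disk, distinct boundary circles are at distance at least `2 * d`, and every hole has radius at
least `c * d`. -/
structure Admissible (c d : ℝ) {n : ℕ} (z : Fin (n + 1) → ℂ) (r : Fin (n + 1) → ℝ) : Prop where
  d_pos : 0 < d
  subset_outer : ∀ k : Fin n,
    Metric.closedBall (z k.succ) (r k.succ) ⊆ Metric.ball (z 0) (r 0)
  disjoint_holes : ∀ j k : Fin n, j ≠ k →
    Disjoint (Metric.closedBall (z j.succ) (r j.succ)) (Metric.closedBall (z k.succ) (r k.succ))
  dist_circles : ∀ j k : Fin (n + 1), j ≠ k →
    ∀ x ∈ Metric.sphere (z j) (r j), ∀ y ∈ Metric.sphere (z k) (r k), 2 * d ≤ dist x y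
  radius_ge : ∀ k : Fin n, c * d ≤ r k.succ

/-- `G` is the weak (distributional) derivative of `φ` in the open set `E`. -/
def HasWeakDerivOn (E : Set ℂ) (φ : ℂ → ℝ) (G : ℂ → ℂ →L[ℝ] ℝ) : Prop :=
  ∀ η : ℂ → ℝ, ContDiff ℝ ∞ η → HasCompactSupport η → tsupport η ⊆ E → ∀ v : ℂ,
    ∫ x in E, φ x * fderiv ℝ η x v = -∫ x in E, G x v * η x

/-- The Poincaré constant for the Neumann problem: the supremum, in `[0, ∞]`, of the `L²` norms of
the functions in `H¹(E)` with zero mean whose weak derivative has `L²` norm `1`. -/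
def poincareConst (E : Set ℂ) : ℝ≥0∞ :=
  sSup {a : ℝ≥0∞ | ∃ (φ : ℂ → ℝ) (G : ℂ → ℂ →L[ℝ] ℝ),
    MemLp φ 2 (volume.restrict E) ∧ MemLp G 2 (volume.restrict E) ∧ HasWeakDerivOn E φ G ∧
    eLpNorm G 2 (volume.restrict E) = 1 ∧ ∫ x in E, φ x = 0 ∧
    a = eLpNorm φ 2 (volume.restrict E)}

/-- `B(E) = |E|^(1/2) C_P(E) (d^(-1/2) C_P(E) + 1) n^(1/2) r_0^(1/2)`. -/
def constB (d : ℝ) {n : ℕ} (z : Fin (n + 1) → ℂ) (r : Fin (n + 1) → ℝ) : ℝ≥0∞ :=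
  volume (domain z r) ^ (1 / 2 : ℝ) * poincareConst (domain z r) *
    (ENNReal.ofReal (d ^ (-(1 / 2) : ℝ)) * poincareConst (domain z r) + 1) *
    (n : ℝ≥0∞) ^ (1 / 2 : ℝ) * ENNReal.ofReal (r 0 ^ (1 / 2 : ℝ))

/-- The supremum norm of `f` on `S`. -/
def supNorm {F : Type*} [NormedAddCommGroup F] (S : Set ℂ) (f : ℂ → F) : ℝ≥0∞ :=
  ⨆ x ∈ S, ‖f x‖ₑ

/-- The Hölder seminorm `[f]_{0,α}` of `f` on `S`. -/
def holderSeminorm {F : Type*} [NormedAddCommGroup F] (α : ℝ≥0) (S : Set ℂ) (f : ℂ → F) : ℝ≥0∞ :=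
  eHolderNorm α (S.domRestrict f)

/-- The derivative of `g` with respect to arc length (counterclockwise) at the point `p` of the
circle with centre `z` and radius `r`. -/
def arcDeriv (z : ℂ) (r : ℝ) (g : ℂ → ℝ) (p : ℂ) : ℝ :=
  deriv (fun s : ℝ => g (z + (p - z) * Complex.exp (((s / r : ℝ) : ℂ) * Complex.I))) 0

/-- `‖g‖_∞` on the boundary. -/
def bdrySup {n : ℕ} (z : Fin (n + 1) → ℂ) (r : Fin (n + 1) → ℝ) (g : ℂ → ℝ) : ℝ≥0∞ :=
  supNorm (bdry z r) g

/-- `[g]_{0,α}` on the boundary: the largest of the seminorms on the boundary circles. -/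
def bdryHolder {n : ℕ} (α : ℝ≥0) (z : Fin (n + 1) → ℂ) (r : Fin (n + 1) → ℝ) (g : ℂ → ℝ) : ℝ≥0∞ :=
  ⨆ k, holderSeminorm α (Metric.sphere (z k) (r k)) g

/-- `‖g'‖_∞` on the boundary. -/
def bdryDerivSup {n : ℕ} (z : Fin (n + 1) → ℂ) (r : Fin (n + 1) → ℝ) (g : ℂ → ℝ) : ℝ≥0∞ :=
  ⨆ k, supNorm (Metric.sphere (z k) (r k)) (arcDeriv (z k) (r k) g)

/-- `[g']_{0,α}` on the boundary: the largest of the seminorms on the boundary circles. -/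
def bdryDerivHolder {n : ℕ} (α : ℝ≥0) (z : Fin (n + 1) → ℂ) (r : Fin (n + 1) → ℝ) (g : ℂ → ℝ) :
    ℝ≥0∞ :=
  ⨆ k, holderSeminorm α (Metric.sphere (z k) (r k)) (arcDeriv (z k) (r k) g)

/-- `g` is of class `C^{1,α}` on every boundary circle. -/
def IsC1Holder {n : ℕ} (α : ℝ≥0) (z : Fin (n + 1) → ℂ) (r : Fin (n + 1) → ℝ) (g : ℂ → ℝ) : Prop :=
  (∀ k, ContDiff ℝ 1 fun θ : ℝ => g (circleMap (z k) (r k) θ)) ∧ bdryDerivHolder α z r g ≠ ⊤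

/-- `u` solves `Δ u = 0` in `E`, `∂u/∂ν = g` on the boundary of `E` (`ν` is the outward unit normal
of `E`): `u` is harmonic in `E`, lies in `H¹(E)`, and satisfies the Neumann condition in the weak
sense, `∫_E Du · Dφ = ∫_{∂E} g φ dS` for all smooth `φ`. Every classical solution, of class `C²` in
`E` and `C¹` up to the boundary, is one by Green's formula. -/
structure IsNeumannSolution {n : ℕ} (z : Fin (n + 1) → ℂ) (r : Fin (n + 1) → ℝ)
    (g u : ℂ → ℝ) : Prop where
  harmonic : HarmonicOnNhd u (domain z r)
  memLp : MemLp u 2 (volume.restrict (domain z r))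
  memLp_deriv : MemLp (fderiv ℝ u) 2 (volume.restrict (domain z r))
  neumann : ∀ φ : ℂ → ℝ, ContDiff ℝ ∞ φ →
    ∫ x in domain z r, (fderiv ℝ u x 1 * fderiv ℝ φ x 1 +
        fderiv ℝ u x Complex.I * fderiv ℝ φ x Complex.I) =
      ∑ k, r k * ∫ θ in (0 : ℝ)..(2 * Real.pi),
        g (circleMap (z k) (r k) θ) * φ (circleMap (z k) (r k) θ)

end PerforatedDisk

end

/-! Write f = ∂u/∂x − i ∂u/∂y (`cgrad u`). It is holomorphic in E, |f| = |Du|, and |f'| controls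
|D²u|. On a boundary circle with centre p and radius r the Neumann condition prescribes Re((w − p)
f(w)) = ± r g. So f solves a Riemann–Hilbert problem at each circle, and it can be written down
there by Cauchy integrals.

Near one circle, let h = (w − p) f and apply Cauchy's formula between this circle and the parallel
circle at distance d inside E. On the boundary circle h = 2 Re h − conj h. The first term is given
data. The Cauchy integral of the second is moved, by reflection in the circle, to the mirror image
of the parallel circle (`conj_cauchyInt_reflect`). Hence f is the Cauchy integral of the data 2 r g
plus two integrals over circles at distance at least a multiple of d, which are controlled by sup
|f| on the parallel circle. The weak form of the boundary condition suffices, because the Cauchy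
kernel, cut off near its pole, provides admissible test functions
(`HasBoundaryFlux.tendsto_cauchyInt`). The derivative of the Cauchy integral of an α-Hölder density
is O(δ^(α−1)) at distance δ from the circle (`norm_cauchyInt_two_le`). For f'' one integrates by
parts once, and g' takes the place of g (`HasBoundaryFlux.hasDerivAt`). Away from the circles,
interior estimates bound f, f', f'' by the L² norm K of Du.

A bound |F'| ≤ A + N t^(α−1), where t is the distance to the boundary, makes F bounded and α-Hölder,
by the argument of Hardy and Littlewood (`DerivBound.sup_le`, `DerivBound.holder_le`). With F = f
and F = f' this gives all four estimates, with K still on the right.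

It remains to bound K. The regularity already obtained justifies a limit form of ∫|Du|² = ∫ g u: on
parallel circles the flux is at most r_k sup|g| plus an error that tends to 0
(`HasBoundaryFlux.abs_re_le`), and ∫|u| over such a circle is bounded by integrals over a strip of
width d (`integral_abs_circleMap_le`). The strips are disjoint and their total area is O(n d r_0),
so Cauchy–Schwarz yields K² ≤ C sup|g| d^(−1) (n d r_0)^(1/2) (‖u‖₂ + d K). Now ‖u‖₂ ≤ C_P K, a
scaled test function shows C_P ≥ κ d (`exists_mul_le_poincareConst`), and |E|^(1/2) ≥ d. Together
these give d² K ≤ C₀ B sup|g| (`exists_energy_bound`). -/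

namespace PerforatedDisk

open Metric Set Filter Topology Complex

/-! ### Polar coordinates and Green's formula on annuli. -/

section Annulus

/-- The closed annulus with centre `p` and radii `a`, `b`. -/
def closedAnnulus (p : ℂ) (a b : ℝ) : Set ℂ := {w | a ≤ ‖w - p‖ ∧ ‖w - p‖ ≤ b}

/-- The open annulus with centre `p` and radii `a`, `b`. -/
def openAnnulus (p : ℂ) (a b : ℝ) : Set ℂ := {w | a < ‖w - p‖ ∧ ‖w - p‖ < b}

lemma isOpen_openAnnulus (p : ℂ) (a b : ℝ) : IsOpen (openAnnulus p a b) :=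
  (isOpen_lt (by fun_prop) (by fun_prop)).and (isOpen_lt (by fun_prop) (by fun_prop))

lemma isClosed_closedAnnulus (p : ℂ) (a b : ℝ) : IsClosed (closedAnnulus p a b) :=
  (isClosed_le (by fun_prop) (by fun_prop)).and (isClosed_le (by fun_prop) (by fun_prop))

lemma norm_circleMap_sub (p : ℂ) {ρ : ℝ} (hρ : 0 ≤ ρ) (θ : ℝ) : ‖circleMap p ρ θ - p‖ = ρ := by
  simp [circleMap, abs_of_nonneg hρ]

lemma continuous_circleMap_prod (p : ℂ) : Continuous fun x : ℝ × ℝ => circleMap p x.1 x.2 := by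
  unfold circleMap; fun_prop

lemma continuousOn_comp_circleMap {E : Type*} [TopologicalSpace E] {p : ℂ} {a b : ℝ} (ha : 0 ≤ a)
    {F : ℂ → E} (hF : ContinuousOn F (closedAnnulus p a b)) (s : Set ℝ) :
    ContinuousOn (fun x : ℝ × ℝ => F (circleMap p x.1 x.2)) (Icc a b ×ˢ s) := by
  refine hF.comp (continuous_circleMap_prod p).continuousOn fun x hx => ?_
  have h0 : 0 ≤ x.1 := ha.trans hx.1.1
  simp only [closedAnnulus, mem_ofPred_eq, norm_circleMap_sub p h0]
  exact hx.1

lemma setIntegral_annulus {E : Type*} [NormedAddCommGroup E] [NormedSpace ℝ E]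
    {p : ℂ} {a b : ℝ} (ha : 0 < a) (hab : a ≤ b) {F : ℂ → E}
    (hF : ContinuousOn F (closedAnnulus p a b)) :
    ∫ w in openAnnulus p a b, F w =
      ∫ ρ in a..b, ∫ θ in (0 : ℝ)..2 * Real.pi, ρ • F (circleMap p ρ θ) := by
  have hcont : ContinuousOn (fun x : ℝ × ℝ => x.1 • F (circleMap p x.1 x.2))
      (Icc a b ×ˢ Icc (-Real.pi) Real.pi) :=
    continuous_fst.continuousOn.smul (continuousOn_comp_circleMap ha.le hF _)
  have hint : IntegrableOn (fun x : ℝ × ℝ => x.1 • F (circleMap p x.1 x.2))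
      (Ioo a b ×ˢ Ioo (-Real.pi) Real.pi) :=
    (hcont.integrableOn_compact (isCompact_Icc.prod isCompact_Icc)).mono_set
      (prod_mono Ioo_subset_Icc_self Ioo_subset_Icc_self)
  have hmeas := (isOpen_openAnnulus p a b).measurableSet
  have h1 : ∫ w in openAnnulus p a b, F w =
      ∫ w, (openAnnulus 0 a b).indicator (fun w => F (p + w)) w := by
    rw [← integral_indicator hmeas, ← integral_add_left_eq_self _ p]
    congr 1; ext w
    simp [indicator, openAnnulus]
  rw [h1, ← Complex.integral_comp_polarCoord_symm]
  have h2 : ∀ x ∈ Complex.polarCoord.target,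
      x.1 • (openAnnulus 0 a b).indicator (fun w => F (p + w)) (Complex.polarCoord.symm x) =
      (Ioo a b ×ˢ Ioo (-Real.pi) Real.pi).indicator
        (fun x : ℝ × ℝ => x.1 • F (circleMap p x.1 x.2)) x := by
    intro x hx
    rw [Complex.polarCoord_target] at hx
    have hx0 : 0 < x.1 := hx.1
    have he : Complex.polarCoord.symm x = x.1 * cexp (x.2 * I) := by
      rw [Complex.polarCoord_symm_apply, Complex.exp_mul_I, ofReal_cos, ofReal_sin]
    have hn : ‖Complex.polarCoord.symm x‖ = x.1 := by
      rw [Complex.norm_polarCoord_symm, abs_of_pos hx0]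
    by_cases hxm : x.1 ∈ Ioo a b
    · rw [indicator_of_mem, indicator_of_mem, he]
      · rfl
      · exact ⟨hxm, hx.2⟩
      · simpa [openAnnulus, hn, abs_of_pos hx0] using hxm
    · rw [indicator_of_notMem, indicator_of_notMem, smul_zero]
      · exact fun h => hxm h.1
      · simpa [openAnnulus, hn, abs_of_pos hx0] using hxm
  rw [show polarCoord.target = Complex.polarCoord.target from rfl,
    setIntegral_congr_fun (Complex.polarCoord.open_target.measurableSet) h2,
    setIntegral_indicator (measurableSet_Ioo.prod measurableSet_Ioo), Complex.polarCoord_target,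
    inter_eq_right.2 (prod_mono (fun x (hx : x ∈ Ioo a b) => mem_Ioi.2 (ha.trans hx.1)) subset_rfl),
    Measure.volume_eq_prod, setIntegral_prod _ hint, intervalIntegral.integral_of_le hab,
    ← integral_Ioc_eq_integral_Ioo]
  refine setIntegral_congr_fun measurableSet_Ioc fun ρ _ => ?_
  -- Polar coordinates use angles in (−π, π); periodicity moves the integral to (0, 2π).
  have hper : Function.Periodic (fun θ => ρ • F (circleMap p ρ θ)) (2 * Real.pi) := fun θ => by
    simp [periodic_circleMap p ρ θ]
  have := hper.intervalIntegral_add_eq (-Real.pi) 0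
  rw [zero_add, show -Real.pi + 2 * Real.pi = Real.pi by ring,
    intervalIntegral.integral_of_le (by linarith [Real.pi_pos]), integral_Ioc_eq_integral_Ioo] at this
  exact this

lemma hasFDerivAt_circleMap_prod (p : ℂ) (x : ℝ × ℝ) :
    HasFDerivAt (fun x : ℝ × ℝ => circleMap p x.1 x.2)
      ((ContinuousLinearMap.fst ℝ ℝ ℝ).smulRight (cexp (x.2 * I)) +
        (ContinuousLinearMap.snd ℝ ℝ ℝ).smulRight ((x.1 : ℂ) * (I * cexp (x.2 * I)))) x := by
  have h1 : HasFDerivAt (fun x : ℝ × ℝ => (x.1 : ℂ))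
      (ofRealCLM.comp (ContinuousLinearMap.fst ℝ ℝ ℝ)) x :=
    (ofRealCLM.hasFDerivAt).comp x (ContinuousLinearMap.fst ℝ ℝ ℝ).hasFDerivAt
  have h2 : HasFDerivAt (fun x : ℝ × ℝ => cexp (x.2 * I))
      ((ContinuousLinearMap.snd ℝ ℝ ℝ).smulRight (I * cexp (x.2 * I))) x := by
    have h3 : HasDerivAt (fun t : ℝ => cexp (t * I)) (I * cexp (x.2 * I)) x.2 := by
      have := ((hasDerivAt_id (x.2 : ℂ)).mul_const I).cexp.comp_ofReal
      simpa [mul_comm] using this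
    exact h3.hasFDerivAt.comp x (ContinuousLinearMap.snd ℝ ℝ ℝ).hasFDerivAt
  have := (h1.mul h2).const_add p
  refine this.congr_fderiv ?_
  ext <;> simp

/-- Green's formula on an annulus for the product of a holomorphic and a real function. -/
lemma green_annulus {p : ℂ} {a b : ℝ} (ha : 0 < a) (hab : a ≤ b) {f : ℂ → ℂ} {φ : ℂ → ℝ}
    {U : Set ℂ} (hU : IsOpen U) (hUs : closedAnnulus p a b ⊆ U) (hf : DifferentiableOn ℂ f U)
    (hφ : ContDiffOn ℝ 1 φ U) :
    (∫ ρ in a..b, ∫ θ in (0 : ℝ)..2 * Real.pi, (ρ : ℂ) * (f (circleMap p ρ θ) *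
        (fderiv ℝ φ (circleMap p ρ θ) 1 + I * fderiv ℝ φ (circleMap p ρ θ) I))) =
      (∫ θ in (0 : ℝ)..2 * Real.pi,
        (b * cexp (θ * I)) * (f (circleMap p b θ) * φ (circleMap p b θ))) -
      ∫ θ in (0 : ℝ)..2 * Real.pi,
        (a * cexp (θ * I)) * (f (circleMap p a θ) * φ (circleMap p a θ)) := by
  set P : ℝ × ℝ → ℂ := fun x => circleMap p x.1 x.2 with hP
  set F : ℂ → ℂ := fun w => f w * φ w with hF
  have hφd : ∀ w ∈ U, HasFDerivAt φ (fderiv ℝ φ w) w := fun w hw =>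
    ((hφ.contDiffAt (hU.mem_nhds hw)).differentiableAt one_ne_zero).hasFDerivAt
  have hfd : ∀ w ∈ U, HasFDerivAt f ((ContinuousLinearMap.toSpanSingleton ℂ (deriv f w)).restrictScalars ℝ) w := fun w hw =>
    ((hf.differentiableAt (hU.mem_nhds hw)).hasDerivAt.hasFDerivAt).restrictScalars ℝ
  set F' : ℂ → ℂ →L[ℝ] ℂ := fun w => f w • (ofRealCLM.comp (fderiv ℝ φ w)) +
    (φ w : ℂ) • ((ContinuousLinearMap.toSpanSingleton ℂ (deriv f w)).restrictScalars ℝ) with hF'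
  have hFd : ∀ w ∈ U, HasFDerivAt F (F' w) w := fun w hw =>
    (hfd w hw).mul ((ofRealCLM.hasFDerivAt (x := φ w)).comp w (hφd w hw))
  have hPU : ∀ x ∈ Icc a b ×ˢ Icc (0 : ℝ) (2 * Real.pi), P x ∈ U := fun x hx => hUs (by
    simp only [closedAnnulus, mem_ofPred_eq, hP, norm_circleMap_sub p (ha.le.trans hx.1.1)]
    exact hx.1)
  have hFc : ContinuousOn F (closedAnnulus p a b) := fun w hw =>
    (hFd w (hUs hw)).continuousAt.continuousWithinAt
  have hFPc := continuousOn_comp_circleMap ha.le hFc (Icc 0 (2 * Real.pi))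
  have hpi : (0 : ℝ) ≤ 2 * Real.pi := by positivity
  set P' : ℝ × ℝ → ℝ × ℝ →L[ℝ] ℂ := fun x =>
    ((ContinuousLinearMap.fst ℝ ℝ ℝ).smulRight (cexp (x.2 * I)) +
        (ContinuousLinearMap.snd ℝ ℝ ℝ).smulRight ((x.1 : ℂ) * (I * cexp (x.2 * I)))) with hP'
  have hD1 : ∀ x ∈ Icc a b ×ˢ Icc (0 : ℝ) (2 * Real.pi),
      HasFDerivAt (fun x : ℝ × ℝ => ((x.1 : ℂ) * cexp (x.2 * I)) * F (P x)) ((((x.1 : ℂ) * cexp (x.2 * I)) •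
        ((F' (P x)).comp (P' x))) + F (P x) • P' x) x := by
    intro x hx
    have h1 : HasFDerivAt (fun x : ℝ × ℝ => (x.1 : ℂ) * cexp (x.2 * I)) (P' x) x := by
      simpa only [circleMap, zero_add] using hasFDerivAt_circleMap_prod 0 x
    exact h1.mul ((hFd _ (hPU x hx)).comp x (hasFDerivAt_circleMap_prod p x))
  have hD2 : ∀ x ∈ Icc a b ×ˢ Icc (0 : ℝ) (2 * Real.pi),
      HasFDerivAt (fun x : ℝ × ℝ => (I * cexp (x.2 * I)) * F (P x)) (((I * cexp (x.2 * I)) •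
        ((F' (P x)).comp (P' x))) +
        F (P x) • (ContinuousLinearMap.snd ℝ ℝ ℝ).smulRight (-cexp (x.2 * I))) x := by
    intro x hx
    have h1 : HasFDerivAt (fun x : ℝ × ℝ => I * cexp (x.2 * I))
        ((ContinuousLinearMap.snd ℝ ℝ ℝ).smulRight (-cexp (x.2 * I))) x := by
      have h3 : HasDerivAt (fun t : ℝ => I * cexp (t * I)) (-cexp (x.2 * I)) x.2 := by
        have := (((hasDerivAt_id' (x.2 : ℂ)).mul_const I).cexp.const_mul I).comp_ofReal
        convert this using 1

        linear_combination (-cexp (x.2 * I)) * I_mul_I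
      exact h3.hasFDerivAt.comp x (ContinuousLinearMap.snd ℝ ℝ ℝ).hasFDerivAt
    exact h1.mul ((hFd _ (hPU x hx)).comp x (hasFDerivAt_circleMap_prod p x))
  -- This is the identity e^{iθ} (∂_ρ + (i/ρ) ∂_θ) = ∂_x + i ∂_y, multiplied by ρ. The right-hand
  -- operator annihilates the holomorphic factor f, so it only acts on φ.
  have hsum : ∀ x ∈ Icc a b ×ˢ Icc (0 : ℝ) (2 * Real.pi),
      fderiv ℝ (fun x : ℝ × ℝ => ((x.1 : ℂ) * cexp (x.2 * I)) * F (P x)) x (1, 0) +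
      fderiv ℝ (fun x : ℝ × ℝ => (I * cexp (x.2 * I)) * F (P x)) x (0, 1) =
      (x.1 : ℂ) * (f (P x) * (fderiv ℝ φ (P x) 1 + I * fderiv ℝ φ (P x) I)) := by
    intro x hx
    rw [(hD1 x hx).fderiv, (hD2 x hx).fderiv]
    set e := cexp (x.2 * I) with he
    have hlin : ∀ v : ℂ, fderiv ℝ φ (P x) v = v.re * fderiv ℝ φ (P x) 1 + v.im * fderiv ℝ φ (P x) I := by
      intro v
      conv_lhs => rw [show v = v.re • (1 : ℂ) + v.im • I by simp]
      rw [map_add, map_smul, map_smul]; rfl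
    have he1 : e = e.re + e.im * I := (re_add_im e).symm
    have he2 : (e.re : ℂ) ^ 2 + (e.im : ℂ) ^ 2 = 1 := by
      have : ‖e‖ = 1 := by rw [he]; exact norm_exp_ofReal_mul_I _
      have h := normSq_eq_norm_sq e
      rw [this, normSq_apply] at h
      exact_mod_cast (by linarith : e.re ^ 2 + e.im ^ 2 = 1)
    simp [hF', hP']
    rw [hlin e, hlin (x.1 * (I * e))]
    simp [← he]
    have hee : e * (e.re - e.im * I) = 1 := by
      nth_rewrite 1 [he1]
      linear_combination he2 - (e.im : ℂ) ^ 2 * I_mul_I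
    linear_combination (x.1 : ℂ) * f (P x) * (fderiv ℝ φ (P x) 1 + I * fderiv ℝ φ (P x) I) * hee +
      ((x.1 : ℂ) * e ^ 2 * φ (P x) * deriv f (P x) +
        x.1 * f (P x) * fderiv ℝ φ (P x) I * e * e.im) * I_mul_I
  have key := integral2_divergence_prod_of_hasFDerivAt_off_countable
    (fun x => ((x.1 : ℂ) * cexp (x.2 * I)) * F (P x))
    (fun x => (I * cexp (x.2 * I)) * F (P x))
    (fun x => fderiv ℝ (fun x : ℝ × ℝ => ((x.1 : ℂ) * cexp (x.2 * I)) * F (P x)) x)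
    (fun x => fderiv ℝ (fun x : ℝ × ℝ => (I * cexp (x.2 * I)) * F (P x)) x)
    a 0 b (2 * Real.pi) ∅ countable_empty ?_ ?_ ?_ ?_ ?_
  rotate_left
  · rw [uIcc_of_le hab, uIcc_of_le hpi]
    exact ContinuousOn.mul (by fun_prop) hFPc
  · rw [uIcc_of_le hab, uIcc_of_le hpi]
    exact ContinuousOn.mul (by fun_prop) hFPc
  · rw [min_eq_left hab, max_eq_right hab, min_eq_left hpi, max_eq_right hpi]
    intro x hx
    exact (hD1 x (prod_mono Ioo_subset_Icc_self Ioo_subset_Icc_self hx.1)).differentiableAt.hasFDerivAt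
  · rw [min_eq_left hab, max_eq_right hab, min_eq_left hpi, max_eq_right hpi]
    intro x hx
    exact (hD2 x (prod_mono Ioo_subset_Icc_self Ioo_subset_Icc_self hx.1)).differentiableAt.hasFDerivAt
  · rw [uIcc_of_le hab, uIcc_of_le hpi]
    refine ContinuousOn.integrableOn_compact (isCompact_Icc.prod isCompact_Icc) ?_
    refine ContinuousOn.congr ?_ hsum
    have hφ' : ContinuousOn (fderiv ℝ φ) (closedAnnulus p a b) :=
      (hφ.continuousOn_fderiv_of_isOpen hU le_rfl).mono hUs
    exact ContinuousOn.mul (by fun_prop) (continuousOn_comp_circleMap ha.le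
      (F := fun w => f w * (fderiv ℝ φ w 1 + I * fderiv ℝ φ w I)) (by
        have := hf.continuousOn.mono hUs
        fun_prop) _)
  have h3 : ∀ ρ ∈ uIcc a b, ∀ θ ∈ uIcc (0 : ℝ) (2 * Real.pi), _ = _ := fun ρ hρ θ hθ =>
    hsum (ρ, θ) (by rw [uIcc_of_le hab] at hρ; rw [uIcc_of_le hpi] at hθ; exact ⟨hρ, hθ⟩)
  rw [intervalIntegral.integral_congr fun ρ hρ => intervalIntegral.integral_congr (h3 ρ hρ)] at key
  -- The sides θ = 0 and θ = 2π of the rectangle cancel.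
  have hper : ∀ ρ, circleMap p ρ (2 * Real.pi) = circleMap p ρ 0 := fun ρ => by
    simpa using periodic_circleMap p ρ 0
  simpa [hP, hper, hF] using key

end Annulus

/-! ### Cauchy integrals over a circle and their growth at the circle. -/

section CauchyIntegral

lemma norm_circleMap_sub_circleMap (p : ℂ) {r : ℝ} (hr : 0 ≤ r) (a b : ℝ) :
    ‖circleMap p r a - circleMap p r b‖ = 2 * r * |Real.sin ((a - b) / 2)| := by
  have : circleMap p r a - circleMap p r b = r * cexp (b * I) * (cexp (I * ((a - b : ℝ) : ℂ)) - 1) := by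
    simp only [circleMap, mul_sub, mul_one, mul_assoc, ← Complex.exp_add]
    push_cast
    ring_nf
  rw [this, norm_mul, norm_mul, norm_exp_ofReal_mul_I, norm_exp_I_mul_ofReal_sub_one]
  simp [abs_of_nonneg hr]; ring

/-- Jordan's inequality |sin x| ≥ 2|x|/π, applied to the chord length. -/
lemma mul_abs_le_norm_circleMap_sub (p : ℂ) {r : ℝ} (hr : 0 ≤ r) {a b : ℝ}
    (hab : |a - b| ≤ Real.pi) :
    2 / Real.pi * r * |a - b| ≤ ‖circleMap p r a - circleMap p r b‖ := by
  rw [norm_circleMap_sub_circleMap p hr]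
  have := Real.mul_abs_le_abs_sin (x := (a - b) / 2) (by rw [abs_div, abs_two]; linarith)
  rw [abs_div, abs_two] at this
  calc 2 / Real.pi * r * |a - b| = 2 * r * (2 / Real.pi * (|a - b| / 2)) := by ring
    _ ≤ _ := by gcongr

lemma abs_sub_le_norm_circleMap_sub {p z : ℂ} {r : ℝ} (hr : 0 ≤ r) (θ : ℝ) :
    |‖z - p‖ - r| ≤ ‖circleMap p r θ - z‖ := by
  have h := abs_norm_sub_norm_le (z - p) (circleMap p r θ - p)
  rw [norm_circleMap_sub p hr] at h
  rwa [show z - p - (circleMap p r θ - p) = -(circleMap p r θ - z) by ring, norm_neg] at h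

/-- The integral of `D θ / (w - z) ^ m` over the circle `w = p + r exp (i θ)`. -/
noncomputable def cauchyInt (p : ℂ) (r : ℝ) (D : ℝ → ℂ) (m : ℕ) (z : ℂ) : ℂ :=
  ∫ θ in (0 : ℝ)..2 * Real.pi, D θ / (circleMap p r θ - z) ^ m

lemma norm_cauchyInt_le {p z : ℂ} {r δ M : ℝ} {D : ℝ → ℂ} (hδ : 0 < δ) (hr : 0 ≤ r)
    (hz : δ ≤ |‖z - p‖ - r|) (hD : ∀ θ, ‖D θ‖ ≤ M) (m : ℕ) :
    ‖cauchyInt p r D m z‖ ≤ 2 * Real.pi * M / δ ^ m := by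
  have h := intervalIntegral.norm_integral_le_of_norm_le_const (a := 0) (b := 2 * Real.pi)
    (f := fun θ => D θ / (circleMap p r θ - z) ^ m) (C := M / δ ^ m) fun θ _ => by
      rw [norm_div, norm_pow]
      have h1 : δ ≤ ‖circleMap p r θ - z‖ := hz.trans (abs_sub_le_norm_circleMap_sub hr θ)
      have h2 := (norm_nonneg _).trans (hD θ)
      gcongr
      exact hD θ
  rw [sub_zero, abs_of_nonneg (by positivity)] at h
  exact h.trans_eq (by ring)

lemma circleMap_sub_ne_zero {p z : ℂ} {r : ℝ} (hr : 0 ≤ r) (hz : ‖z - p‖ ≠ r) (θ : ℝ) :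
    circleMap p r θ - z ≠ 0 :=
  norm_pos_iff.1 ((abs_pos.2 (sub_ne_zero.2 hz)).trans_le (abs_sub_le_norm_circleMap_sub hr θ))

lemma continuous_div_circleMap_sub_pow {p z : ℂ} {r : ℝ} (hr : 0 ≤ r) (hz : ‖z - p‖ ≠ r)
    {D : ℝ → ℂ} (hD : Continuous D) (m : ℕ) :
    Continuous fun θ => D θ / (circleMap p r θ - z) ^ m :=
  hD.div (by fun_prop) fun θ => pow_ne_zero _ (circleMap_sub_ne_zero hr hz θ)

lemma hasDerivAt_cauchyInt {p z : ℂ} {r : ℝ} (hr : 0 ≤ r) (hz : ‖z - p‖ ≠ r) {D : ℝ → ℂ}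
    (hD : Continuous D) (m : ℕ) :
    HasDerivAt (cauchyInt p r D m) (m * cauchyInt p r D (m + 1) z) z := by
  have hδ : 0 < |‖z - p‖ - r| := abs_pos.2 (sub_ne_zero.2 hz)
  set δ := |‖z - p‖ - r| with hδd
  -- On the disk of radius δ/2 about z the kernel stays bounded, which provides the dominating
  -- function.
  have hball : ∀ x ∈ ball z (δ / 2), δ / 2 ≤ |‖x - p‖ - r| := fun x hx => by
    have h1 := abs_norm_sub_norm_le (z - p) (x - p)
    rw [sub_sub_sub_cancel_right] at h1
    have h2 : δ ≤ |‖z - p‖ - ‖x - p‖| + |‖x - p‖ - r| := by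
      rw [hδd]; exact (abs_sub_le _ _ _)
    have h3 := mem_ball'.1 hx
    rw [dist_eq_norm] at h3
    linarith
  have hne : ∀ x ∈ ball z (δ / 2), ‖x - p‖ ≠ r := fun x hx h => by
    have := hball x hx
    rw [h, sub_self, abs_zero] at this
    linarith
  obtain ⟨M, hM⟩ : ∃ M, ∀ θ ∈ Icc (0 : ℝ) (2 * Real.pi), ‖D θ‖ ≤ M :=
    isCompact_Icc.exists_bound_of_continuousOn hD.continuousOn
  have hpi : (0 : ℝ) ≤ 2 * Real.pi := by positivity
  have key := intervalIntegral.hasDerivAt_integral_of_dominated_loc_of_deriv_le (μ := volume)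
    (F := fun x θ => D θ / (circleMap p r θ - x) ^ m)
    (F' := fun x θ => m * (D θ / (circleMap p r θ - x) ^ (m + 1)))
    (a := 0) (b := 2 * Real.pi) (x₀ := z) (s := ball z (δ / 2))
    (bound := fun _ => m * (M / (δ / 2) ^ (m + 1)))
    (ball_mem_nhds z (by positivity)) ?_ ?_ ?_ ?_ ?_ ?_
  · have := key.2
    rw [intervalIntegral.integral_const_mul] at this
    exact this
  · filter_upwards [ball_mem_nhds z (half_pos hδ)] with x hx
    exact (continuous_div_circleMap_sub_pow hr (hne x hx) hD m).aestronglyMeasurable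
  · exact (continuous_div_circleMap_sub_pow hr hz hD m).intervalIntegrable _ _
  · exact ((continuous_div_circleMap_sub_pow hr hz hD (m + 1)).const_smul (m : ℂ)).aestronglyMeasurable
  · refine ae_of_all _ fun θ hθ x hx => ?_
    rw [norm_mul, norm_div, norm_pow, Complex.norm_natCast]
    have h1 := (hball x hx).trans (abs_sub_le_norm_circleMap_sub hr θ)
    rw [uIoc_of_le hpi] at hθ
    have h2 := hM θ (Ioc_subset_Icc_self hθ)
    have h3 := (norm_nonneg _).trans h2
    gcongr
  · exact intervalIntegrable_const
  · refine ae_of_all _ fun θ hθ x hx => ?_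
    have h0 := circleMap_sub_ne_zero hr (hne x hx) θ
    have h1 := (((hasDerivAt_id' x).const_sub (circleMap p r θ)).pow m).inv (pow_ne_zero m h0)
    have h2 := h1.const_mul (D θ)
    refine HasDerivAt.congr_deriv (f := fun x => D θ / (circleMap p r θ - x) ^ m) h2 ?_
    rcases m with _ | m
    · simp
    · simp
      field_simp
      ring

/-- Integration by parts on the circle. -/
lemma cauchyInt_two_eq {p z : ℂ} {r : ℝ} (hr : 0 ≤ r) (hz : ‖z - p‖ ≠ r) {G G' : ℝ → ℂ}
    (hG : ∀ θ, HasDerivAt G (G' θ) θ) (hG' : Continuous G') (hper : G (2 * Real.pi) = G 0) :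
    cauchyInt p r (fun θ => G θ * (r * cexp (θ * I))) 2 z =
      cauchyInt p r (fun θ => -I * G' θ) 1 z := by
  have hGc : Continuous G := continuous_iff_continuousAt.2 fun θ => (hG θ).continuousAt
  -- Since w' = i (w − p), the function i G/(w − z) is a periodic antiderivative of the difference
  -- of the two integrands.
  have h1 : ∀ θ : ℝ, HasDerivAt (fun θ : ℝ => I * G θ / (circleMap p r θ - z))
      (G θ * (r * cexp (θ * I)) / (circleMap p r θ - z) ^ 2 -
        -I * G' θ / (circleMap p r θ - z) ^ 1) θ := fun θ => by
    have h0 := circleMap_sub_ne_zero hr hz θ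
    have h2 := ((hG θ).const_mul I).div ((hasDerivAt_circleMap p r θ).sub_const z) h0
    refine h2.congr_deriv ?_
    rw [show circleMap 0 r θ = r * cexp (θ * I) by simp [circleMap], pow_one, div_sub_div _ _
      (pow_ne_zero 2 h0) h0, div_eq_div_iff (pow_ne_zero 2 h0) (mul_ne_zero (pow_ne_zero 2 h0) h0)]
    linear_combination -(r * cexp (θ * I) * G θ) * (circleMap p r θ - z) ^ 3 * I_mul_I
  have hc1 := continuous_div_circleMap_sub_pow hr hz
    (D := fun θ => G θ * (r * cexp (θ * I))) (by fun_prop) 2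
  have hc2 := continuous_div_circleMap_sub_pow hr hz (D := fun θ => -I * G' θ) (by fun_prop) 1
  have h3 := intervalIntegral.integral_eq_sub_of_hasDerivAt (a := 0) (b := 2 * Real.pi)
    (fun θ _ => h1 θ) ((hc1.sub hc2).intervalIntegrable _ _)
  rw [intervalIntegral.integral_sub (hc1.intervalIntegrable _ _) (hc2.intervalIntegrable _ _),
    hper, show circleMap p r (2 * Real.pi) = circleMap p r 0 by
      simpa using periodic_circleMap p r 0, sub_self] at h3
  exact sub_eq_zero.1 h3

/-- This is the majorant of a Hölder density of exponent α against 1/|w − z|², where |w − z| is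
comparable with δ + r|t|/π. As α − 2 < −1, the part near t = 0 dominates, and the bound does not
depend on r. -/
lemma integral_rpow_kernel_le {α r δ : ℝ} (hα : α < 1) (hr : 0 < r) (hδ : 0 < δ) :
    ∫ t in -Real.pi..Real.pi, r * (δ + r * |t| / Real.pi) ^ (α - 2) ≤
      2 * Real.pi / (1 - α) * δ ^ (α - 1) := by
  have hpi := Real.pi_pos
  have hcont : Continuous fun t : ℝ => r * (δ + r * |t| / Real.pi) ^ (α - 2) := by
    refine continuous_const.mul (Continuous.rpow_const (by fun_prop) fun t => Or.inl ?_)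
    positivity
  have hα' : 0 < 1 - α := by linarith
  have half : ∫ t in (0 : ℝ)..Real.pi, r * (δ + r * |t| / Real.pi) ^ (α - 2) ≤
      Real.pi / (1 - α) * δ ^ (α - 1) := by
    have hd : ∀ t ∈ uIcc 0 Real.pi, HasDerivAt
        (fun t => -(Real.pi / (1 - α)) * (δ + r * t / Real.pi) ^ (α - 1))
        (r * (δ + r * |t| / Real.pi) ^ (α - 2)) t := by
      intro t ht
      rw [uIcc_of_le hpi.le] at ht
      have hpos : 0 < δ + r * t / Real.pi := by have := ht.1; positivity
      have h1 : HasDerivAt (fun t => δ + r * t / Real.pi) (r / Real.pi) t := by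
        simpa using (((hasDerivAt_id' t).const_mul r).div_const Real.pi).const_add δ
      have h2 := (h1.rpow_const (p := α - 1) (Or.inl hpos.ne')).const_mul (-(Real.pi / (1 - α)))
      rw [abs_of_nonneg ht.1]
      refine h2.congr_deriv ?_
      rw [show α - 1 - 1 = α - 2 by ring]
      field_simp
      ring
    rw [intervalIntegral.integral_eq_sub_of_hasDerivAt hd (hcont.intervalIntegrable _ _)]
    have : 0 ≤ Real.pi / (1 - α) * (δ + r * Real.pi / Real.pi) ^ (α - 1) := by positivity
    simp only [mul_zero, zero_div, add_zero]
    linarith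
  have hneg : ∫ t in -Real.pi..0, r * (δ + r * |t| / Real.pi) ^ (α - 2) =
      ∫ t in (0 : ℝ)..Real.pi, r * (δ + r * |t| / Real.pi) ^ (α - 2) := by
    have := intervalIntegral.integral_comp_neg (a := 0) (b := Real.pi)
      (fun t => r * (δ + r * |t| / Real.pi) ^ (α - 2))
    simp only [abs_neg, neg_zero] at this
    exact this.symm
  rw [← intervalIntegral.integral_add_adjacent_intervals (hcont.intervalIntegrable _ 0)
    (hcont.intervalIntegrable _ _), hneg]
  calc _ ≤ Real.pi / (1 - α) * δ ^ (α - 1) + Real.pi / (1 - α) * δ ^ (α - 1) := add_le_add half half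
    _ = _ := by ring

/-- The derivative of the Cauchy integral of a Hölder continuous density blows up at most like
`δ ^ (α - 1)` at the circle. -/
lemma norm_cauchyInt_two_le {p z : ℂ} {r α N : ℝ} (hα₀ : 0 < α) (hα : α < 1) (hr : 0 < r)
    (hz : ‖z - p‖ ≠ r) {G : ℝ → ℂ} (hG : Continuous G) (hN : 0 ≤ N)
    (hGN : ∀ a b, ‖G a - G b‖ ≤ N * ‖circleMap p r a - circleMap p r b‖ ^ α) :
    ‖cauchyInt p r (fun θ => G θ * (r * cexp (θ * I))) 2 z‖ ≤
      8 * Real.pi / (1 - α) * N * |‖z - p‖ - r| ^ (α - 1) := by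
  set δ := |‖z - p‖ - r| with hδd
  have hδ : 0 < δ := abs_pos.2 (sub_ne_zero.2 hz)
  set θ₀ := arg (z - p) with hθ₀
  have hpi := Real.pi_pos
  -- The point of the circle closest to z. At the centre z = p all points are equally close, and arg
  -- 0 = 0 selects one of them.
  set w₀ := circleMap p r θ₀ with hw₀
  have hzw : ‖z - w₀‖ = δ := by
    have : z - w₀ = ((‖z - p‖ - r : ℝ) : ℂ) * cexp (θ₀ * I) := by
      rw [hw₀, circleMap]
      have := norm_mul_exp_arg_mul_I (z - p)
      rw [← hθ₀] at this
      push_cast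
      linear_combination -this
    rw [this, norm_mul, norm_exp_ofReal_mul_I, mul_one, norm_real, Real.norm_eq_abs]
  -- A constant G contributes nothing, by integration by parts, so G may be replaced by its
  -- increment from w₀.
  have hsub : cauchyInt p r (fun θ => G θ * (r * cexp (θ * I))) 2 z =
      cauchyInt p r (fun θ => (G θ - G θ₀) * (r * cexp (θ * I))) 2 z := by
    have h0 : cauchyInt p r (fun θ => G θ₀ * (r * cexp (θ * I))) 2 z = 0 := by
      rw [cauchyInt_two_eq hr.le hz (G := fun _ => G θ₀) (fun θ => hasDerivAt_const θ _)
        continuous_const rfl]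
      simp [cauchyInt]
    rw [← sub_zero (cauchyInt p r (fun θ => G θ * (r * cexp (θ * I))) 2 z), ← h0]
    simp only [cauchyInt]
    rw [← intervalIntegral.integral_sub]
    · congr 1; ext θ; ring
    · exact (continuous_div_circleMap_sub_pow hr.le hz (by fun_prop) 2).intervalIntegrable _ _
    · exact (continuous_div_circleMap_sub_pow hr.le hz (by fun_prop) 2).intervalIntegrable _ _
  -- As α > 0, the Hölder bound in terms of the chord forces periodicity.
  have hGper : ∀ θ, G (θ + 2 * Real.pi) = G θ := fun θ => by
    have := hGN (θ + 2 * Real.pi) θ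
    rw [periodic_circleMap p r θ, sub_self, norm_zero, Real.zero_rpow hα₀.ne', mul_zero] at this
    exact sub_eq_zero.1 (norm_le_zero_iff.1 this)
  set H : ℝ → ℂ := fun θ => (G θ - G θ₀) * (r * cexp (θ * I)) / (circleMap p r θ - z) ^ 2 with hH
  have hHper : Function.Periodic H (2 * Real.pi) := fun θ => by
    have he : cexp (((θ + 2 * Real.pi : ℝ) : ℂ) * I) = cexp (θ * I) := by
      push_cast
      rw [add_mul, Complex.exp_periodic]
    simp only [hH, hGper, periodic_circleMap p r θ, he]
  have hshift : cauchyInt p r (fun θ => (G θ - G θ₀) * (r * cexp (θ * I))) 2 z =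
      ∫ t in -Real.pi..Real.pi, H (θ₀ + t) := by
    rw [intervalIntegral.integral_comp_add_left (fun t => H t)]
    have := hHper.intervalIntegral_add_eq 0 (θ₀ + -Real.pi)
    rw [zero_add, show θ₀ + -Real.pi + 2 * Real.pi = θ₀ + Real.pi by ring] at this
    exact this
  rw [hsub, hshift]
  have hbd : ∀ t ∈ Icc (-Real.pi) Real.pi, ‖H (θ₀ + t)‖ ≤
      4 * N * (r * (δ + r * |t| / Real.pi) ^ (α - 2)) := by
    intro t ht
    set w := circleMap p r (θ₀ + t) with hw
    have h1 : δ ≤ ‖w - z‖ := abs_sub_le_norm_circleMap_sub hr.le _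
    -- The distance from z to w₀ is δ, the least distance from z to the circle. Hence |w − w₀| is
    -- controlled by |w − z|, and |w − z| dominates both δ and r|t|/π.
    have h2 : ‖w - w₀‖ ≤ 2 * ‖w - z‖ := by
      calc ‖w - w₀‖ = ‖(w - z) + (z - w₀)‖ := by ring_nf
        _ ≤ ‖w - z‖ + ‖z - w₀‖ := norm_add_le _ _
        _ ≤ 2 * ‖w - z‖ := by rw [hzw]; linarith
    have h3 : 2 / Real.pi * r * |t| ≤ ‖w - w₀‖ := by
      have := mul_abs_le_norm_circleMap_sub p hr.le (a := θ₀ + t) (b := θ₀)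
        (by rw [add_sub_cancel_left]; exact abs_le.2 ht)
      rwa [add_sub_cancel_left] at this
    have hpos : 0 < ‖w - z‖ := hδ.trans_le h1
    have h4 : (δ + r * |t| / Real.pi) / 2 ≤ ‖w - z‖ := by
      have : 2 / Real.pi * r * |t| = 2 * (r * |t| / Real.pi) := by ring
      linarith
    have hb : 0 < δ + r * |t| / Real.pi := by positivity
    have h5 : ‖w - z‖ ^ (α - 2) ≤ ((δ + r * |t| / Real.pi) / 2) ^ (α - 2) :=
      Real.rpow_le_rpow_of_nonpos (by positivity) h4 (by linarith)
    have h6 : ((δ + r * |t| / Real.pi) / 2) ^ (α - 2) =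
        2 ^ (2 - α) * (δ + r * |t| / Real.pi) ^ (α - 2) := by
      rw [Real.div_rpow hb.le (by norm_num), div_eq_mul_inv, ← Real.rpow_neg (by norm_num)]
      rw [show -(α - 2) = 2 - α by ring, mul_comm]
    have h7 : ‖H (θ₀ + t)‖ = ‖G (θ₀ + t) - G θ₀‖ * r / ‖w - z‖ ^ 2 := by
      simp only [hH, norm_div, norm_mul, norm_pow, norm_exp_ofReal_mul_I, mul_one, norm_real,
        Real.norm_eq_abs, abs_of_pos hr, hw]
    rw [h7]
    -- The Hölder bound contributes 2^α and the lower bound for |w − z| contributes 2^(2−α);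
    -- together they give the constant 4.
    calc ‖G (θ₀ + t) - G θ₀‖ * r / ‖w - z‖ ^ 2
        ≤ (N * (2 * ‖w - z‖) ^ α) * r / ‖w - z‖ ^ 2 := by
          gcongr
          refine (hGN _ _).trans ?_
          gcongr
      _ = N * r * 2 ^ α * ‖w - z‖ ^ (α - 2) := by
          rw [Real.mul_rpow (by norm_num) hpos.le, Real.rpow_sub hpos, Real.rpow_two]
          ring
      _ ≤ N * r * 2 ^ α * (2 ^ (2 - α) * (δ + r * |t| / Real.pi) ^ (α - 2)) := by
          rw [← h6]; gcongr
      _ = N * r * (2 ^ α * 2 ^ (2 - α)) * (δ + r * |t| / Real.pi) ^ (α - 2) := by ring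
      _ = _ := by
          rw [← Real.rpow_add (by norm_num), show α + (2 - α) = (2 : ℝ) by ring, Real.rpow_two]
          ring
  have hcont : Continuous fun t : ℝ => 4 * N * (r * (δ + r * |t| / Real.pi) ^ (α - 2)) := by
    refine continuous_const.mul (continuous_const.mul
      (Continuous.rpow_const (by fun_prop) fun t => Or.inl ?_))
    positivity
  have h8 := intervalIntegral.norm_integral_le_of_norm_le (μ := volume) (by linarith : -Real.pi ≤ Real.pi)
    (ae_of_all _ fun t ht => hbd t (Ioc_subset_Icc_self ht)) (hcont.intervalIntegrable _ _)
  refine h8.trans ?_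
  rw [intervalIntegral.integral_const_mul]
  calc _ ≤ 4 * N * (2 * Real.pi / (1 - α) * δ ^ (α - 1)) := by
        gcongr; exact integral_rpow_kernel_le hα hr hδ
    _ = _ := by ring

end CauchyIntegral

/-! ### Cauchy's formula on an annulus and reflection in a circle. -/

section Representation

lemma circleIntegral_eq_of_annulus {p : ℂ} {a b : ℝ} (ha : 0 < a) (hb : 0 < b) {F : ℂ → ℂ}
    {U : Set ℂ} (hU : IsOpen U) (hUs : closedAnnulus p (min a b) (max a b) ⊆ U)
    (hF : DifferentiableOn ℂ F U) : (∮ w in C(p, a), F w) = ∮ w in C(p, b), F w := by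
  wlog hab : a ≤ b generalizing a b
  · exact (this hb ha (by rwa [min_comm, max_comm]) (le_of_not_ge hab)).symm
  rw [min_eq_left hab, max_eq_right hab] at hUs
  have hsub : closedBall p b \ ball p a ⊆ U := fun w hw => hUs (by
    simpa [closedAnnulus, dist_eq_norm, and_comm] using hw)
  refine (circleIntegral_eq_of_differentiable_on_annulus_off_countable ha hab countable_empty
    (hF.continuousOn.mono hsub) fun w hw => ?_).symm
  refine hF.differentiableAt (hU.mem_nhds (hsub ?_))
  exact ⟨ball_subset_closedBall hw.1.1, fun h => hw.1.2 (ball_subset_closedBall h)⟩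

lemma circleIntegral_eq_integral (p : ℂ) (ρ : ℝ) (F : ℂ → ℂ) :
    (∮ w in C(p, ρ), F w) =
      I * ∫ θ in (0 : ℝ)..2 * Real.pi, (circleMap p ρ θ - p) * F (circleMap p ρ θ) := by
  rw [circleIntegral, ← intervalIntegral.integral_const_mul]
  congr 1; ext θ
  rw [deriv_circleMap, smul_eq_mul, circleMap_sub_center]
  ring

/-- On the circle dw = i (w − p) dθ. The factor w − p goes into the density, so the formulas below
carry 2π in place of 2πi. -/
lemma cauchyInt_eq_circleIntegral (p z : ℂ) (ρ : ℝ) (f : ℂ → ℂ) :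
    I * cauchyInt p ρ (fun θ => (circleMap p ρ θ - p) * f (circleMap p ρ θ)) 1 z =
      ∮ w in C(p, ρ), (w - z)⁻¹ • f w := by
  rw [circleIntegral_eq_integral, cauchyInt]
  congr 2; ext θ
  rw [smul_eq_mul]; ring

/-- Cauchy's formula on an annulus. -/
lemma cauchy_annulus {p z : ℂ} {a b : ℝ} (ha : 0 < a) (hz₁ : a < ‖z - p‖) (hz₂ : ‖z - p‖ < b)
    {f : ℂ → ℂ} {U : Set ℂ} (hU : IsOpen U) (hUs : closedAnnulus p a b ⊆ U)
    (hf : DifferentiableOn ℂ f U) :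
    2 * Real.pi * f z =
      cauchyInt p b (fun θ => (circleMap p b θ - p) * f (circleMap p b θ)) 1 z -
      cauchyInt p a (fun θ => (circleMap p a θ - p) * f (circleMap p a θ)) 1 z := by
  have hab : a < b := hz₁.trans hz₂
  have hb := ha.trans hab
  have hzU : z ∈ U := hUs ⟨hz₁.le, hz₂.le⟩
  -- The difference quotient of f at z is holomorphic across z, so its integrals over the two
  -- circles agree; expanding them gives Cauchy's formula.
  have hd : DifferentiableOn ℂ (dslope f z) U := (differentiableOn_dslope (hU.mem_nhds hzU)).2 hf
  have h1 := circleIntegral_eq_of_annulus ha hb hU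
    (by rwa [min_eq_left hab.le, max_eq_right hab.le]) hd
  have hcont : ∀ ρ, 0 < ρ → a ≤ ρ → ρ ≤ b → ‖z - p‖ ≠ ρ →
      (∮ w in C(p, ρ), dslope f z w) =
        (∮ w in C(p, ρ), (w - z)⁻¹ • f w) - (∮ w in C(p, ρ), (w - z)⁻¹) * f z := by
    intro ρ hρ h1 h2 h3
    have hne : ∀ w ∈ sphere p ρ, w ≠ z := fun w hw hwz => h3 (by
      rw [← hwz, ← dist_eq_norm]; exact hw)
    have hci : ContinuousOn (fun w : ℂ => (w - z)⁻¹) (sphere p ρ) := fun w hw =>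
      ((continuousAt_id.sub continuousAt_const).inv₀ (sub_ne_zero.2 (hne w hw))).continuousWithinAt
    have hfc : ContinuousOn f (sphere p ρ) := hf.continuousOn.mono fun w hw => hUs (by
      have : ‖w - p‖ = ρ := by rw [← dist_eq_norm]; exact hw
      simp only [closedAnnulus, mem_ofPred_eq, this]; exact ⟨h1, h2⟩)
    rw [← smul_eq_mul (∮ w in C(p, ρ), (w - z)⁻¹), ← circleIntegral.integral_smul_const,
      ← circleIntegral.integral_sub]
    · refine circleIntegral.integral_congr hρ.le fun w hw => ?_
      rw [dslope_of_ne _ (hne w hw), slope_def_field]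
      simp only [smul_eq_mul]
      ring
    · exact (hci.smul hfc).circleIntegrable hρ.le
    · exact (hci.smul continuousOn_const).circleIntegrable hρ.le
  rw [hcont a ha le_rfl hab.le hz₁.ne', hcont b hb hab.le le_rfl hz₂.ne,
    circleIntegral.integral_sub_inv_of_mem_ball (c := p) (w := z) (R := b)
      (by rwa [mem_ball, dist_eq_norm])] at h1
  have h0 : (∮ w in C(p, a), (w - z)⁻¹) = 0 := by
    refine circleIntegral_eq_zero_of_differentiable_on_off_countable ha.le countable_empty ?_ ?_
    · intro w hw
      refine ((continuousAt_id.sub continuousAt_const).inv₀ (sub_ne_zero.2 ?_)).continuousWithinAt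
      rintro rfl
      exact absurd (mem_closedBall.1 hw) (by rw [dist_eq_norm]; simpa using hz₁)
    · intro w hw
      refine ((differentiableAt_id).sub_const z).inv (sub_ne_zero.2 ?_)
      rintro rfl
      exact absurd (mem_ball.1 hw.1) (by rw [dist_eq_norm]; simpa using hz₁.le)
  rw [h0, ← cauchyInt_eq_circleIntegral, ← cauchyInt_eq_circleIntegral] at h1
  apply mul_left_cancel₀ I_ne_zero
  linear_combination h1

/-- Let w* = p + s²/conj(w − p) be the mirror image of w in the circle of radius s. Then conj(w* −
z) (w − p) = s² − conj(z − p) (w − p), so up to conjugation both sides integrate one function F,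
holomorphic between the circles of radius s and R. Moving the contour from s to R moves w* from the
circle of radius s to the one of radius s²/R. -/
lemma conj_cauchyInt_reflect {p z : ℂ} {s R : ℝ} (hs : 0 < s) (hR : 0 < R)
    (hz : (s < ‖z - p‖ ∧ ‖z - p‖ < R) ∨ (R < ‖z - p‖ ∧ ‖z - p‖ < s)) {f : ℂ → ℂ} {U : Set ℂ}
    (hU : IsOpen U) (hUs : closedAnnulus p (min s R) (max s R) ⊆ U)
    (hf : DifferentiableOn ℂ f U) :
    cauchyInt p s
        (fun θ => (starRingEnd ℂ) ((circleMap p s θ - p) * f (circleMap p s θ))) 1 z =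
      cauchyInt p (s ^ 2 / R)
        (fun θ => (starRingEnd ℂ) ((circleMap p R θ - p) * f (circleMap p R θ))) 1 z := by
  set k : ℂ := (starRingEnd ℂ) (z - p) with hk
  have hkn : ‖k‖ = ‖z - p‖ := by rw [hk, RCLike.norm_conj]
  set F : ℂ → ℂ := fun w => f w * (w - p) / (s ^ 2 - k * (w - p)) with hF
  set V : Set ℂ := U ∩ {w | (s : ℂ) ^ 2 - k * (w - p) ≠ 0} with hV
  have hVo : IsOpen V := hU.inter (isOpen_ne_fun (by fun_prop) (by fun_prop))
  -- The pole of F is the mirror image of z. As z lies between the two circles, the image lies on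
  -- the other side of the circle of radius s, outside the annulus.
  have hVs : closedAnnulus p (min s R) (max s R) ⊆ V := by
    intro w hw
    refine ⟨hUs hw, fun h0 => ?_⟩
    have h1 : ‖z - p‖ * ‖w - p‖ = s ^ 2 := by
      have := congrArg norm (sub_eq_zero.1 h0)
      rw [norm_mul, hkn, norm_pow, norm_real, Real.norm_eq_abs, abs_of_pos hs] at this
      exact this.symm
    obtain ⟨hw1, hw2⟩ := hw
    rcases hz with ⟨h2, h3⟩ | ⟨h2, h3⟩
    · rw [min_eq_left (h2.trans h3).le] at hw1
      nlinarith
    · rw [max_eq_left (h2.trans h3).le] at hw2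
      nlinarith [norm_nonneg (w - p), hR.trans h2]
  have hFd : DifferentiableOn ℂ F V := by
    intro w hw
    have := hf w hw.1
    refine ((this.mono inter_subset_left).mul (by fun_prop)).div (by fun_prop) hw.2
  have h1 := circleIntegral_eq_of_annulus hs hR hVo hVs hFd
  rw [circleIntegral_eq_integral, circleIntegral_eq_integral] at h1
  have h2 := congrArg (starRingEnd ℂ) (mul_left_cancel₀ I_ne_zero h1)
  rw [← intervalIntegral.intervalIntegral_conj, ← intervalIntegral.intervalIntegral_conj] at h2
  have h3 : ∀ ρ : ℝ, 0 < ρ → ∀ θ : ℝ,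
      (starRingEnd ℂ) ((circleMap p ρ θ - p) * F (circleMap p ρ θ)) =
        (starRingEnd ℂ) ((circleMap p ρ θ - p) * f (circleMap p ρ θ)) /
          (circleMap p (s ^ 2 / ρ) θ - z) ^ 1 := by
    intro ρ hρ θ
    have hρ' : (ρ : ℂ) ≠ 0 := ofReal_ne_zero.2 hρ.ne'
    set e := cexp (θ * I) with he
    have hee : e * (starRingEnd ℂ) e = 1 := by
      rw [mul_conj, normSq_eq_norm_sq, he, norm_exp_ofReal_mul_I]; simp
    have hw : circleMap p ρ θ - p = ρ * e := by simp [circleMap, he]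
    have hw' : circleMap p (s ^ 2 / ρ) θ - z = (s ^ 2 - (z - p) * (ρ * (starRingEnd ℂ) e)) * (e / ρ) := by
      simp only [circleMap, ← he]
      push_cast
      field_simp
      linear_combination (z - p) * ρ * hee
    have hk' : (starRingEnd ℂ) k = z - p := by rw [hk, conj_conj]
    have hD : (starRingEnd ℂ) ((s : ℂ) ^ 2 - k * (ρ * e)) =
        s ^ 2 - (z - p) * (ρ * (starRingEnd ℂ) e) := by
      rw [map_sub, map_mul, map_mul, hk', map_pow, conj_ofReal, conj_ofReal]
    have hFc : (starRingEnd ℂ) (F (circleMap p ρ θ)) =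
        (starRingEnd ℂ) (f (circleMap p ρ θ)) * (ρ * (starRingEnd ℂ) e) /
          (s ^ 2 - (z - p) * (ρ * (starRingEnd ℂ) e)) := by
      simp only [hF]
      rw [hw, map_div₀, hD, map_mul, map_mul, conj_ofReal]
    rw [map_mul, hFc, map_mul, hw', hw, pow_one, map_mul, conj_ofReal]
    have he0 : e ≠ 0 := Complex.exp_ne_zero _
    generalize (s : ℂ) ^ 2 - (z - p) * (ρ * (starRingEnd ℂ) e) = X
    by_cases hX : X = 0
    · simp [hX]
    · rw [mul_div_assoc', div_eq_div_iff hX (mul_ne_zero hX (div_ne_zero he0 hρ'))]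
      field_simp
      linear_combination (starRingEnd ℂ) e * (starRingEnd ℂ) (f (circleMap p ρ θ)) * hee
  simp only [h3 s hs, h3 R hR] at h2
  rw [show s ^ 2 / s = s by field_simp] at h2
  exact h2

/-- A function that is holomorphic on an annulus, expressed by the real part of `(w - p) f(w)` on
one of the circles and the values of `f` on the other one. -/
lemma representation_annulus {p z : ℂ} {s R σ : ℝ} (hs : 0 < s) (hR : 0 < R)
    (hz : (σ = -1 ∧ s < ‖z - p‖ ∧ ‖z - p‖ < R) ∨ (σ = 1 ∧ R < ‖z - p‖ ∧ ‖z - p‖ < s))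
    {f : ℂ → ℂ} {U : Set ℂ} (hU : IsOpen U)
    (hUs : closedAnnulus p (min s R) (max s R) ⊆ U) (hf : DifferentiableOn ℂ f U) :
    2 * Real.pi * f z = σ * (2 * cauchyInt p s (fun θ =>
        ((((circleMap p s θ - p) * f (circleMap p s θ)).re : ℝ) : ℂ)) 1 z -
      cauchyInt p (s ^ 2 / R)
        (fun θ => (starRingEnd ℂ) ((circleMap p R θ - p) * f (circleMap p R θ))) 1 z -
      cauchyInt p R (fun θ => (circleMap p R θ - p) * f (circleMap p R θ)) 1 z) := by
  have hne : ‖z - p‖ ≠ s := by rcases hz with h | h; exacts [h.2.1.ne', h.2.2.ne]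
  have hfs : Continuous fun θ => f (circleMap p s θ) :=
    hf.continuousOn.comp_continuous (continuous_circleMap p s) fun θ => hUs (by
      simp only [closedAnnulus, mem_ofPred_eq, norm_circleMap_sub p hs.le]
      exact ⟨min_le_left _ _, le_max_left _ _⟩)
  have hhs : Continuous fun θ => (circleMap p s θ - p) * f (circleMap p s θ) :=
    Continuous.mul (by fun_prop) hfs
  -- On the circle that carries the data, h = 2 Re h − conj h; only the conjugate part is reflected.
  have h1 : cauchyInt p s (fun θ => (circleMap p s θ - p) * f (circleMap p s θ)) 1 z =
      2 * cauchyInt p s (fun θ =>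
        ((((circleMap p s θ - p) * f (circleMap p s θ)).re : ℝ) : ℂ)) 1 z -
      cauchyInt p s
        (fun θ => (starRingEnd ℂ) ((circleMap p s θ - p) * f (circleMap p s θ))) 1 z := by
    simp only [cauchyInt]
    rw [← intervalIntegral.integral_const_mul, ← intervalIntegral.integral_sub]
    · congr 1; ext θ
      rw [← mul_div_assoc, ← sub_div]
      congr 1
      rw [re_eq_add_conj]
      ring
    · exact (continuous_const.mul (continuous_div_circleMap_sub_pow hs.le hne
        (continuous_ofReal.comp (continuous_re.comp hhs)) 1)).intervalIntegrable _ _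
    · exact (continuous_div_circleMap_sub_pow hs.le hne
        (continuous_conj.comp hhs) 1).intervalIntegrable _ _
  rw [conj_cauchyInt_reflect hs hR (by tauto) hU hUs hf] at h1
  rcases hz with ⟨rfl, h2, h3⟩ | ⟨rfl, h2, h3⟩
  · rw [min_eq_left (h2.trans h3).le, max_eq_right (h2.trans h3).le] at hUs
    rw [cauchy_annulus hs h2 h3 hU hUs hf, h1]
    push_cast; ring
  · rw [min_eq_right (h2.trans h3).le, max_eq_left (h2.trans h3).le] at hUs
    rw [cauchy_annulus hR h2 h3 hU hUs hf, h1]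
    push_cast; ring

end Representation

/-! ### The signed distance to a circle. -/

section Level

/-- The signed distance to the circle with centre `p` and radius `r`: positive inside for `σ = 1`,
positive outside for `σ = -1`. -/
noncomputable def level (σ : ℝ) (p : ℂ) (r : ℝ) (x : ℂ) : ℝ := σ * (r - ‖x - p‖)

lemma continuous_level (σ : ℝ) (p : ℂ) (r : ℝ) : Continuous (level σ p r) := by
  unfold level; fun_prop

lemma level_circleMap {σ r t : ℝ} (hσ : σ = 1 ∨ σ = -1) (p : ℂ) (h : 0 ≤ r - σ * t) (θ : ℝ) :
    level σ p r (circleMap p (r - σ * t) θ) = t := by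
  rw [level, norm_circleMap_sub p h]
  rcases hσ with rfl | rfl <;> ring

lemma norm_sub_eq_of_level {σ r : ℝ} (hσ : σ = 1 ∨ σ = -1) (p x : ℂ) :
    ‖x - p‖ = r - σ * level σ p r x := by
  rw [level]
  rcases hσ with rfl | rfl <;> ring

lemma abs_level {σ r : ℝ} (hσ : σ = 1 ∨ σ = -1) (p x : ℂ) :
    |‖x - p‖ - r| = |level σ p r x| := by
  rw [norm_sub_eq_of_level (r := r) hσ p x]
  rcases hσ with rfl | rfl <;> simp

lemma abs_level_sub_le {σ r : ℝ} (hσ : σ = 1 ∨ σ = -1) (p x y : ℂ) :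
    |level σ p r x - level σ p r y| ≤ dist x y := by
  have h := abs_norm_sub_norm_le (x - p) (y - p)
  rw [sub_sub_sub_cancel_right] at h
  rw [level, level, dist_eq_norm]
  rcases hσ with rfl | rfl
  · rwa [show 1 * (r - ‖x - p‖) - 1 * (r - ‖y - p‖) = -(‖x - p‖ - ‖y - p‖) by ring, abs_neg]
  · rwa [show -1 * (r - ‖x - p‖) - -1 * (r - ‖y - p‖) = ‖x - p‖ - ‖y - p‖ by ring]

/-- A radial bump function or its complement, according to the side. On the inner side b < r is
needed, because the complementary bump must have a positive radius r − b. -/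
lemma exists_cutoff {σ r a b : ℝ} (hσ : σ = 1 ∨ σ = -1) (p : ℂ) (hr : 0 < r) (ha : 0 ≤ a)
    (hab : a < b) (hb : σ = 1 → b < r) :
    ∃ χ : ℂ → ℝ, ContDiff ℝ ∞ χ ∧ (∀ x, level σ p r x ≤ a → χ x = 1) ∧
      (∀ x, b ≤ level σ p r x → χ x = 0) := by
  rcases hσ with rfl | rfl
  · let B : ContDiffBump p := ⟨r - b, r - a, by linarith [hb rfl], by linarith⟩
    refine ⟨fun x => 1 - B x, contDiff_const.sub B.contDiff, fun x hx => ?_, fun x hx => ?_⟩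
    · rw [level] at hx
      change 1 - B x = 1
      rw [B.zero_of_le_dist, sub_zero]
      rw [dist_eq_norm]; change r - a ≤ _; linarith
    · rw [level] at hx
      change 1 - B x = 0
      rw [B.one_of_mem_closedBall, sub_self]
      rw [mem_closedBall, dist_eq_norm]; change _ ≤ r - b; linarith
  · let B : ContDiffBump p := ⟨r + a, r + b, by linarith, by linarith⟩
    refine ⟨B, B.contDiff, fun x hx => ?_, fun x hx => ?_⟩
    · rw [level] at hx
      rw [B.one_of_mem_closedBall]
      rw [mem_closedBall, dist_eq_norm]; change _ ≤ r + a; linarith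
    · rw [level] at hx
      rw [B.zero_of_le_dist]
      rw [dist_eq_norm]; change r + b ≤ _; linarith

end Level

/-! ### Representation of a holomorphic function by its weak boundary flux. -/

section LocalRepresentation

/-- Needed for the reflected circle, whose radius (r − σt)²/R varies with t while its density is
fixed. -/
lemma tendsto_cauchyInt_radius {p z : ℂ} {ρ₀ : ℝ} (hρ : 0 < ρ₀) (hz : ‖z - p‖ ≠ ρ₀) {D : ℝ → ℂ}
    (hD : Continuous D) :
    Tendsto (fun ρ => cauchyInt p ρ D 1 z) (𝓝 ρ₀) (𝓝 (cauchyInt p ρ₀ D 1 z)) := by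
  have hδ : 0 < |‖z - p‖ - ρ₀| := abs_pos.2 (sub_ne_zero.2 hz)
  set δ := |‖z - p‖ - ρ₀| with hδd
  have hpi : (0 : ℝ) ≤ 2 * Real.pi := by positivity
  obtain ⟨M, hM⟩ : ∃ M, ∀ θ ∈ Icc (0 : ℝ) (2 * Real.pi), ‖D θ‖ ≤ M :=
    isCompact_Icc.exists_bound_of_continuousOn hD.continuousOn
  have hev : ∀ᶠ ρ in 𝓝 ρ₀, 0 ≤ ρ ∧ δ / 2 < |‖z - p‖ - ρ| := by
    refine ((lt_mem_nhds hρ).mono fun _ => le_of_lt).and ?_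
    have : Tendsto (fun ρ => |‖z - p‖ - ρ|) (𝓝 ρ₀) (𝓝 δ) :=
      (continuous_const.sub continuous_id).abs.tendsto ρ₀
    exact this.eventually (lt_mem_nhds (half_lt_self hδ))
  have hne : ∀ ρ, δ / 2 < |‖z - p‖ - ρ| → ‖z - p‖ ≠ ρ := fun ρ h h' => by
    rw [h', sub_self, abs_zero] at h; linarith
  refine intervalIntegral.tendsto_integral_filter_of_dominated_convergence
    (fun _ => M / (δ / 2) ^ 1) ?_ ?_ intervalIntegrable_const ?_
  · filter_upwards [hev] with ρ hρ'
    exact (continuous_div_circleMap_sub_pow hρ'.1 (hne ρ hρ'.2) hD 1).aestronglyMeasurable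
  · filter_upwards [hev] with ρ hρ'
    refine ae_of_all _ fun θ hθ => ?_
    rw [uIoc_of_le hpi] at hθ
    have h2 := hM θ (Ioc_subset_Icc_self hθ)
    have h3 := (norm_nonneg _).trans h2
    have h1 := hρ'.2.le.trans (abs_sub_le_norm_circleMap_sub hρ'.1 θ)
    rw [norm_div, norm_pow]
    gcongr
  · refine ae_of_all _ fun θ _ => ?_
    refine Tendsto.div tendsto_const_nhds ?_ (pow_ne_zero _ (circleMap_sub_ne_zero hρ.le hz θ))
    have : Continuous fun ρ => (circleMap p ρ θ - z) ^ 1 := by unfold circleMap; fun_prop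
    exact this.tendsto ρ₀

/-- The weak form of the boundary condition `Re ((w - p) f(w)) = σ r γ` on a circle. -/
def HasBoundaryFlux (σ : ℝ) (p : ℂ) (r d : ℝ) (f : ℂ → ℂ) (γ : ℝ → ℝ) : Prop :=
  ∀ φ : ℂ → ℝ, ContDiff ℝ ∞ φ → (∀ x, d ≤ level σ p r x → φ x = 0) →
    Tendsto (fun t => ∫ θ in (0 : ℝ)..2 * Real.pi,
      ((circleMap p (r - σ * t) θ - p) * f (circleMap p (r - σ * t) θ)).re *
        φ (circleMap p (r - σ * t) θ)) (𝓝[>] 0)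
      (𝓝 (σ * r * ∫ θ in (0 : ℝ)..2 * Real.pi, γ θ * φ (circleMap p r θ)))

variable {σ r d : ℝ} {p : ℂ} {f : ℂ → ℂ} {γ : ℝ → ℝ}

/-- The real and imaginary parts of the Cauchy kernel w ↦ 1/(w − z), multiplied by a cutoff that is
1 near the circle and 0 near the pole, are admissible test functions. No boundary values of f are
needed. -/
lemma HasBoundaryFlux.tendsto_cauchyInt (h : HasBoundaryFlux σ p r d f γ)
    (hσ : σ = 1 ∨ σ = -1) (hr : 0 < r) (hd : σ = 1 → d < r)
    (hf : ContinuousOn f {x | 0 < level σ p r x ∧ level σ p r x < d}) (hγ : Continuous γ)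
    {z : ℂ} (hz₀ : 0 < level σ p r z) (hzd : level σ p r z < d) :
    Tendsto (fun t => cauchyInt p (r - σ * t) (fun θ =>
        ((((circleMap p (r - σ * t) θ - p) * f (circleMap p (r - σ * t) θ)).re : ℝ) : ℂ)) 1 z)
      (𝓝[>] 0) (𝓝 (cauchyInt p r (fun θ => ((σ * r * γ θ : ℝ) : ℂ)) 1 z)) := by
  set l := level σ p r z with hl
  obtain ⟨χ, hχ, hχ1, hχ0⟩ := exists_cutoff (a := l / 3) (b := 2 * l / 3) hσ p hr (by linarith)
    (by linarith) (fun h => by linarith [hd h])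
  have hK : ∀ x, x ≠ z → ContDiffAt ℝ ∞ (fun w : ℂ => (w - z)⁻¹) x := fun x hx =>
    (contDiffAt_id.sub contDiffAt_const).inv (sub_ne_zero.2 hx)
  have hsm : ∀ L : ℂ →L[ℝ] ℝ, ContDiff ℝ ∞ fun w : ℂ => χ w * L ((w - z)⁻¹) := by
    intro L
    rw [contDiff_iff_contDiffAt]
    intro x
    by_cases hx : x = z
    · have : (fun w : ℂ => χ w * L ((w - z)⁻¹)) =ᶠ[𝓝 x] fun _ => 0 := by
        have h1 : ∀ᶠ w in 𝓝 x, 2 * l / 3 < level σ p r w := by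
          refine (continuous_level σ p r).continuousAt.eventually (lt_mem_nhds ?_)
          rw [hx, ← hl]; linarith
        filter_upwards [h1] with w hw
        rw [hχ0 w hw.le, zero_mul]
      exact contDiffAt_const.congr_of_eventuallyEq this
    · exact hχ.contDiffAt.mul (L.contDiff.contDiffAt.comp x (hK x hx))
  have hzero : ∀ L : ℂ →L[ℝ] ℝ, ∀ x, d ≤ level σ p r x → χ x * L ((x - z)⁻¹) = 0 := fun L x hx => by
    rw [hχ0 x (by linarith), zero_mul]
  have h1 := h _ (hsm reCLM) (hzero reCLM)
  have h2 := h _ (hsm imCLM) (hzero imCLM)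
  have hne0 : ‖z - p‖ ≠ r := fun h => by
    rw [norm_sub_eq_of_level hσ (r := r) p z, ← hl] at h
    rcases hσ with rfl | rfl <;> linarith
  have comb : ∀ (ρ : ℝ) (v : ℝ → ℝ), Continuous v → 0 < ρ → ‖z - p‖ ≠ ρ →
      (∀ θ, level σ p r (circleMap p ρ θ) ≤ l / 3) →
      cauchyInt p ρ (fun θ => ((v θ : ℝ) : ℂ)) 1 z =
        ((∫ θ in (0 : ℝ)..2 * Real.pi,
          v θ * (χ (circleMap p ρ θ) * reCLM ((circleMap p ρ θ - z)⁻¹)) : ℝ) : ℂ) +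
        ((∫ θ in (0 : ℝ)..2 * Real.pi,
          v θ * (χ (circleMap p ρ θ) * imCLM ((circleMap p ρ θ - z)⁻¹)) : ℝ) : ℂ) * I := by
    intro ρ v hv hρ hne hlev
    have hci : Continuous fun θ => (circleMap p ρ θ - z)⁻¹ :=
      Continuous.inv₀ (by fun_prop) (circleMap_sub_ne_zero hρ.le hne)
    rw [← intervalIntegral.integral_ofReal, ← intervalIntegral.integral_ofReal,
      ← intervalIntegral.integral_mul_const, ← intervalIntegral.integral_add]
    · refine intervalIntegral.integral_congr fun θ _ => ?_
      simp only [hχ1 _ (hlev θ), one_mul, reCLM_apply, imCLM_apply, pow_one]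
      conv_lhs => rw [div_eq_mul_inv, ← re_add_im (circleMap p ρ θ - z)⁻¹]
      push_cast
      ring
    · simp only [hχ1 _ (hlev _), one_mul]
      exact (continuous_ofReal.comp (hv.mul (reCLM.continuous.comp hci))).intervalIntegrable _ _
    · simp only [hχ1 _ (hlev _), one_mul]
      exact ((continuous_ofReal.comp (hv.mul (imCLM.continuous.comp hci))).mul
        continuous_const).intervalIntegrable _ _
  have hlev0 : ∀ θ, level σ p r (circleMap p r θ) ≤ l / 3 := fun θ => by
    have := level_circleMap (t := 0) hσ p (by simpa using hr.le : 0 ≤ r - σ * 0) θ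
    rw [mul_zero, sub_zero] at this
    rw [this]; linarith
  rw [comb r _ (by fun_prop) hr hne0 hlev0]
  have h3 := ((continuous_ofReal.tendsto _).comp h1).add
    (((continuous_ofReal.tendsto _).comp h2).mul_const I)
  have e1 : ∀ ψ : ℝ → ℝ, σ * r * ∫ θ in (0 : ℝ)..2 * Real.pi, γ θ * ψ θ =
      ∫ θ in (0 : ℝ)..2 * Real.pi, σ * r * γ θ * ψ θ := fun ψ => by
    rw [← intervalIntegral.integral_const_mul]
    congr 1; ext θ; ring
  rw [e1, e1] at h3
  refine h3.congr' ?_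
  have hmin : 0 < min (l / 3) r := lt_min (by linarith) hr
  filter_upwards [Ioo_mem_nhdsGT hmin] with t ht
  have ht1 : t < l / 3 := ht.2.trans_le (min_le_left _ _)
  have ht2 : 0 < r - σ * t := by
    have := ht.2.trans_le (min_le_right _ _)
    rcases hσ with rfl | rfl
    · linarith
    · linarith [ht.1]
  have hlt : ∀ θ, level σ p r (circleMap p (r - σ * t) θ) = t := level_circleMap hσ p ht2.le
  refine (comb _ _ ?_ ht2 ?_ fun θ => ?_).symm
  · have hft : Continuous fun θ => f (circleMap p (r - σ * t) θ) :=
      hf.comp_continuous (continuous_circleMap _ _) fun θ => by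
        simp only [mem_ofPred_eq, hlt]
        exact ⟨ht.1, by linarith⟩
    exact continuous_re.comp (Continuous.mul (by fun_prop) hft)
  · intro h
    rw [norm_sub_eq_of_level hσ (r := r) p z, ← hl] at h
    rcases hσ with rfl | rfl <;> linarith
  · rw [hlt]; exact ht1.le

/-- A function that is holomorphic on one side of a circle, with prescribed boundary flux, is a sum
of Cauchy integrals over this circle and over two circles at a positive distance. -/
lemma HasBoundaryFlux.representation (h : HasBoundaryFlux σ p r d f γ)
    (hσ : σ = 1 ∨ σ = -1) (hr : 0 < r) (hdr : σ = 1 → d < r)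
    (hf : DifferentiableOn ℂ f {x | 0 < level σ p r x ∧ level σ p r x < 2 * d})
    (hγ : Continuous γ)
    {z : ℂ} (hz₀ : 0 < level σ p r z) (hzd : level σ p r z < d) :
    2 * Real.pi * f z = cauchyInt p r (fun θ => ((2 * r * γ θ : ℝ) : ℂ)) 1 z -
      σ * (cauchyInt p (r ^ 2 / (r - σ * d)) (fun θ => (starRingEnd ℂ)
          ((circleMap p (r - σ * d) θ - p) * f (circleMap p (r - σ * d) θ))) 1 z +
        cauchyInt p (r - σ * d)
          (fun θ => (circleMap p (r - σ * d) θ - p) * f (circleMap p (r - σ * d) θ)) 1 z) := by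
  have hd : 0 < d := hz₀.trans hzd
  set l := level σ p r z with hl
  set R := r - σ * d with hR
  have hzn : ‖z - p‖ = r - σ * l := norm_sub_eq_of_level hσ p z
  have hRpos : 0 < R := by
    rcases hσ with h | rfl
    · have := hdr h; rw [hR, h]; linarith
    · rw [hR]; linarith
  set U := {x | 0 < level σ p r x ∧ level σ p r x < 2 * d} with hU
  have hUo : IsOpen U := (isOpen_lt continuous_const (continuous_level σ p r)).and
    (isOpen_lt (continuous_level σ p r) continuous_const)
  have hfR : Continuous fun θ => (circleMap p R θ - p) * f (circleMap p R θ) := by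
    refine Continuous.mul (by fun_prop) (hf.continuousOn.comp_continuous
      (continuous_circleMap _ _) fun θ => ?_)
    rw [hU, mem_ofPred_eq, level_circleMap hσ p hRpos.le]
    exact ⟨hd, by linarith⟩
  -- The representation is first applied with the data on the circle at distance t, where f is
  -- holomorphic; then t → 0.
  have hrep : ∀ᶠ t in 𝓝[>] (0 : ℝ), σ * (2 * cauchyInt p (r - σ * t) (fun θ =>
        ((((circleMap p (r - σ * t) θ - p) * f (circleMap p (r - σ * t) θ)).re : ℝ) : ℂ)) 1 z -
      cauchyInt p ((r - σ * t) ^ 2 / R)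
        (fun θ => (starRingEnd ℂ) ((circleMap p R θ - p) * f (circleMap p R θ))) 1 z -
      cauchyInt p R (fun θ => (circleMap p R θ - p) * f (circleMap p R θ)) 1 z) =
      2 * Real.pi * f z := by
    filter_upwards [Ioo_mem_nhdsGT hz₀] with t ht
    refine (representation_annulus ?_ hRpos ?_ hUo ?_ hf).symm
    · rcases hσ with h | rfl
      · have := hdr h; rw [h]; linarith [ht.2]
      · linarith [ht.1]
    · rcases hσ with rfl | rfl
      · right; refine ⟨rfl, ?_, ?_⟩ <;> rw [hzn] <;> linarith [ht.2]
      · left; refine ⟨rfl, ?_, ?_⟩ <;> rw [hzn] <;> linarith [ht.2]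
    · intro x hx
      obtain ⟨hx1, hx2⟩ := hx
      rw [norm_sub_eq_of_level hσ (r := r) p x] at hx1 hx2
      have ht1 := ht.1
      have ht2 := ht.2
      rcases hσ with rfl | rfl
      · rw [min_eq_right (by linarith)] at hx1
        rw [max_eq_left (by linarith)] at hx2
        constructor <;> linarith
      · rw [min_eq_left (by linarith)] at hx1
        rw [max_eq_right (by linarith)] at hx2
        constructor <;> linarith
  have hlim1 := h.tendsto_cauchyInt hσ hr hdr
    (hf.continuousOn.mono fun x hx => ⟨hx.1, hx.2.trans (by linarith)⟩) hγ hz₀ hzd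
  have hlim2 : Tendsto (fun t => cauchyInt p ((r - σ * t) ^ 2 / R)
      (fun θ => (starRingEnd ℂ) ((circleMap p R θ - p) * f (circleMap p R θ))) 1 z) (𝓝[>] 0)
      (𝓝 (cauchyInt p (r ^ 2 / R)
        (fun θ => (starRingEnd ℂ) ((circleMap p R θ - p) * f (circleMap p R θ))) 1 z)) := by
    refine (tendsto_cauchyInt_radius (by positivity) ?_ (continuous_conj.comp hfR)).comp ?_
    · intro h
      rw [eq_div_iff hRpos.ne', hzn, hR] at h
      rcases hσ with rfl | rfl
      · nlinarith [hdr rfl]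
      · nlinarith
    · have : Continuous fun t => (r - σ * t) ^ 2 / R := by fun_prop
      have h2 := this.tendsto 0
      simp only [mul_zero, sub_zero] at h2
      exact h2.mono_left nhdsWithin_le_nhds
  have hlim := (((hlim1.const_mul 2).sub hlim2).sub_const (cauchyInt p R
    (fun θ => (circleMap p R θ - p) * f (circleMap p R θ)) 1 z)).const_mul (σ : ℂ)
  have := tendsto_nhds_unique (tendsto_const_nhds.congr' (hrep.mono fun t ht => ht.symm)) hlim
  rw [this]
  have h5 : cauchyInt p r (fun θ => ((2 * r * γ θ : ℝ) : ℂ)) 1 z =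
      σ * (2 * cauchyInt p r (fun θ => ((σ * r * γ θ : ℝ) : ℂ)) 1 z) := by
    simp only [cauchyInt]
    rw [← intervalIntegral.integral_const_mul, ← intervalIntegral.integral_const_mul]
    congr 1; ext θ
    have : (σ : ℂ) * σ = 1 := by rcases hσ with rfl | rfl <;> simp
    push_cast
    linear_combination (-2 * r * γ θ / (circleMap p r θ - z) ^ 1) * this
  rw [h5]; ring

end LocalRepresentation

/-! ### Growth of the first two derivatives at a circle. -/

section LocalDerivativeBounds

variable {σ r d : ℝ} {p : ℂ} {f : ℂ → ℂ} {γ γ' : ℝ → ℝ}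

/-- The density of the Cauchy integral in the representation of `f`. -/
noncomputable def density (γ : ℝ → ℝ) (θ : ℝ) : ℂ := 2 * γ θ * cexp (-(θ * I))

/-- The density of the Cauchy integral in the representation of the derivative of `f`. -/
noncomputable def densityDeriv (r : ℝ) (γ γ' : ℝ → ℝ) (θ : ℝ) : ℂ :=
  -I * (2 * (γ' θ - I * γ θ) * cexp (-(2 * θ * I))) / r

/-- Writing 2rγ as `density γ` times r e^{iθ} turns the data term of f' into a Cauchy integral with
the kernel (w − z)^(−2) to which `norm_cauchyInt_two_le` applies. One integration by parts,
permitted since γ is C¹, brings the data term of f'' into the same form with `densityDeriv`. The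
other two circles have distance at least cd/2 from z, and trivial bounds suffice there. -/
lemma HasBoundaryFlux.hasDerivAt (h : HasBoundaryFlux σ p r d f γ)
    (hσ : σ = 1 ∨ σ = -1) (hr : 0 < r) (hdr : σ = 1 → 2 * d ≤ r)
    (hf : DifferentiableOn ℂ f {x | 0 < level σ p r x ∧ level σ p r x < 2 * d})
    (hγ : ∀ θ, HasDerivAt γ (γ' θ) θ) (hγ' : Continuous γ') (hper : γ (2 * Real.pi) = γ 0)
    {c α M N₀ N₁ : ℝ} (hc : 0 < c) (hc1 : c ≤ 1) (hcr : c * d ≤ r) (hα₀ : 0 < α) (hα : α < 1)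
    (hM : ∀ x, level σ p r x = d → ‖f x‖ ≤ M)
    (hN₀ : 0 ≤ N₀) (hN₁ : 0 ≤ N₁)
    (hG₀ : ∀ a b, ‖density γ a - density γ b‖ ≤
      N₀ * ‖circleMap p r a - circleMap p r b‖ ^ α)
    (hG₁ : ∀ a b, ‖densityDeriv r γ γ' a - densityDeriv r γ γ' b‖ ≤
      N₁ * ‖circleMap p r a - circleMap p r b‖ ^ α)
    {z : ℂ} (hz₀ : 0 < level σ p r z) (hzd : level σ p r z ≤ d / 2) :
    ‖deriv f z‖ ≤ 4 / (1 - α) * N₀ * level σ p r z ^ (α - 1) +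
        8 * (r - σ * d) * M / (c * d) ^ 2 ∧
      ‖deriv (deriv f) z‖ ≤ 4 / (1 - α) * N₁ * level σ p r z ^ (α - 1) +
        32 * (r - σ * d) * M / (c * d) ^ 3 := by
  have hd : 0 < d := by linarith
  have hpi := Real.pi_pos
  have hγc : Continuous γ := continuous_iff_continuousAt.2 fun θ => (hγ θ).continuousAt
  set R := r - σ * d with hR
  have hRpos : 0 < R := by
    rcases hσ with h | rfl
    · have := hdr h; rw [hR, h]; linarith
    · rw [hR]; linarith
  set hfun : ℝ → ℂ := fun θ => (circleMap p R θ - p) * f (circleMap p R θ) with hh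
  set A := cauchyInt p r (fun θ => ((2 * r * γ θ : ℝ) : ℂ)) with hA
  set B := cauchyInt p (r ^ 2 / R) (fun θ => (starRingEnd ℂ) (hfun θ)) with hB
  set C := cauchyInt p R hfun with hC
  have hlev : ∀ θ, level σ p r (circleMap p R θ) = d := level_circleMap hσ p hRpos.le
  have hhc : Continuous hfun := by
    refine Continuous.mul (by fun_prop) (hf.continuousOn.comp_continuous
      (continuous_circleMap _ _) fun θ => ?_)
    rw [mem_ofPred_eq, hlev]
    exact ⟨hd, by linarith⟩
  have hhM : ∀ θ, ‖hfun θ‖ ≤ R * M := fun θ => by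
    rw [hh, norm_mul, norm_circleMap_sub p hRpos.le]
    exact mul_le_mul_of_nonneg_left (hM _ (hlev θ)) hRpos.le
  have hrR : 0 < r ^ 2 / R := by positivity
  -- distances to the three circles
  have dR : ∀ x, level σ p r x < d → ‖x - p‖ ≠ R := fun x hx h => by
    rw [norm_sub_eq_of_level hσ (r := r) p x, hR] at h
    rcases hσ with rfl | rfl <;> linarith
  have dr : ∀ x, 0 < level σ p r x → ‖x - p‖ ≠ r := fun x hx h => by
    rw [norm_sub_eq_of_level hσ (r := r) p x] at h
    rcases hσ with rfl | rfl <;> linarith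
  -- The mirror image of the parallel circle lies outside the domain side: r²/(r − d) ≥ r + d if σ =
  -- 1, and r²/(r + d) ≤ r − cd/2 if σ = −1. The second inequality uses cd ≤ r and c ≤ 1.
  have dS : ∀ x, 0 < level σ p r x → c * d / 2 ≤ |‖x - p‖ - r ^ 2 / R| := fun x hx => by
    rw [norm_sub_eq_of_level hσ (r := r) p x]
    rcases hσ with rfl | rfl
    · have h1 : r + d ≤ r ^ 2 / R := by
        rw [le_div_iff₀ hRpos, hR]; nlinarith
      rw [abs_of_neg (by linarith)]
      nlinarith
    · have h1 : r ^ 2 / R ≤ r - c * d / 2 := by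
        rw [div_le_iff₀ hRpos, hR]
        nlinarith [mul_le_mul_of_nonneg_right hc1 hd.le, mul_le_mul_of_nonneg_right hc1 hr.le]
      rw [abs_of_pos (by nlinarith)]
      linarith
  have dS' : ∀ x, 0 < level σ p r x → ‖x - p‖ ≠ r ^ 2 / R := fun x hx h => by
    have := dS x hx
    rw [h, sub_self, abs_zero] at this
    have : 0 < c * d := by positivity
    linarith
  -- Here level ≤ d/2 enters: z keeps the distance d/2 from the parallel circle.
  have dR' : c * d / 2 ≤ |‖z - p‖ - R| := by
    have : |‖z - p‖ - R| = d - level σ p r z := by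
      rw [norm_sub_eq_of_level hσ (r := r) p z, hR]
      rcases hσ with rfl | rfl
      · rw [abs_of_nonneg (by linarith)]; ring
      · rw [abs_of_nonpos (by linarith)]; ring
    rw [this]; nlinarith
  -- the first derivative
  have hrep : ∀ x, 0 < level σ p r x → level σ p r x < d →
      f x = (2 * (Real.pi : ℂ))⁻¹ * (A 1 x - σ * (B 1 x + C 1 x)) := fun x hx0 hxd => by
    rw [← h.representation hσ hr (fun h => by linarith [hdr h]) hf hγc hx0 hxd]
    have : (Real.pi : ℂ) ≠ 0 := ofReal_ne_zero.2 hpi.ne'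
    field_simp
  have hV : IsOpen {x | 0 < level σ p r x ∧ level σ p r x < d} :=
    (isOpen_lt continuous_const (continuous_level σ p r)).and
      (isOpen_lt (continuous_level σ p r) continuous_const)
  have hG₀' : ∀ θ, HasDerivAt (density γ) (2 * (γ' θ - I * γ θ) * cexp (-(θ * I))) θ := fun θ => by
    have h1 := ((hγ θ).ofReal_comp.const_mul 2)
    have h2 : HasDerivAt (fun θ : ℝ => cexp (-(θ * I))) (cexp (-(θ * I)) * -(1 * I)) θ :=
      (((hasDerivAt_id' (θ : ℂ)).mul_const I).neg.cexp).comp_ofReal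
    refine (h1.mul h2).congr_deriv ?_
    ring
  have hG₀c : Continuous (density γ) :=
    continuous_iff_continuousAt.2 fun θ => (hG₀' θ).continuousAt
  have hDA : A = cauchyInt p r (fun θ => density γ θ * (r * cexp (θ * I))) := by
    rw [hA]; congr 1; ext θ
    have : cexp (-(θ * I)) * cexp (θ * I) = 1 := by rw [← Complex.exp_add]; simp
    rw [density]; push_cast
    linear_combination (-2 * r * γ θ) * this
  -- The integration by parts lowers the power of the kernel to 1, so differentiating once more
  -- gives power 2 and not 3.
  have hAA : ∀ x, 0 < level σ p r x → A 2 x =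
      cauchyInt p r (fun θ => densityDeriv r γ γ' θ * (r * cexp (θ * I))) 1 x := fun x hx => by
    rw [hDA, cauchyInt_two_eq hr.le (dr x hx) hG₀' (by fun_prop)]
    · congr 1; ext θ
      have hr' : (r : ℂ) ≠ 0 := ofReal_ne_zero.2 hr.ne'
      have : cexp (-(θ * I)) = cexp (-(2 * θ * I)) * cexp (θ * I) := by
        rw [← Complex.exp_add]; congr 1; ring
      rw [densityDeriv, this]
      field_simp
    · simp only [density, hper]
      congr 1
      push_cast
      rw [zero_mul, neg_zero, Complex.exp_zero, Complex.exp_neg,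
        Complex.exp_two_pi_mul_I, inv_one]
  have hDc : Continuous fun θ : ℝ => densityDeriv r γ γ' θ * (r * cexp (θ * I)) := by
    unfold densityDeriv; fun_prop
  have hf1 : ∀ x, 0 < level σ p r x → level σ p r x < d →
      HasDerivAt f ((2 * (Real.pi : ℂ))⁻¹ * (A 2 x - σ * (B 2 x + C 2 x))) x := fun x hx0 hxd => by
    have a1 := hasDerivAt_cauchyInt hr.le (dr x hx0) (D := fun θ => ((2 * r * γ θ : ℝ) : ℂ))
      (by fun_prop) 1
    have b1 := hasDerivAt_cauchyInt hrR.le (dS' x hx0) (continuous_conj.comp hhc) 1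
    have c1 := hasDerivAt_cauchyInt hRpos.le (dR x hxd) hhc 1
    have := (a1.sub ((b1.add c1).const_mul (σ : ℂ))).const_mul ((2 * Real.pi : ℂ)⁻¹)
    refine (this.congr_of_eventuallyEq ?_).congr_deriv ?_
    · filter_upwards [hV.mem_nhds ⟨hx0, hxd⟩] with y hy
      exact hrep y hy.1 hy.2
    · simp only [Nat.cast_one, one_mul]
      rfl
  have hf2 : HasDerivAt (deriv f) ((2 * (Real.pi : ℂ))⁻¹ *
      (cauchyInt p r (fun θ => densityDeriv r γ γ' θ * (r * cexp (θ * I))) 2 z -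
        σ * (2 * B 3 z + 2 * C 3 z))) z := by
    have hzd' : level σ p r z < d := by linarith
    have a1 := hasDerivAt_cauchyInt hr.le (dr z hz₀) hDc 1
    have b1 := hasDerivAt_cauchyInt hrR.le (dS' z hz₀) (continuous_conj.comp hhc) 2
    have c1 := hasDerivAt_cauchyInt hRpos.le (dR z hzd') hhc 2
    have := (a1.sub ((b1.add c1).const_mul (σ : ℂ))).const_mul ((2 * Real.pi : ℂ)⁻¹)
    refine (this.congr_of_eventuallyEq ?_).congr_deriv ?_
    · filter_upwards [hV.mem_nhds ⟨hz₀, hzd'⟩] with y hy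
      rw [(hf1 y hy.1 hy.2).deriv, hAA y hy.1]
      rfl
    · simp only [Nat.cast_one, one_mul, Nat.cast_ofNat]
      rfl
  have hcd : 0 < c * d / 2 := by positivity
  have bB : ∀ m, ‖B m z‖ ≤ 2 * Real.pi * (R * M) / (c * d / 2) ^ m := fun m =>
    norm_cauchyInt_le hcd hrR.le (dS z hz₀) (fun θ => by rw [RCLike.norm_conj]; exact hhM θ) m
  have bC : ∀ m, ‖C m z‖ ≤ 2 * Real.pi * (R * M) / (c * d / 2) ^ m := fun m =>
    norm_cauchyInt_le hcd hRpos.le dR' hhM m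
  have hσn : ‖(σ : ℂ)‖ = 1 := by rcases hσ with rfl | rfl <;> simp
  have hlz : |‖z - p‖ - r| = level σ p r z := by rw [abs_level hσ, abs_of_pos hz₀]
  have hpn : ‖((2 * Real.pi : ℂ))⁻¹‖ = (2 * Real.pi)⁻¹ := by
    rw [norm_inv, norm_mul, norm_real, Real.norm_eq_abs, abs_of_pos hpi]; simp
  constructor
  · rw [(hf1 z hz₀ (by linarith)).deriv, norm_mul, hpn, inv_mul_le_iff₀ (by positivity)]
    have a2 : ‖A 2 z‖ ≤ 8 * Real.pi / (1 - α) * N₀ * level σ p r z ^ (α - 1) := by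
      rw [← hlz, hDA]
      exact norm_cauchyInt_two_le hα₀ hα hr (dr z hz₀) hG₀c hN₀ hG₀
    calc _ ≤ ‖A 2 z‖ + ‖(σ : ℂ) * (B 2 z + C 2 z)‖ := norm_sub_le _ _
      _ ≤ ‖A 2 z‖ + (‖B 2 z‖ + ‖C 2 z‖) := by
        rw [norm_mul, hσn, one_mul]; gcongr; exact norm_add_le _ _
      _ ≤ 8 * Real.pi / (1 - α) * N₀ * level σ p r z ^ (α - 1) +
          (2 * Real.pi * (R * M) / (c * d / 2) ^ 2 + 2 * Real.pi * (R * M) / (c * d / 2) ^ 2) :=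
        add_le_add a2 (add_le_add (bB 2) (bC 2))
      _ = _ := by field_simp; ring
  · rw [hf2.deriv, norm_mul, hpn, inv_mul_le_iff₀ (by positivity)]
    have a2 := norm_cauchyInt_two_le hα₀ hα hr (dr z hz₀) (G := densityDeriv r γ γ')
      (by unfold densityDeriv; fun_prop) hN₁ hG₁
    rw [hlz] at a2
    calc _ ≤ _ + ‖(σ : ℂ) * (2 * B 3 z + 2 * C 3 z)‖ := norm_sub_le _ _
      _ ≤ _ + (2 * ‖B 3 z‖ + 2 * ‖C 3 z‖) := by
        rw [norm_mul, hσn, one_mul]; gcongr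
        refine (norm_add_le _ _).trans (by simp)
      _ ≤ 8 * Real.pi / (1 - α) * N₁ * level σ p r z ^ (α - 1) +
          (2 * (2 * Real.pi * (R * M) / (c * d / 2) ^ 3) +
            2 * (2 * Real.pi * (R * M) / (c * d / 2) ^ 3)) :=
        add_le_add a2 (add_le_add (mul_le_mul_of_nonneg_left (bB 3) (by norm_num))
          (mul_le_mul_of_nonneg_left (bC 3) (by norm_num)))
      _ = _ := by field_simp; ring

end LocalDerivativeBounds

/-! ### Distances between the boundary circles. -/

section Geometry

variable {n : ℕ} {z : Fin (n + 1) → ℂ} {r : Fin (n + 1) → ℝ} {c d : ℝ}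

/-- The side of the `k`-th circle on which the domain lies. -/
noncomputable def side (k : Fin (n + 1)) : ℝ := if k = 0 then 1 else -1

lemma side_eq (k : Fin (n + 1)) : side k = 1 ∨ side k = -1 := by
  unfold side; split_ifs <;> simp

@[simp] lemma side_zero : side (0 : Fin (n + 1)) = 1 := by simp [side]

@[simp] lemma side_succ (k : Fin n) : side k.succ = -1 := by simp [side, Fin.succ_ne_zero]

/-- The signed distance to the `k`-th circle. -/
noncomputable def lev (z : Fin (n + 1) → ℂ) (r : Fin (n + 1) → ℝ) (k : Fin (n + 1)) : ℂ → ℝ :=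
  level (side k) (z k) (r k)

lemma lev_zero (x : ℂ) : lev z r 0 x = r 0 - ‖x - z 0‖ := by simp [lev, level]

lemma lev_succ (k : Fin n) (x : ℂ) : lev z r k.succ x = ‖x - z k.succ‖ - r k.succ := by
  simp [lev, level]

lemma continuous_lev (k : Fin (n + 1)) : Continuous (lev z r k) := continuous_level _ _ _

lemma abs_lev_sub_le (k : Fin (n + 1)) (x y : ℂ) : |lev z r k x - lev z r k y| ≤ dist x y :=
  abs_level_sub_le (side_eq k) _ _ _

lemma mem_domain_iff {x : ℂ} : x ∈ domain z r ↔ ∀ k, 0 < lev z r k x := by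
  rw [Fin.forall_fin_succ]
  simp only [lev_zero, lev_succ, sub_pos, domain, Set.mem_sdiff, mem_ball, mem_iUnion,
    mem_closedBall, not_exists, not_le, dist_eq_norm]

lemma isOpen_domain : IsOpen (domain z r) := by
  have : domain z r = ⋂ k, {x | 0 < lev z r k x} := by
    ext x; simp [mem_domain_iff]
  rw [this]
  exact isOpen_iInter_of_finite fun k => isOpen_lt continuous_const (continuous_lev k)

lemma Admissible.mono {c' : ℝ} (h : Admissible c d z r) (hc : c' ≤ c) : Admissible c' d z r :=
  ⟨h.d_pos, h.subset_outer, h.disjoint_holes, h.dist_circles, fun k =>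
    (mul_le_mul_of_nonneg_right hc h.d_pos.le).trans (h.radius_ge k)⟩

lemma Admissible.radius_succ_pos (h : Admissible c d z r) (hc : 0 < c) (k : Fin n) :
    0 < r k.succ := (mul_pos hc h.d_pos).trans_le (h.radius_ge k)

/-- A unit vector in the direction of `w`. -/
lemma exists_unit_direction (w : ℂ) : ∃ e : ℂ, ‖e‖ = 1 ∧ w = ‖w‖ * e := by
  by_cases hw : w = 0
  · exact ⟨1, by simp, by simp [hw]⟩
  · have : (‖w‖ : ℂ) ≠ 0 := ofReal_ne_zero.2 (norm_ne_zero_iff.2 hw)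
    exact ⟨w / ‖w‖, by simp [hw], by field_simp⟩

lemma add_smul_unit_mem_sphere {p e : ℂ} {ρ t : ℝ} (he : ‖e‖ = 1) (ht : |t| = ρ) :
    p + t * e ∈ sphere p ρ := by
  rw [mem_sphere, dist_eq_norm, add_sub_cancel_left, norm_mul, he, mul_one, norm_real,
    Real.norm_eq_abs, ht]

/-- Take the points of the two circles on the ray from z 0 through the centre of the hole (any ray,
if the circles are concentric). The inclusion of the hole decides the order of these points on the
ray, and their distance is at least 2d. -/
lemma Admissible.radius_zero_ge_dist (h : Admissible c d z r) (hc : 0 < c) (k : Fin n) :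
    ‖z k.succ - z 0‖ + r k.succ + 2 * d ≤ r 0 := by
  have hk := h.radius_succ_pos hc k
  obtain ⟨e, he, hw⟩ := exists_unit_direction (z k.succ - z 0)
  set D := ‖z k.succ - z 0‖ with hD
  have hzk : z k.succ = z 0 + D * e := by rw [← hw]; ring
  have h1 : z k.succ + (r k.succ : ℂ) * e ∈ sphere (z k.succ) (r k.succ) :=
    add_smul_unit_mem_sphere he (abs_of_pos hk)
  have h2 := h.subset_outer k (sphere_subset_closedBall h1)
  have e1 : ∀ s t : ℝ, dist (z 0 + s * e) (z 0 + t * e) = |s - t| := fun s t => by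
    rw [dist_eq_norm, show z 0 + s * e - (z 0 + t * e) = ((s - t : ℝ) : ℂ) * e by push_cast; ring,
      norm_mul, he, mul_one, norm_real, Real.norm_eq_abs]
  have e2 : z k.succ + (r k.succ : ℂ) * e = z 0 + ((D + r k.succ : ℝ) : ℂ) * e := by
    rw [hzk]; push_cast; ring
  have hDn : 0 ≤ D := norm_nonneg _
  have h3 : D + r k.succ < r 0 := by
    rw [e2, mem_ball, dist_eq_norm, add_sub_cancel_left, norm_mul, he, mul_one, norm_real,
      Real.norm_eq_abs, abs_of_pos (by linarith)] at h2
    exact h2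
  have h4 : z 0 + (r 0 : ℂ) * e ∈ sphere (z 0) (r 0) :=
    add_smul_unit_mem_sphere he (abs_of_pos (by linarith))
  have h5 := h.dist_circles 0 k.succ (Fin.succ_ne_zero k).symm _ h4 _ h1
  rw [e2, e1, abs_of_pos (by linarith)] at h5
  linarith

/-- The two circles are compared at the points that face each other on the segment between the
centres; disjointness of the disks excludes that the order of these points is reversed. -/
lemma Admissible.dist_centers_ge (h : Admissible c d z r) (hc : 0 < c) {j k : Fin n}
    (hjk : j ≠ k) : r j.succ + r k.succ + 2 * d ≤ ‖z k.succ - z j.succ‖ := by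
  have hk := h.radius_succ_pos hc k
  have hj := h.radius_succ_pos hc j
  have hd := h.d_pos
  obtain ⟨e, he, hw⟩ := exists_unit_direction (z k.succ - z j.succ)
  set D := ‖z k.succ - z j.succ‖ with hD
  have hzk : z k.succ = z j.succ + D * e := by rw [← hw]; ring
  have hDn : 0 ≤ D := norm_nonneg _
  have e1 : ∀ s t : ℝ, dist (z j.succ + s * e) (z j.succ + t * e) = |s - t| := fun s t => by
    rw [dist_eq_norm, show z j.succ + s * e - (z j.succ + t * e) = ((s - t : ℝ) : ℂ) * e by
      push_cast; ring, norm_mul, he, mul_one, norm_real, Real.norm_eq_abs]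
  have h1 : z k.succ + ((-r k.succ : ℝ) : ℂ) * e ∈ sphere (z k.succ) (r k.succ) :=
    add_smul_unit_mem_sphere he (by rw [abs_neg, abs_of_pos hk])
  have h4 : z j.succ + (r j.succ : ℂ) * e ∈ sphere (z j.succ) (r j.succ) :=
    add_smul_unit_mem_sphere he (abs_of_pos hj)
  have e2 : z k.succ + ((-r k.succ : ℝ) : ℂ) * e = z j.succ + ((D - r k.succ : ℝ) : ℂ) * e := by
    rw [hzk]; push_cast; ring
  have h5 := h.dist_circles j.succ k.succ (fun h => hjk (Fin.succ_injective _ h)) _ h4 _ h1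
  rw [e2, e1] at h5
  have h6 : r j.succ + r k.succ < D := by
    by_contra hcon
    push Not at hcon
    -- If D ≤ r j + r k, the point at distance min D (r j) from the first centre towards the second
    -- lies in both disks. The minimum with D covers the case that one centre is inside the other
    -- disk.
    have hm1 : z j.succ + ((min D (r j.succ) : ℝ) : ℂ) * e ∈ closedBall (z j.succ) (r j.succ) := by
      rw [mem_closedBall, dist_eq_norm, add_sub_cancel_left, norm_mul, he, mul_one, norm_real,
        Real.norm_eq_abs, abs_of_nonneg (le_min hDn hj.le)]
      exact min_le_right _ _
    refine disjoint_left.1 (h.disjoint_holes j k hjk) hm1 ?_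
    rw [hzk, mem_closedBall, e1, abs_of_nonpos (by linarith [min_le_left D (r j.succ)])]
    rcases min_cases D (r j.succ) with ⟨h, _⟩ | ⟨h, _⟩ <;> rw [h] <;> linarith
  rw [abs_of_neg (by linarith)] at h5
  linarith

/-- The sum of the signed distances to two different circles is at least `2 * d`. -/
lemma Admissible.le_lev_add_lev (h : Admissible c d z r) (hc : 0 < c) {j k : Fin (n + 1)}
    (hjk : j ≠ k) (x : ℂ) : 2 * d ≤ lev z r j x + lev z r k x := by
  have key : ∀ k : Fin n, 2 * d ≤ lev z r 0 x + lev z r k.succ x := fun k => by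
    rw [lev_zero, lev_succ]
    have h1 := h.radius_zero_ge_dist hc k
    have h2 := norm_add_le (x - z k.succ) (z k.succ - z 0)
    rw [sub_add_sub_cancel] at h2
    linarith
  refine Fin.cases (motive := fun j => j ≠ k → 2 * d ≤ lev z r j x + lev z r k x)
    (fun h0 => ?_) (fun j hj => ?_) j hjk
  · obtain ⟨k', rfl⟩ := Fin.exists_succ_eq.2 h0.symm
    exact key k'
  · revert hj
    refine Fin.cases (fun _ => ?_) (fun k hjk' => ?_) k
    · rw [add_comm]; exact key j
    · rw [lev_succ, lev_succ]
      have h1 := h.dist_centers_ge hc (j := j) (k := k) fun h => hjk' (by rw [h])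
      have h2 := norm_sub_le (x - z j.succ) (x - z k.succ)
      rw [sub_sub_sub_cancel_left] at h2
      linarith

lemma Admissible.radius_zero_ge (h : Admissible c d z r) (hc : 0 < c) (hn : 1 ≤ n) :
    2 * d ≤ r 0 := by
  have h1 := h.radius_zero_ge_dist hc ⟨0, hn⟩
  have h2 := h.radius_succ_pos hc ⟨0, hn⟩
  linarith [norm_nonneg (z (Fin.succ ⟨0, hn⟩) - z 0)]

lemma Admissible.mul_le_radius (h : Admissible c d z r) (hc : 0 < c) (hc1 : c ≤ 1) (hn : 1 ≤ n)
    (k : Fin (n + 1)) : c * d ≤ r k := by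
  refine Fin.cases ?_ (fun k => h.radius_ge k) k
  have := h.radius_zero_ge hc hn
  nlinarith [h.d_pos]

lemma Admissible.radius_pos (h : Admissible c d z r) (hc : 0 < c) (hn : 1 ≤ n)
    (k : Fin (n + 1)) : 0 < r k := by
  refine Fin.cases ?_ (fun k => h.radius_succ_pos hc k) k
  have := h.radius_zero_ge hc hn
  linarith [h.d_pos]

lemma Admissible.radius_side_le (h : Admissible c d z r) (hc : 0 < c)
    (k : Fin (n + 1)) : r k - side k * d ≤ r 0 := by
  have := h.d_pos
  refine Fin.cases ?_ (fun k => ?_) k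
  · simp; linarith
  · simp only [side_succ]
    have := h.radius_zero_ge_dist hc k
    linarith [norm_nonneg (z k.succ - z 0)]

lemma Admissible.two_mul_le_radius_of_side (h : Admissible c d z r) (hc : 0 < c) (hn : 1 ≤ n)
    (k : Fin (n + 1)) (hk : side k = 1) : 2 * d ≤ r k := by
  revert hk
  refine Fin.cases (fun _ => h.radius_zero_ge hc hn) (fun k hk => ?_) k
  rw [side_succ] at hk; norm_num at hk

/-- The sum of two signed distances is at least 2d, so the distances to all other circles are
positive. -/
lemma Admissible.strip_subset (h : Admissible c d z r) (hc : 0 < c) {k : Fin (n + 1)} {x : ℂ}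
    (h0 : 0 < lev z r k x) (h1 : lev z r k x < 2 * d) : x ∈ domain z r := by
  refine mem_domain_iff.2 fun j => ?_
  by_cases hj : j = k
  · rwa [hj]
  · linarith [h.le_lev_add_lev hc hj x]

end Geometry

/-! ### From growth of the derivative at the boundary to sup and Hölder bounds. -/

section Gluing

variable {n : ℕ} {z : Fin (n + 1) → ℂ} {r : Fin (n + 1) → ℝ} {c d : ℝ}

/-- Translation of `x` by `s` in the direction from the `k`-th circle into the domain. -/
noncomputable def push (z : Fin (n + 1) → ℂ) (k : Fin (n + 1)) (s : ℝ) (x : ℂ) : ℂ :=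
  x - side k * s * ((x - z k) / ‖x - z k‖)

lemma norm_direction {w : ℂ} (hw : w ≠ 0) : ‖w / (‖w‖ : ℂ)‖ = 1 := by simp [hw]

lemma norm_direction_sub_le {a b : ℂ} (ha : a ≠ 0) (hb : b ≠ 0) :
    ‖a / (‖a‖ : ℂ) - b / (‖b‖ : ℂ)‖ ≤ 2 * ‖a - b‖ / ‖a‖ := by
  have ha' : (‖a‖ : ℂ) ≠ 0 := ofReal_ne_zero.2 (norm_ne_zero_iff.2 ha)
  have hb' : (‖b‖ : ℂ) ≠ 0 := ofReal_ne_zero.2 (norm_ne_zero_iff.2 hb)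
  have h1 : a / (‖a‖ : ℂ) - b / (‖b‖ : ℂ) =
      (a - b) / (‖a‖ : ℂ) + ((‖b‖ - ‖a‖ : ℝ) : ℂ) / (‖a‖ : ℂ) * (b / (‖b‖ : ℂ)) := by
    push_cast; field_simp; ring
  rw [h1]
  refine (norm_add_le _ _).trans ?_
  rw [norm_mul, norm_direction hb, mul_one, norm_div, norm_div, norm_real, norm_real,
    Real.norm_eq_abs, abs_norm, Real.norm_eq_abs, ← add_div]
  gcongr
  have := abs_norm_sub_norm_le b a
  rw [norm_sub_rev b a] at this
  linarith

/-- The condition on s keeps the point from passing through the centre, beyond which the signed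
distance would no longer grow with s. -/
lemma lev_push {k : Fin (n + 1)} {s : ℝ} {x : ℂ} (hx : x ≠ z k) (hs : side k * s ≤ ‖x - z k‖) :
    lev z r k (push z k s x) = lev z r k x + s := by
  have hx' : x - z k ≠ 0 := sub_ne_zero.2 hx
  have h0 : (‖x - z k‖ : ℂ) ≠ 0 := ofReal_ne_zero.2 (norm_ne_zero_iff.2 hx')
  have h1 : push z k s x - z k =
      ((‖x - z k‖ - side k * s : ℝ) : ℂ) * ((x - z k) / ‖x - z k‖) := by
    rw [push]; push_cast; field_simp; ring
  have h2 : ‖push z k s x - z k‖ = ‖x - z k‖ - side k * s := by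
    rw [h1, norm_mul, norm_direction hx', mul_one, norm_real, Real.norm_eq_abs,
      abs_of_nonneg (by linarith)]
  rw [lev, level, level, h2]
  rcases side_eq k with h | h <;> rw [h] <;> ring

lemma push_zero (k : Fin (n + 1)) (x : ℂ) : push z k 0 x = x := by simp [push]

variable {F : ℂ → ℂ} {α A N M : ℝ}

lemma Admissible.norm_sub_center_ge (h : Admissible c d z r) (hc : 0 < c) (hc1 : c ≤ 1)
    (hn : 1 ≤ n) {k : Fin (n + 1)} {x : ℂ} (hx0 : 0 < lev z r k x) (hxd : lev z r k x ≤ d) :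
    c * d ≤ ‖x - z k‖ ∧ side k * d ≤ ‖x - z k‖ := by
  have hd := h.d_pos
  have h1 : ‖x - z k‖ = r k - side k * lev z r k x := norm_sub_eq_of_level (side_eq k) _ _
  rw [h1]
  rcases side_eq k with hk | hk <;> rw [hk]
  · have := h.two_mul_le_radius_of_side hc hn k hk
    constructor <;> nlinarith
  · have := h.mul_le_radius hc hc1 hn k
    have := h.radius_pos hc hn k
    constructor <;> nlinarith

/-- Integrate the bound for F' along the radial segment. Since t^(α−1) is integrable at 0, the
result is finite, and (l + s)^α ≤ l^α + s^α makes it independent of the initial distance l. -/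
lemma norm_sub_push_le (h : Admissible c d z r) (hc : 0 < c) (hc1 : c ≤ 1) (hn : 1 ≤ n)
    (hα₀ : 0 < α) (hα : α < 1) (hN : 0 ≤ N)
    (hF : ∀ x ∈ domain z r, DifferentiableAt ℂ F x)
    (hF' : ∀ x ∈ domain z r, ∀ t > 0, (∀ k, t ≤ lev z r k x) → ‖deriv F x‖ ≤ A + N * t ^ (α - 1))
    {k : Fin (n + 1)} {x : ℂ} {s : ℝ} (hx0 : 0 < lev z r k x) (hs : 0 ≤ s)
    (hsd : lev z r k x + s ≤ d) :
    ‖F (push z k s x) - F x‖ ≤ A * s + N * s ^ α / α := by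
  have hd := h.d_pos
  obtain ⟨hn1, hn2⟩ := h.norm_sub_center_ge hc hc1 hn hx0 (by linarith)
  have hcd : 0 < c * d := by positivity
  have hxne : x - z k ≠ 0 := norm_pos_iff.1 (hcd.trans_le hn1)
  set l := lev z r k x with hl
  set e := (x - z k) / (‖x - z k‖ : ℂ) with he
  have hlev : ∀ t ∈ Icc 0 s, lev z r k (push z k t x) = l + t := fun t ht => by
    refine lev_push (sub_ne_zero.1 hxne) ?_
    have ht2 := ht.2
    have ht1 := ht.1
    rcases side_eq k with hk | hk <;> rw [hk] at hn2 ⊢ <;> linarith [norm_nonneg (x - z k)]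
  have hdom : ∀ t ∈ Icc 0 s, push z k t x ∈ domain z r := fun t ht =>
    h.strip_subset hc (k := k) (by rw [hlev t ht]; linarith [ht.1])
      (by rw [hlev t ht]; linarith [ht.2])
  have hderiv : ∀ t ∈ Icc 0 s, HasDerivAt (fun t => F (push z k t x) - F x)
      (deriv F (push z k t x) * (-(side k * e))) t := fun t ht => by
    have h1 : HasDerivAt (fun t : ℝ => push z k t x) (-(side k * e)) t := by
      have := ((((hasDerivAt_id' t).ofReal_comp).const_mul (side k : ℂ)).mul_const e).const_sub x
      simpa [push, he] using this
    have h2 := ((hF _ (hdom t ht)).hasDerivAt.scomp t h1).sub_const (F x)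
    simpa [mul_comm] using h2
  have key := image_norm_le_of_norm_deriv_right_le_deriv_boundary' (a := 0) (b := s)
    (f := fun t => F (push z k t x) - F x)
    (B := fun t => A * t + N * (((l + t) ^ α - l ^ α) / α))
    (B' := fun t => A + N * (l + t) ^ (α - 1))
    (fun t ht => (hderiv t ht).continuousAt.continuousWithinAt)
    (fun t ht => (hderiv t (Ico_subset_Icc_self ht)).hasDerivWithinAt)
    (by simp [push_zero]) ?_ ?_ ?_ (right_mem_Icc.2 hs)
  · refine key.trans ?_
    have h3 : (l + s) ^ α ≤ l ^ α + s ^ α := Real.rpow_add_le_add_rpow hx0.le hs hα₀.le hα.le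
    have h4 : ((l + s) ^ α - l ^ α) / α ≤ s ^ α / α := by gcongr; linarith
    have := mul_le_mul_of_nonneg_left h4 hN
    rw [mul_div_assoc]; linarith
  · refine ContinuousOn.add (by fun_prop) (continuousOn_const.mul (ContinuousOn.div_const
      (ContinuousOn.sub ?_ continuousOn_const) _))
    exact ContinuousOn.rpow_const (by fun_prop) fun t ht => Or.inr hα₀.le
  · intro t ht
    have hpos : 0 < l + t := by linarith [ht.1]
    have h1 : HasDerivAt (fun t => l + t) 1 t := (hasDerivAt_id' t).const_add l
    have h2 := ((((h1.rpow_const (p := α) (Or.inl hpos.ne')).sub_const (l ^ α)).div_const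
      α).const_mul N).const_add (A * t)
    have h3 := ((hasDerivAt_id' t).const_mul A).add ((((h1.rpow_const (p := α)
      (Or.inl hpos.ne')).sub_const (l ^ α)).div_const α).const_mul N)
    refine (h3.congr_deriv ?_).hasDerivWithinAt
    field_simp
  · intro t ht
    have ht' := Ico_subset_Icc_self ht
    have hside : ‖(side k : ℂ)‖ = 1 := by rcases side_eq k with h | h <;> rw [h] <;> simp
    rw [norm_mul, norm_neg, norm_mul, hside, he, norm_direction hxne, mul_one, mul_one]
    -- As l + t ≤ d, every other circle is at distance at least 2d − (l + t) ≥ l + t, so the k-th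
    -- circle is the nearest one.
    refine hF' _ (hdom t ht') (l + t) (by linarith [ht.1]) fun j => ?_
    by_cases hj : j = k
    · rw [hj, hlev t ht']
    · have := h.le_lev_add_lev hc hj (push z k t x)
      rw [hlev t ht'] at this
      linarith [ht'.2]

/-- The hypotheses on `F` in the gluing lemmas. -/
structure DerivBound (z : Fin (n + 1) → ℂ) (r : Fin (n + 1) → ℝ) (d α A N M : ℝ) (F : ℂ → ℂ) :
    Prop where
  A_nonneg : 0 ≤ A
  N_nonneg : 0 ≤ N
  differentiableAt : ∀ x ∈ domain z r, DifferentiableAt ℂ F x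
  norm_deriv_le : ∀ x ∈ domain z r, ∀ t > 0, (∀ k, t ≤ lev z r k x) →
    ‖deriv F x‖ ≤ A + N * t ^ (α - 1)
  norm_le : ∀ x ∈ domain z r, (∀ k, d / 4 ≤ lev z r k x) → ‖F x‖ ≤ M

/-- A point close to a circle is pushed by d/4 into the region where F is bounded by M; the
increment is controlled by the integrated derivative bound. -/
lemma DerivBound.sup_le (hF : DerivBound z r d α A N M F) (h : Admissible c d z r) (hc : 0 < c)
    (hc1 : c ≤ 1) (hn : 1 ≤ n) (hα₀ : 0 < α) (hα : α < 1) {x : ℂ} (hx : x ∈ domain z r) :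
    ‖F x‖ ≤ M + A * d + N * d ^ α / α := by
  have hd := h.d_pos
  have hA := hF.A_nonneg
  have hN := hF.N_nonneg
  by_cases hfar : ∀ k, d / 4 ≤ lev z r k x
  · have h1 := hF.norm_le x hx hfar
    have : 0 ≤ A * d + N * d ^ α / α := by positivity
    linarith
  · push Not at hfar
    obtain ⟨k, hk⟩ := hfar
    have hk0 := mem_domain_iff.1 hx k
    obtain ⟨hn1, hn2⟩ := h.norm_sub_center_ge hc hc1 hn hk0 (by linarith)
    have hcd : 0 < c * d := by positivity
    have hlev : lev z r k (push z k (d / 4) x) = lev z r k x + d / 4 := by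
      refine lev_push (sub_ne_zero.1 (norm_pos_iff.1 (hcd.trans_le hn1))) ?_
      rcases side_eq k with hs | hs <;> rw [hs] at hn2 ⊢ <;> linarith [norm_nonneg (x - z k)]
    have h1 := norm_sub_push_le h hc hc1 hn hα₀ hα hN hF.differentiableAt hF.norm_deriv_le hk0
      (by positivity : 0 ≤ d / 4) (by linarith)
    have h2 := hF.norm_le (push z k (d / 4) x)
      (h.strip_subset hc (k := k) (by linarith) (by linarith)) fun j => by
        by_cases hj : j = k
        · rw [hj]; linarith
        · have := h.le_lev_add_lev hc hj (push z k (d / 4) x)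
          linarith
    have h3 : (d / 4) ^ α ≤ d ^ α := Real.rpow_le_rpow (by positivity) (by linarith) hα₀.le
    have h4 : N * (d / 4) ^ α / α ≤ N * d ^ α / α := by gcongr
    have h5 : A * (d / 4) ≤ A * d := by gcongr; linarith
    have h6 := norm_sub_norm_le (F x) (F (push z k (d / 4) x))
    rw [norm_sub_rev] at h6
    linarith

lemma DerivBound.holder_le_of_segment (hF : DerivBound z r d α A N M F) {x y : ℂ} {t : ℝ}
    (ht : 0 < t) (hseg : ∀ w ∈ segment ℝ x y, ∀ k, t ≤ lev z r k w) :
    ‖F y - F x‖ ≤ (A + N * t ^ (α - 1)) * ‖y - x‖ := by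
  have hdom : ∀ w ∈ segment ℝ x y, w ∈ domain z r := fun w hw =>
    mem_domain_iff.2 fun k => ht.trans_le (hseg w hw k)
  exact (convex_segment x y).norm_image_sub_le_of_norm_deriv_le
    (fun w hw => hF.differentiableAt w (hdom w hw))
    (fun w hw => hF.norm_deriv_le w (hdom w hw) t ht (hseg w hw))
    (left_mem_segment ℝ x y) (right_mem_segment ℝ x y)

lemma dist_le_of_mem_segment {x y w : ℂ} (hw : w ∈ segment ℝ x y) : dist w x ≤ dist x y := by
  have := (convex_closedBall x (dist x y)).segment_subset
    (mem_closedBall_self dist_nonneg) (mem_closedBall'.2 le_rfl) hw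
  exact this

/-- The Hardy–Littlewood argument, with τ = |x − y|. If τ is comparable with d, the sup bound is
enough. If x has distance at least 2τ from the boundary, the mean value inequality on the segment
from x to y gives N τ^(α−1) τ. Otherwise both points are pushed by 2τ away from the nearby circle;
the two pushes cost O(τ^α) and Aτ, and the shifted points are compared on a segment on which the
distance to the boundary is at least τ/2. -/
lemma DerivBound.holder_le (hF : DerivBound z r d α A N M F) (h : Admissible c d z r) (hc : 0 < c)
    (hc1 : c ≤ 1) (hn : 1 ≤ n) (hα₀ : 0 < α) (hα : α < 1) (hM : 0 ≤ M) {x y : ℂ}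
    (hx : x ∈ domain z r) (hy : y ∈ domain z r) :
    ‖F x - F y‖ ≤ 32 / (c * α) * (A * d ^ (1 - α) + N + M * d ^ (-α)) * dist x y ^ α := by
  have hd := h.d_pos
  have hA := hF.A_nonneg
  have hN := hF.N_nonneg
  set τ := dist x y with hτ
  rcases (dist_nonneg : 0 ≤ dist x y).eq_or_lt with h0 | hτ0
  · rw [dist_eq_zero.1 h0.symm]; simp only [sub_self, norm_zero]; positivity
  rw [← hτ] at hτ0
  have hτα : 0 < τ ^ α := by positivity
  have hcα : 1 ≤ 1 / (c * α) := by
    rw [le_div_iff₀ (by positivity)]; nlinarith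
  have hα1 : 1 ≤ 1 / α := by rw [le_div_iff₀ hα₀]; linarith
  -- The threshold c d/16 makes 4τ small compared with d and 2τ at most 1/8 of the distance from x
  -- or y to the centre of the nearby circle.
  rcases le_or_gt (c / 16 * d) τ with hfar | hnear
  · have h1 := hF.sup_le h hc hc1 hn hα₀ hα hx
    have h2 := hF.sup_le h hc hc1 hn hα₀ hα hy
    have h3 := norm_sub_le (F x) (F y)
    have e1 : (c / 16 * d) ^ α ≤ τ ^ α := Real.rpow_le_rpow (by positivity) hfar hα₀.le
    have e2 : c / 16 ≤ (c / 16) ^ α := by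
      have := Real.rpow_le_rpow_of_exponent_ge (by positivity : 0 < c / 16) (by linarith) hα.le
      rwa [Real.rpow_one] at this
    rw [Real.mul_rpow (by positivity) hd.le] at e1
    have e3 : c / 16 * d ^ α ≤ τ ^ α := (mul_le_mul_of_nonneg_right e2 (by positivity)).trans e1
    have e4 : 1 ≤ 16 / c * d ^ (-α) * τ ^ α := by
      have hdα : 0 < d ^ α := by positivity
      rw [Real.rpow_neg hd.le]
      have : 16 / c * (d ^ α)⁻¹ * (c / 16 * d ^ α) = 1 := by field_simp
      rw [← this]; gcongr
    have e5 : d ^ (1 - α) = d * d ^ (-α) := by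
      rw [sub_eq_add_neg, Real.rpow_add hd, Real.rpow_one]
    have e6 : d ^ (-α) * d ^ α = 1 := by rw [← Real.rpow_add hd]; simp
    calc ‖F x - F y‖ ≤ 2 * (M + A * d + N * d ^ α / α) * 1 := by linarith
      _ ≤ 2 * (M + A * d + N * d ^ α / α) * (16 / c * d ^ (-α) * τ ^ α) := by gcongr
      _ ≤ 2 * ((M + A * d) * (1 / α) + N * d ^ α / α) * (16 / c * d ^ (-α) * τ ^ α) := by
        have : (M + A * d) * 1 ≤ (M + A * d) * (1 / α) :=
          mul_le_mul_of_nonneg_left hα1 (by positivity)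
        gcongr; linarith
      _ = 32 / (c * α) * (A * (d * d ^ (-α)) + N * (d ^ (-α) * d ^ α) + M * d ^ (-α)) * τ ^ α := by
        field_simp; ring
      _ = _ := by rw [e5, e6, mul_one]
  have hτd : τ ≤ d / 16 := by nlinarith
  -- As τ ≤ d, a Lipschitz term is a Hölder term with the factor d^(1−α).
  have e1 : A * τ ≤ A * d ^ (1 - α) * τ ^ α := by
    have h1 : τ = τ ^ (1 - α) * τ ^ α := by rw [← Real.rpow_add hτ0]; simp
    have h2 : τ ^ (1 - α) ≤ d ^ (1 - α) := Real.rpow_le_rpow hτ0.le (by linarith) (by linarith)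
    calc A * τ = A * (τ ^ (1 - α) * τ ^ α) := by rw [← h1]
      _ ≤ A * (d ^ (1 - α) * τ ^ α) := by gcongr
      _ = _ := by ring
  have e2 : τ ^ (α - 1) * τ = τ ^ α := by
    rw [Real.rpow_sub_one hτ0.ne']; field_simp
  have e3 : (τ / 2) ^ (α - 1) ≤ 2 * τ ^ (α - 1) := by
    rw [Real.div_rpow hτ0.le (by norm_num), div_eq_mul_inv, ← Real.rpow_neg (by norm_num), mul_comm]
    have : (2 : ℝ) ^ (-(α - 1)) ≤ 2 ^ (1 : ℝ) :=
      Real.rpow_le_rpow_of_exponent_le (by norm_num) (by linarith)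
    rw [Real.rpow_one] at this
    gcongr
  have hMd : 0 ≤ M * d ^ (-α) := by positivity
  have hAd : 0 ≤ A * d ^ (1 - α) := by positivity
  have fin : ∀ X, X ≤ 6 * (A * τ) + (4 / α + 3) * N * τ ^ α →
      X ≤ 32 / (c * α) * (A * d ^ (1 - α) + N + M * d ^ (-α)) * τ ^ α := by
    intro X hX
    refine hX.trans ?_
    have h1 : 4 / α + 3 ≤ 32 / (c * α) := by
      have : 1 / α ≤ 1 / (c * α) := by
        apply one_div_le_one_div_of_le (by positivity); nlinarith
      have e4 : 4 / α = 4 * (1 / α) := by ring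
      have e5 : 32 / (c * α) = 32 * (1 / (c * α)) := by ring
      rw [e4, e5]; linarith
    have h2 : 6 ≤ 32 / (c * α) := by
      have e5 : 32 / (c * α) = 32 * (1 / (c * α)) := by ring
      rw [e5]; linarith
    calc 6 * (A * τ) + (4 / α + 3) * N * τ ^ α
        ≤ 32 / (c * α) * (A * d ^ (1 - α) * τ ^ α) + 32 / (c * α) * N * τ ^ α := by
          gcongr
      _ = 32 / (c * α) * (A * d ^ (1 - α) + N + 0) * τ ^ α := by ring
      _ ≤ _ := by gcongr
  by_cases hdeep : ∀ k, 2 * τ ≤ lev z r k x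
  · apply fin
    have := hF.holder_le_of_segment hτ0 (x := x) (y := y) fun w hw k => by
      have h1 := dist_le_of_mem_segment hw
      have h2 := (abs_le.1 (abs_lev_sub_le (z := z) (r := r) k w x)).1
      linarith [hdeep k]
    rw [norm_sub_rev, ← dist_eq_norm, ← dist_eq_norm, dist_comm y x, ← hτ] at this
    rw [← dist_eq_norm]
    have e4 : (A + N * τ ^ (α - 1)) * τ = A * τ + N * τ ^ α := by rw [← e2]; ring
    have e5 : N * τ ^ α ≤ (4 / α + 3) * N * τ ^ α := by
      have : 1 ≤ 4 / α + 3 := by have : 0 < 4 / α := by positivity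
                                 linarith
      nlinarith [mul_nonneg hN hτα.le]
    have : 0 ≤ A * τ := by positivity
    linarith
  push Not at hdeep
  obtain ⟨k, hk⟩ := hdeep
  have hkx := mem_domain_iff.1 hx k
  have hky := mem_domain_iff.1 hy k
  have hk' : lev z r k y < 3 * τ := by
    have := (abs_le.1 (abs_lev_sub_le (z := z) (r := r) k x y)).1
    linarith
  obtain ⟨nx1, nx2⟩ := h.norm_sub_center_ge hc hc1 hn hkx (by linarith)
  obtain ⟨ny1, ny2⟩ := h.norm_sub_center_ge hc hc1 hn hky (by linarith)
  have hcd : 0 < c * d := by positivity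
  have hxne : x - z k ≠ 0 := norm_pos_iff.1 (hcd.trans_le nx1)
  have hyne : y - z k ≠ 0 := norm_pos_iff.1 (hcd.trans_le ny1)
  have lx : lev z r k (push z k (2 * τ) x) = lev z r k x + 2 * τ := by
    refine lev_push (sub_ne_zero.1 hxne) ?_
    rcases side_eq k with hs | hs <;> rw [hs] at nx2 ⊢ <;> linarith [norm_nonneg (x - z k)]
  have px := norm_sub_push_le h hc hc1 hn hα₀ hα hN hF.differentiableAt hF.norm_deriv_le hkx
    (by positivity : 0 ≤ 2 * τ) (by linarith)
  have py := norm_sub_push_le h hc hc1 hn hα₀ hα hN hF.differentiableAt hF.norm_deriv_le hky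
    (by positivity : 0 ≤ 2 * τ) (by linarith)
  have hside : ‖(side k : ℂ)‖ = 1 := by rcases side_eq k with h | h <;> rw [h] <;> simp
  -- The unit directions of x and y from the centre differ by at most 2τ/|x − z k|. Multiplied by 2τ
  -- this is at most τ/4, so pushing enlarges the distance τ at most to 5τ/4, less than the 2τ
  -- gained in depth.
  have hdist : dist (push z k (2 * τ) x) (push z k (2 * τ) y) ≤ 5 / 4 * τ := by
    have h1 : push z k (2 * τ) x - push z k (2 * τ) y = (x - y) - side k * ((2 * τ : ℝ) : ℂ) *
        ((x - z k) / (‖x - z k‖ : ℂ) - (y - z k) / (‖y - z k‖ : ℂ)) := by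
      simp only [push]; ring
    have h2 := norm_direction_sub_le hxne hyne
    rw [sub_sub_sub_cancel_right, ← dist_eq_norm x y, ← hτ] at h2
    have h3 : 2 * τ / ‖x - z k‖ ≤ 1 / 8 := by
      rw [div_le_iff₀ (hcd.trans_le nx1)]; linarith
    rw [dist_eq_norm, h1]
    refine (norm_sub_le _ _).trans ?_
    rw [norm_mul, norm_mul, hside, one_mul, norm_real, Real.norm_eq_abs, abs_of_pos (by positivity),
      ← dist_eq_norm x y, ← hτ]
    nlinarith [h2.trans h3]
  have pm := hF.holder_le_of_segment (half_pos hτ0) (x := push z k (2 * τ) x)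
    (y := push z k (2 * τ) y) fun w hw j => by
      have h1 := (dist_le_of_mem_segment hw).trans hdist
      have h2 := (abs_le.1 (abs_lev_sub_le (z := z) (r := r) j w (push z k (2 * τ) x))).1
      by_cases hj : j = k
      · rw [hj] at h2 ⊢; linarith
      · have := h.le_lev_add_lev hc hj (push z k (2 * τ) x)
        linarith
  apply fin
  have pm' : ‖F (push z k (2 * τ) y) - F (push z k (2 * τ) x)‖ ≤ 2 * (A * τ) + 3 * N * τ ^ α := by
    refine pm.trans ?_
    rw [← dist_eq_norm, dist_comm]
    calc _ ≤ (A + N * (2 * τ ^ (α - 1))) * (5 / 4 * τ) := by gcongr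
      _ = 5 / 4 * (A * τ) + 5 / 2 * N * τ ^ α := by rw [← e2]; ring
      _ ≤ _ := by nlinarith [mul_nonneg hA hτ0.le, mul_nonneg hN hτα.le]
  have h2α : N * (2 * τ) ^ α / α ≤ 2 / α * N * τ ^ α := by
    rw [Real.mul_rpow (by norm_num) hτ0.le]
    have : (2 : ℝ) ^ α ≤ 2 ^ (1 : ℝ) := Real.rpow_le_rpow_of_exponent_le (by norm_num) hα.le
    rw [Real.rpow_one] at this
    calc N * (2 ^ α * τ ^ α) / α ≤ N * (2 * τ ^ α) / α := by gcongr
      _ = _ := by ring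
  have htri : ‖F x - F y‖ ≤ ‖F (push z k (2 * τ) x) - F x‖ +
      ‖F (push z k (2 * τ) y) - F (push z k (2 * τ) x)‖ + ‖F (push z k (2 * τ) y) - F y‖ := by
    have e : F x - F y = -(F (push z k (2 * τ) x) - F x) -
      (F (push z k (2 * τ) y) - F (push z k (2 * τ) x)) + (F (push z k (2 * τ) y) - F y) := by ring
    rw [e]
    refine (norm_add_le _ _).trans (add_le_add ((norm_sub_le _ _).trans ?_) le_rfl)
    rw [norm_neg]
  have e7 : (4 / α + 3) * N * τ ^ α = 2 * (2 / α * N * τ ^ α) + 3 * N * τ ^ α := by ring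
  rw [e7]
  linarith

end Gluing

/-! ### The gradient of a harmonic function as a holomorphic function. -/

section ComplexGradient

/-- The complex number that represents a real linear form by `v ↦ Re (a v)`. -/
noncomputable def toComplex (L : ℂ →L[ℝ] ℝ) : ℂ := L 1 - I * L I

lemma re_toComplex_mul (L : ℂ →L[ℝ] ℝ) (v : ℂ) : (toComplex L * v).re = L v := by
  conv_rhs => rw [show v = v.re • (1 : ℂ) + v.im • I by simp]
  rw [map_add, map_smul, map_smul]
  simp [toComplex]; ring

/-- Evaluating the form v ↦ Re(a v) at v = conj a gives |a|², so the bound |Re(a v)| ≤ |a||v| is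
sharp. -/
lemma norm_toComplex (L : ℂ →L[ℝ] ℝ) : ‖toComplex L‖ = ‖L‖ := by
  apply le_antisymm
  · by_cases h0 : toComplex L = 0
    · simp [h0]
    · have h1 : L ((starRingEnd ℂ) (toComplex L)) = ‖toComplex L‖ ^ 2 := by
        rw [← re_toComplex_mul, mul_conj, normSq_eq_norm_sq, ofReal_re]
      have h2 := L.le_opNorm ((starRingEnd ℂ) (toComplex L))
      rw [h1, RCLike.norm_conj, norm_pow, norm_norm, sq] at h2
      exact le_of_mul_le_mul_right h2 (norm_pos_iff.2 h0)
  · refine L.opNorm_le_bound (norm_nonneg _) fun v => ?_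
    rw [← re_toComplex_mul, ← norm_mul, Real.norm_eq_abs]
    exact abs_re_le_norm _

lemma toComplex_sub (L L' : ℂ →L[ℝ] ℝ) : toComplex (L - L') = toComplex L - toComplex L' := by
  simp [toComplex]; ring

/-- The real linear form `v ↦ Re (a v)`, as a linear function of `a`. -/
noncomputable def ofComplex : ℂ →L[ℝ] ℂ →L[ℝ] ℝ :=
  (ContinuousLinearMap.compL ℝ ℂ ℂ ℝ reCLM).comp (ContinuousLinearMap.mul ℝ ℂ)

lemma ofComplex_apply (a v : ℂ) : ofComplex a v = (a * v).re := rfl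

lemma ofComplex_toComplex (L : ℂ →L[ℝ] ℝ) : ofComplex (toComplex L) = L := by
  ext; rw [ofComplex_apply, re_toComplex_mul]

lemma norm_ofComplex_le (a : ℂ) : ‖ofComplex a‖ ≤ ‖a‖ :=
  ContinuousLinearMap.opNorm_le_bound _ (norm_nonneg _) fun v => by
    rw [ofComplex_apply, ← norm_mul, Real.norm_eq_abs]
    exact abs_re_le_norm _

/-- The holomorphic function `∂u/∂x - i ∂u/∂y`. -/
noncomputable def cgrad (u : ℂ → ℝ) (x : ℂ) : ℂ := toComplex (fderiv ℝ u x)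

lemma norm_cgrad (u : ℂ → ℝ) (x : ℂ) : ‖cgrad u x‖ = ‖fderiv ℝ u x‖ := norm_toComplex _

lemma norm_fderiv_sub (u : ℂ → ℝ) (x y : ℂ) :
    ‖fderiv ℝ u x - fderiv ℝ u y‖ = ‖cgrad u x - cgrad u y‖ := by
  rw [cgrad, cgrad, ← toComplex_sub, norm_toComplex]

lemma re_cgrad_mul (u φ : ℂ → ℝ) (x : ℂ) :
    (cgrad u x * (fderiv ℝ φ x 1 + I * fderiv ℝ φ x I)).re =
      fderiv ℝ u x 1 * fderiv ℝ φ x 1 + fderiv ℝ u x I * fderiv ℝ φ x I := by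
  simp [cgrad, toComplex]

variable {u : ℂ → ℝ} {E : Set ℂ}

lemma differentiableAt_cgrad (hu : HarmonicOnNhd u E) {x : ℂ} (hx : x ∈ E) :
    DifferentiableAt ℂ (cgrad u) x :=
  HarmonicAt.differentiableAt_complex_partial (hu x hx)

lemma differentiableOn_cgrad (hu : HarmonicOnNhd u E) : DifferentiableOn ℂ (cgrad u) E :=
  fun _ hx => (differentiableAt_cgrad hu hx).differentiableWithinAt

lemma fderiv_fderiv_eq (hu : HarmonicOnNhd u E) {x : ℂ} (hx : x ∈ E) :
    fderiv ℝ (fderiv ℝ u) x = ofComplex.comp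
      ((ContinuousLinearMap.toSpanSingleton ℂ (deriv (cgrad u) x)).restrictScalars ℝ) := by
  have h1 : fderiv ℝ u = fun x => ofComplex (cgrad u x) := by
    ext x : 1; rw [cgrad, ofComplex_toComplex]
  have h2 : HasFDerivAt (cgrad u)
      ((ContinuousLinearMap.toSpanSingleton ℂ (deriv (cgrad u) x)).restrictScalars ℝ) x :=
    (differentiableAt_cgrad hu hx).hasDerivAt.hasFDerivAt.restrictScalars ℝ
  conv_lhs => rw [h1]
  exact (ofComplex.hasFDerivAt.comp x h2).fderiv

lemma norm_fderiv_fderiv_le (hu : HarmonicOnNhd u E) {x : ℂ} (hx : x ∈ E) :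
    ‖fderiv ℝ (fderiv ℝ u) x‖ ≤ ‖deriv (cgrad u) x‖ := by
  rw [fderiv_fderiv_eq hu hx]
  refine ContinuousLinearMap.opNorm_le_bound _ (norm_nonneg _) fun v => ?_
  refine (norm_ofComplex_le _).trans ?_
  simp [mul_comm]

lemma norm_fderiv_fderiv_sub_le (hu : HarmonicOnNhd u E) {x y : ℂ} (hx : x ∈ E) (hy : y ∈ E) :
    ‖fderiv ℝ (fderiv ℝ u) x - fderiv ℝ (fderiv ℝ u) y‖ ≤
      ‖deriv (cgrad u) x - deriv (cgrad u) y‖ := by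
  rw [fderiv_fderiv_eq hu hx, fderiv_fderiv_eq hu hy]
  refine ContinuousLinearMap.opNorm_le_bound _ (norm_nonneg _) fun v => ?_
  rw [sub_apply, ContinuousLinearMap.comp_apply,
    ContinuousLinearMap.comp_apply, ← map_sub]
  refine (norm_ofComplex_le _).trans ?_
  simp [← mul_sub, mul_comm]

end ComplexGradient

/-! ### Interior estimates by the L² norm. -/

section InteriorBounds

lemma intervalIntegrable_integral {F : Type*} [NormedAddCommGroup F] [NormedSpace ℝ F]
    {f : ℝ × ℝ → F} {a b a' b' : ℝ} (hab : a ≤ b) (hab' : a' ≤ b')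
    (hf : ContinuousOn f (Icc a b ×ˢ Icc a' b')) :
    IntervalIntegrable (fun s => ∫ θ in a'..b', f (s, θ)) volume a b := by
  have h1 : IntegrableOn f (Ioc a b ×ˢ Ioc a' b') :=
    (hf.integrableOn_compact (isCompact_Icc.prod isCompact_Icc)).mono_set
      (prod_mono Ioc_subset_Icc_self Ioc_subset_Icc_self)
  rw [IntegrableOn, Measure.volume_eq_prod, ← Measure.prod_restrict] at h1
  rw [intervalIntegrable_iff_integrableOn_Ioc_of_le hab]
  simp only [intervalIntegral.integral_of_le hab']
  exact h1.integral_prod_left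

/-- The `L²` norm over `E`. -/
noncomputable def l2norm (E : Set ℂ) (f : ℂ → ℂ) : ℝ := √(∫ x in E, ‖f x‖ ^ 2)

variable {E : Set ℂ} {f : ℂ → ℂ}

/-- The mean value property of f² bounds |f(x)|² by the mean of |f|² over each circle about x;
integration over the radii turns this into an area integral. -/
lemma norm_le_l2norm (hfi : IntegrableOn (fun x => ‖f x‖ ^ 2) E)
    (hf : DifferentiableOn ℂ f E) {x : ℂ} {ρ : ℝ} (hρ : 0 < ρ) (hball : ball x ρ ⊆ E) :
    ‖f x‖ ≤ l2norm E f / ρ := by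
  have hpi := Real.pi_gt_three
  -- The radii run from ρ/4 to 3ρ/4, which avoids the centre of the polar coordinates and the
  -- boundary of the disk. The annulus gives the factor πρ²/2, which is at least ρ².
  have hsub : closedAnnulus x (ρ / 4) (3 * ρ / 4) ⊆ ball x ρ := fun w hw => by
    rw [mem_ball, dist_eq_norm]; linarith [hw.2]
  have hc : ContinuousOn (fun w => ‖f w‖ ^ 2) (closedAnnulus x (ρ / 4) (3 * ρ / 4)) :=
    (hf.continuousOn.mono (hsub.trans hball)).norm.pow 2
  have h1 := setIntegral_annulus (by positivity) (by linarith) hc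
  have hmean : ∀ s ∈ Icc (ρ / 4) (3 * ρ / 4),
      2 * Real.pi * s * ‖f x‖ ^ 2 ≤ ∫ θ in (0 : ℝ)..2 * Real.pi, s • ‖f (circleMap x s θ)‖ ^ 2 := by
    intro s hs
    have hs0 : 0 < s := by linarith [hs.1]
    have hcb : closedBall x s ⊆ ball x ρ := closedBall_subset_ball (by linarith [hs.2])
    have hd : DiffContOnCl ℂ (fun w => f w ^ 2) (ball x s) :=
      DifferentiableOn.diffContOnCl (by
        rw [closure_ball x hs0.ne']
        exact (hf.mono (hcb.trans hball)).pow 2)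
    have h2 := hd.circleIntegral_sub_inv_smul (mem_ball_self hs0)
    rw [circleIntegral_eq_integral] at h2
    have h3 : ∫ θ in (0 : ℝ)..2 * Real.pi, f (circleMap x s θ) ^ 2 = 2 * Real.pi * f x ^ 2 := by
      apply mul_left_cancel₀ I_ne_zero
      rw [smul_eq_mul] at h2
      rw [show I * (2 * Real.pi * f x ^ 2) = 2 * Real.pi * I * f x ^ 2 by ring, ← h2]
      congr 1
      refine intervalIntegral.integral_congr fun θ _ => ?_
      have : circleMap x s θ - x ≠ 0 := by
        rw [← norm_pos_iff, norm_circleMap_sub x hs0.le]; exact hs0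
      simp only [smul_eq_mul]
      field_simp
    have h4 := intervalIntegral.norm_integral_le_integral_norm (μ := volume)
      (f := fun θ => f (circleMap x s θ) ^ 2) (by positivity : (0 : ℝ) ≤ 2 * Real.pi)
    rw [h3] at h4
    simp only [norm_mul, norm_pow, norm_real, Real.norm_eq_abs, abs_of_pos Real.pi_pos,
      RCLike.norm_ofNat] at h4
    simp only [smul_eq_mul]
    rw [intervalIntegral.integral_const_mul]
    calc _ = s * (2 * Real.pi * ‖f x‖ ^ 2) := by ring
      _ ≤ _ := by gcongr
  have hle : ∫ s in ρ / 4..3 * ρ / 4, 2 * Real.pi * s * ‖f x‖ ^ 2 ≤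
      ∫ s in ρ / 4..3 * ρ / 4, ∫ θ in (0 : ℝ)..2 * Real.pi, s • ‖f (circleMap x s θ)‖ ^ 2 := by
    refine intervalIntegral.integral_mono_on (by linarith)
      (Continuous.intervalIntegrable (by fun_prop) _ _) ?_ hmean
    have hcc := continuousOn_comp_circleMap (by positivity) hc (univ : Set ℝ)
    exact intervalIntegrable_integral (by linarith) (by positivity)
      ((continuous_fst.continuousOn.smul hcc).mono (prod_mono subset_rfl (subset_univ _)))
  have hval : ∫ s in ρ / 4..3 * ρ / 4, 2 * Real.pi * s * ‖f x‖ ^ 2 =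
      Real.pi / 2 * ρ ^ 2 * ‖f x‖ ^ 2 := by
    rw [intervalIntegral.integral_mul_const, intervalIntegral.integral_const_mul, integral_id]
    ring
  have hmono : ∫ w in openAnnulus x (ρ / 4) (3 * ρ / 4), ‖f w‖ ^ 2 ≤ ∫ w in E, ‖f w‖ ^ 2 := by
    refine setIntegral_mono_set hfi (ae_of_all _ fun w => by positivity)
      (LE.le.eventuallyLE ?_)
    exact fun w hw => hball (hsub ⟨hw.1.le, hw.2.le⟩)
  rw [← h1, hval] at hle
  have h5 : (ρ * ‖f x‖) ^ 2 ≤ ∫ w in E, ‖f w‖ ^ 2 := by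
    refine le_trans ?_ (hle.trans hmono)
    have : 0 ≤ ρ ^ 2 * ‖f x‖ ^ 2 := by positivity
    nlinarith
  rw [le_div_iff₀ hρ, mul_comm]
  exact Real.le_sqrt_of_sq_le h5

/-- Cauchy's estimate on the circle of radius ρ/2, about each point of which a disk of radius ρ/2 is
still available. The same step is repeated for the second derivative. -/
lemma norm_deriv_le_l2norm (hfi : IntegrableOn (fun x => ‖f x‖ ^ 2) E)
    (hf : DifferentiableOn ℂ f E) {x : ℂ} {ρ : ℝ} (hρ : 0 < ρ) (hball : ball x ρ ⊆ E) :
    ‖deriv f x‖ ≤ 4 * l2norm E f / ρ ^ 2 := by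
  have h1 := norm_deriv_le_of_forall_mem_sphere_norm_le (c := x) (R := ρ / 2)
    (C := l2norm E f / (ρ / 2)) (f := f) (by positivity)
    (DifferentiableOn.diffContOnCl (by
      rw [closure_ball x (by positivity)]
      exact hf.mono ((closedBall_subset_ball (by linarith)).trans hball))) fun w hw => by
        refine norm_le_l2norm hfi hf (by positivity) ((ball_subset_ball' ?_).trans hball)
        rw [mem_sphere.1 hw]; linarith
  exact h1.trans_eq (by field_simp; ring)

lemma norm_deriv_deriv_le_l2norm (hE : IsOpen E) (hfi : IntegrableOn (fun x => ‖f x‖ ^ 2) E)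
    (hf : DifferentiableOn ℂ f E) {x : ℂ} {ρ : ℝ} (hρ : 0 < ρ) (hball : ball x ρ ⊆ E) :
    ‖deriv (deriv f) x‖ ≤ 32 * l2norm E f / ρ ^ 3 := by
  have h1 := norm_deriv_le_of_forall_mem_sphere_norm_le (c := x) (R := ρ / 2)
    (C := 4 * l2norm E f / (ρ / 2) ^ 2) (f := deriv f) (by positivity)
    (DifferentiableOn.diffContOnCl (by
      rw [closure_ball x (by positivity)]
      exact (hf.deriv hE).mono ((closedBall_subset_ball (by linarith)).trans hball))) fun w hw => by
        refine norm_deriv_le_l2norm hfi hf (by positivity)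
          ((ball_subset_ball' ?_).trans hball)
        rw [mem_sphere.1 hw]; linarith
  exact h1.trans_eq (by field_simp; ring)

end InteriorBounds

/-! ### Green's formula in terms of the signed distance. -/

section Green

variable {σ r : ℝ} {p : ℂ} {f : ℂ → ℂ} {φ : ℂ → ℝ}

/-- Green's formula between two circles, for a function that vanishes on the second one. -/
lemma green_level (hσ : σ = 1 ∨ σ = -1) {t b : ℝ} (ht : 0 < r - σ * t) (hb : 0 < r - σ * b)
    (htb : t ≤ b) {U : Set ℂ} (hU : IsOpen U)
    (hUs : ∀ x, t ≤ level σ p r x → level σ p r x ≤ b → x ∈ U)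
    (hf : DifferentiableOn ℂ f U) (hφ : ContDiffOn ℝ 1 φ U)
    (hφb : ∀ x, level σ p r x = b → φ x = 0) :
    ∫ x in {x | t < level σ p r x ∧ level σ p r x < b},
        (f x * (fderiv ℝ φ x 1 + I * fderiv ℝ φ x I)).re =
      σ * ∫ θ in (0 : ℝ)..2 * Real.pi,
        ((circleMap p (r - σ * t) θ - p) * f (circleMap p (r - σ * t) θ)).re *
          φ (circleMap p (r - σ * t) θ) := by
  set F : ℂ → ℂ := fun x => f x * (fderiv ℝ φ x 1 + I * fderiv ℝ φ x I) with hF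
  have hFc : ContinuousOn F U := by
    have h1 : ContinuousOn (fderiv ℝ φ) U := hφ.continuousOn_fderiv_of_isOpen hU le_rfl
    have h2 := hf.continuousOn
    fun_prop
  have main : ∀ a b' : ℝ, 0 < a → a ≤ b' → closedAnnulus p a b' ⊆ U →
      ∫ x in openAnnulus p a b', (F x).re =
        ((∫ θ in (0 : ℝ)..2 * Real.pi,
          (b' * cexp (θ * I)) * (f (circleMap p b' θ) * φ (circleMap p b' θ))) -
        ∫ θ in (0 : ℝ)..2 * Real.pi,
          (a * cexp (θ * I)) * (f (circleMap p a θ) * φ (circleMap p a θ))).re := by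
    intro a b' ha hab hs
    rw [← green_annulus ha hab hU hs hf hφ]
    have h1 := setIntegral_annulus ha hab (hFc.mono hs)
    simp only [real_smul] at h1
    rw [← h1]
    have hcomp : IsCompact (closedAnnulus p a b') :=
      Metric.isCompact_of_isClosed_isBounded (isClosed_closedAnnulus p a b')
        ((isBounded_closedBall (x := p) (r := b')).subset fun w hw => by
          rw [mem_closedBall, dist_eq_norm]; exact hw.2)
    have hint : IntegrableOn F (openAnnulus p a b') :=
      ((hFc.mono hs).integrableOn_compact hcomp).mono_set fun w hw => ⟨hw.1.le, hw.2.le⟩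
    exact reCLM.integral_comp_comm hint
  have hUa : ∀ s, (s = t ∨ s = b) → ∀ θ, circleMap p (r - σ * s) θ ∈ U := fun s hs θ => by
    have h0 : 0 ≤ r - σ * s := by rcases hs with rfl | rfl; exacts [ht.le, hb.le]
    have h1 := level_circleMap hσ p h0 θ
    refine hUs _ ?_ ?_ <;> rw [h1] <;> rcases hs with rfl | rfl <;> linarith
  have hzero : ∫ θ in (0 : ℝ)..2 * Real.pi, (((r - σ * b : ℝ) : ℂ) * cexp (θ * I)) *
      (f (circleMap p (r - σ * b) θ) * φ (circleMap p (r - σ * b) θ)) = 0 := by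
    simp [hφb _ (level_circleMap hσ p hb.le _)]
  have hre : (∫ θ in (0 : ℝ)..2 * Real.pi, (((r - σ * t : ℝ) : ℂ) * cexp (θ * I)) *
      (f (circleMap p (r - σ * t) θ) * φ (circleMap p (r - σ * t) θ))).re =
      ∫ θ in (0 : ℝ)..2 * Real.pi,
        ((circleMap p (r - σ * t) θ - p) * f (circleMap p (r - σ * t) θ)).re *
          φ (circleMap p (r - σ * t) θ) := by
    have hfc : Continuous fun θ => f (circleMap p (r - σ * t) θ) :=
      hf.continuousOn.comp_continuous (continuous_circleMap _ _) (hUa t (Or.inl rfl))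
    have hφc : Continuous fun θ => φ (circleMap p (r - σ * t) θ) :=
      hφ.continuousOn.comp_continuous (continuous_circleMap _ _) (hUa t (Or.inl rfl))
    have hi : IntervalIntegrable (fun θ : ℝ => (((r - σ * t : ℝ) : ℂ) * cexp (θ * I)) *
      (f (circleMap p (r - σ * t) θ) * φ (circleMap p (r - σ * t) θ))) volume 0 (2 * Real.pi) :=
      Continuous.intervalIntegrable (Continuous.mul (by fun_prop)
        (hfc.mul (continuous_ofReal.comp hφc))) _ _
    refine (reCLM.intervalIntegral_comp_comm hi).symm.trans ?_
    refine intervalIntegral.integral_congr fun θ _ => ?_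
    have hw : circleMap p (r - σ * t) θ - p = ((r - σ * t : ℝ) : ℂ) * cexp (θ * I) := by
      rw [circleMap, add_sub_cancel_left]
    simp only [reCLM_apply]
    rw [hw, ← mul_assoc, re_mul_ofReal]
  -- For σ = 1 the circle at distance t is the outer boundary of the annulus, for σ = −1 the inner
  -- one; this is where the factor σ comes from.
  rcases hσ with rfl | rfl
  · have hset : {x | t < level 1 p r x ∧ level 1 p r x < b} =
        openAnnulus p (r - 1 * b) (r - 1 * t) := by
      ext x; simp only [openAnnulus, level, mem_ofPred_eq]
      constructor <;> rintro ⟨h1, h2⟩ <;> constructor <;> linarith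
    rw [hset, main _ _ hb (by linarith), hzero, sub_zero, hre]
    · ring
    intro x hx
    have h1 := hx.1
    have h2 := hx.2
    refine hUs x ?_ ?_ <;> rw [level] <;> linarith
  · have hset : {x | t < level (-1) p r x ∧ level (-1) p r x < b} =
        openAnnulus p (r - (-1) * t) (r - (-1) * b) := by
      ext x; simp only [openAnnulus, level, mem_ofPred_eq]
      constructor <;> rintro ⟨h1, h2⟩ <;> constructor <;> linarith
    rw [hset, main _ _ ht (by linarith), hzero, zero_sub, neg_re, hre]
    · ring
    intro x hx
    have h1 := hx.1
    have h2 := hx.2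
    refine hUs x ?_ ?_ <;> rw [level] <;> linarith

end Green

/-! ### From the weak Neumann problem to the boundary flux on each circle. -/

section Flux

lemma tendsto_setIntegral_of_eventually_mem {F : ℂ → ℝ} {S : ℝ → Set ℂ} {S₀ : Set ℂ}
    (hS : ∀ t, MeasurableSet (S t)) (hS₀ : MeasurableSet S₀)
    (hsub : ∀ t, 0 < t → S t ⊆ S₀) (hmem : ∀ x ∈ S₀, ∀ᶠ t in 𝓝[>] (0 : ℝ), x ∈ S t)
    (hF : IntegrableOn F S₀) :
    Tendsto (fun t => ∫ x in S t, F x) (𝓝[>] 0) (𝓝 (∫ x in S₀, F x)) := by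
  simp only [← integral_indicator (hS _), ← integral_indicator hS₀]
  have hFi : Integrable (S₀.indicator F) := hF.integrable_indicator hS₀
  refine tendsto_integral_filter_of_dominated_convergence (fun x => ‖S₀.indicator F x‖) ?_ ?_
    hFi.norm ?_
  · filter_upwards [self_mem_nhdsWithin] with t ht
    have : (S t).indicator F = (S t).indicator (S₀.indicator F) := by
      rw [indicator_indicator, inter_eq_left.2 (hsub t ht)]
    rw [this]
    exact hFi.aestronglyMeasurable.indicator (hS t)
  · filter_upwards [self_mem_nhdsWithin] with t ht
    exact ae_of_all _ fun x => norm_indicator_le_of_subset (hsub t ht) F x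
  · refine ae_of_all _ fun x => ?_
    by_cases hx : x ∈ S₀
    · refine tendsto_const_nhds.congr' ?_
      filter_upwards [hmem x hx] with t ht
      rw [indicator_of_mem hx, indicator_of_mem ht]
    · refine tendsto_const_nhds.congr' ?_
      filter_upwards [self_mem_nhdsWithin] with t ht
      rw [indicator_of_notMem hx, indicator_of_notMem fun h => hx (hsub t ht h)]

variable {c d : ℝ} {n : ℕ} {z : Fin (n + 1) → ℂ} {r : Fin (n + 1) → ℝ} {g u : ℂ → ℝ}

lemma isBounded_domain (z : Fin (n + 1) → ℂ) (r : Fin (n + 1) → ℝ) :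
    Bornology.IsBounded (domain z r) :=
  isBounded_ball.subset sdiff_subset

lemma volume_domain_lt_top (z : Fin (n + 1) → ℂ) (r : Fin (n + 1) → ℝ) :
    volume (domain z r) < ⊤ := (isBounded_domain z r).measure_lt_top

instance (z : Fin (n + 1) → ℂ) (r : Fin (n + 1) → ℝ) :
    IsFiniteMeasure (volume.restrict (domain z r)) :=
  ⟨by rw [Measure.restrict_apply_univ]; exact volume_domain_lt_top z r⟩

lemma IsNeumannSolution.memLp_cgrad (hu : IsNeumannSolution z r g u) :
    MemLp (cgrad u) 2 (volume.restrict (domain z r)) :=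
  hu.memLp_deriv.of_le
    ((differentiableOn_cgrad hu.harmonic).continuousOn.aestronglyMeasurable
      isOpen_domain.measurableSet) (ae_of_all _ fun x => (norm_cgrad u x).le)

lemma IsNeumannSolution.integrable_sq (hu : IsNeumannSolution z r g u) :
    IntegrableOn (fun x => ‖cgrad u x‖ ^ 2) (domain z r) :=
  hu.memLp_cgrad.integrable_norm_pow (p := 2) (by norm_num)

lemma exists_norm_le_of_continuous {F : Type*} [NormedAddCommGroup F] {f : ℂ → F}
    (hf : Continuous f) (z : Fin (n + 1) → ℂ) (r : Fin (n + 1) → ℝ) :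
    ∃ M, ∀ x ∈ domain z r, ‖f x‖ ≤ M := by
  obtain ⟨M, hM⟩ := (isCompact_closedBall (z 0) (r 0)).exists_bound_of_continuousOn
    hf.continuousOn
  exact ⟨M, fun x hx => hM x (ball_subset_closedBall hx.1)⟩

lemma IsNeumannSolution.integrable_cgrad_mul (hu : IsNeumannSolution z r g u) {φ : ℂ → ℝ}
    (hφ : ContDiff ℝ ∞ φ) : IntegrableOn
      (fun x => (cgrad u x * (fderiv ℝ φ x 1 + I * fderiv ℝ φ x I)).re) (domain z r) := by
  have h1 : Integrable (cgrad u) (volume.restrict (domain z r)) :=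
    hu.memLp_cgrad.integrable (by norm_num)
  have hc : Continuous fun x : ℂ => ((fderiv ℝ φ x 1 : ℂ) + I * fderiv ℝ φ x I) := by
    have := hφ.continuous_fderiv (by simp)
    fun_prop
  obtain ⟨M, hM⟩ := exists_norm_le_of_continuous hc z r
  refine (h1.mul_bdd hc.aestronglyMeasurable (c := M) ?_).re
  filter_upwards [ae_restrict_mem isOpen_domain.measurableSet] with x hx using hM x hx

/-- Green's formula converts the flux through the circle at distance t into an integral over the
strip beyond it. As t → 0 this tends to the integral over the full strip, which the weak formulation
evaluates, since φ lives near the k-th circle only. -/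
lemma IsNeumannSolution.hasBoundaryFlux (h : Admissible c d z r) (hc : 0 < c) (hn : 1 ≤ n)
    (hu : IsNeumannSolution z r g u) (k : Fin (n + 1)) :
    HasBoundaryFlux (side k) (z k) (r k) d (cgrad u)
      (fun θ => g (circleMap (z k) (r k) θ)) := by
  intro φ hφ hφd
  have hd := h.d_pos
  have hr := h.radius_pos hc hn
  have hE := (isOpen_domain (z := z) (r := r)).measurableSet
  have hlev : Continuous (lev z r k) := continuous_lev k
  have hside := side_eq k
  have hrb : side k = 1 → 2 * d ≤ r k := h.two_mul_le_radius_of_side hc hn k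
  set F : ℂ → ℝ := fun x => (cgrad u x * (fderiv ℝ φ x 1 + I * fderiv ℝ φ x I)).re with hF
  -- The width 3d/2 lies between d, from which φ vanishes, and 2d, up to which the strip is in the
  -- domain.
  set S₀ : Set ℂ := {x | 0 < lev z r k x ∧ lev z r k x < 3 * d / 2} with hS₀
  have hopen : ∀ t, IsOpen {x | t < lev z r k x ∧ lev z r k x < 3 * d / 2} := fun t =>
    (isOpen_lt continuous_const hlev).and (isOpen_lt hlev continuous_const)
  have hsubE : S₀ ⊆ domain z r := fun x hx => h.strip_subset hc hx.1 (by linarith [hx.2])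
  have hFi := hu.integrable_cgrad_mul hφ
  have hφ0 : ∀ x, d < lev z r k x → fderiv ℝ φ x = 0 := fun x hx => by
    have : φ =ᶠ[𝓝 x] fun _ => 0 := by
      filter_upwards [(isOpen_lt continuous_const hlev).mem_nhds hx] with y hy
      exact hφd y (le_of_lt hy)
    rw [this.fderiv_eq]; simp
  have hweak : ∫ x in S₀, F x = r k * ∫ θ in (0 : ℝ)..2 * Real.pi,
      g (circleMap (z k) (r k) θ) * φ (circleMap (z k) (r k) θ) := by
    have h1 : ∫ x in S₀, F x = ∫ x in domain z r, F x := by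
      refine (setIntegral_eq_of_subset_of_forall_sdiff_eq_zero hE hsubE fun x hx => ?_).symm
      have : d < lev z r k x := by
        by_contra hcon
        push Not at hcon
        exact hx.2 ⟨mem_domain_iff.1 hx.1 k, by linarith⟩
      simp [hF, hφ0 x this]
    rw [h1]
    simp only [hF, re_cgrad_mul]
    rw [hu.neumann φ hφ]
    -- On any other circle the distance to the k-th one is at least 2d, so φ vanishes there.
    refine Finset.sum_eq_single k (fun j _ hj => ?_) (by simp)
    have : ∀ θ, φ (circleMap (z j) (r j) θ) = 0 := fun θ => by
      have h2 := h.le_lev_add_lev hc hj (circleMap (z j) (r j) θ)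
      have h3 : lev z r j (circleMap (z j) (r j) θ) = 0 := by
        have := level_circleMap (side_eq j) (z j) (r := r j) (t := 0)
          (by simpa using (hr j).le) θ
        simpa [lev] using this
      refine hφd _ ?_
      change d ≤ lev z r k _
      linarith
    simp [this]
  have hlim := tendsto_setIntegral_of_eventually_mem (F := F)
    (S := fun t => {x | t < lev z r k x ∧ lev z r k x < 3 * d / 2}) (S₀ := S₀)
    (fun t => (hopen t).measurableSet) (hopen 0).measurableSet
    (fun t ht x hx => ⟨ht.trans hx.1, hx.2⟩)
    (fun x hx => by
      filter_upwards [Ioo_mem_nhdsGT hx.1] with t ht using ⟨ht.2, hx.2⟩)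
    (hFi.mono_set hsubE)
  rw [hweak] at hlim
  have hlim2 := hlim.const_mul (side k)
  rw [← mul_assoc] at hlim2
  refine hlim2.congr' ?_
  filter_upwards [Ioo_mem_nhdsGT hd] with t ht
  have hσσ : side k * side k = 1 := by rcases hside with h0 | h0 <;> rw [h0] <;> norm_num
  have hpos : ∀ s, 0 ≤ s → s < 2 * d → 0 < r k - side k * s := fun s hs hs' => by
    rcases hside with h0 | h0
    · have := hrb h0; rw [h0]; linarith
    · rw [h0]; linarith [hr k]
  have hgreen := green_level (p := z k) (f := cgrad u) (φ := φ) hside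
    (hpos t ht.1.le (by linarith [ht.2])) (hpos (3 * d / 2) (by linarith) (by linarith))
    (by linarith [ht.2]) (U := {x | 0 < lev z r k x ∧ lev z r k x < 2 * d})
    ((isOpen_lt continuous_const hlev).and (isOpen_lt hlev continuous_const))
    (fun x hx hx' => ⟨lt_of_lt_of_le ht.1 hx, lt_of_le_of_lt hx' (by linarith)⟩)
    ((differentiableOn_cgrad hu.harmonic).mono fun x hx => h.strip_subset hc hx.1 hx.2)
    (hφ.of_le (by simp)).contDiffOn
    (fun x hx => hφd x (by rw [hx]; linarith))
  change side k * ∫ x in {x | t < level (side k) (z k) (r k) x ∧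
    level (side k) (z k) (r k) x < 3 * d / 2}, F x = _
  rw [hgreen, ← mul_assoc, hσσ, one_mul]

end Flux

/-! ### Hölder bounds for the densities of the Cauchy integrals. -/

section Density

variable {p : ℂ} {r α : ℝ} {γ γ' : ℝ → ℝ}

lemma norm_exp_neg_mul_I (a : ℝ) : ‖cexp (-(a * I))‖ = 1 := by
  rw [← norm_exp_ofReal_mul_I (-a)]; push_cast; ring_nf

/-- The chord on the unit circle is x ≤ 2, hence x = x^(1−α) x^α ≤ 2 x^α; scaling to radius r
produces r^(−α). -/
lemma norm_exp_sub_exp_le (p : ℂ) (hr : 0 < r) (hα₀ : 0 < α) (hα : α < 1) (a b : ℝ) :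
    ‖cexp (-(a * I)) - cexp (-(b * I))‖ ≤
      2 * (r ^ (-α) * ‖circleMap p r a - circleMap p r b‖ ^ α) := by
  set x := ‖cexp (-(a * I)) - cexp (-(b * I))‖ with hx
  have hxc : ‖circleMap p r a - circleMap p r b‖ = r * x := by
    have h1 : circleMap p r a - circleMap p r b = r * (cexp (a * I) - cexp (b * I)) := by
      simp [circleMap]; ring
    have h2 : cexp (-(a * I)) - cexp (-(b * I)) =
        (starRingEnd ℂ) (cexp (a * I) - cexp (b * I)) := by
      rw [map_sub, ← exp_conj, ← exp_conj]; simp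
    rw [h1, norm_mul, hx, h2, RCLike.norm_conj, norm_real, Real.norm_eq_abs, abs_of_pos hr]
  have hx0 : 0 ≤ x := norm_nonneg _
  have hx2 : x ≤ 2 := by
    refine (norm_sub_le _ _).trans ?_
    rw [norm_exp_neg_mul_I, norm_exp_neg_mul_I]; norm_num
  rw [hxc, Real.mul_rpow hr.le hx0, ← mul_assoc (r ^ (-α)), ← Real.rpow_add hr, neg_add_cancel,
    Real.rpow_zero, one_mul]
  rcases hx0.eq_or_lt with h0 | h0
  · rw [← h0]; positivity
  · calc x = x ^ (1 - α) * x ^ α := by rw [← Real.rpow_add h0]; simp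
      _ ≤ 2 ^ (1 - α) * x ^ α := by
        gcongr
      _ ≤ 2 ^ (1 : ℝ) * x ^ α := by
        gcongr
        · norm_num
        · linarith
      _ = 2 * x ^ α := by rw [Real.rpow_one]

lemma norm_density_sub_le (hr : 0 < r) (hα₀ : 0 < α) (hα : α < 1) {Mg Hg : ℝ}
    (hM : ∀ θ, |γ θ| ≤ Mg)
    (hH : ∀ a b, |γ a - γ b| ≤ Hg * ‖circleMap p r a - circleMap p r b‖ ^ α) (a b : ℝ) :
    ‖density γ a - density γ b‖ ≤
      (2 * Hg + 4 * Mg * r ^ (-α)) * ‖circleMap p r a - circleMap p r b‖ ^ α := by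
  have h1 : density γ a - density γ b = 2 * ((γ a - γ b : ℝ) : ℂ) * cexp (-(a * I)) +
      2 * (γ b : ℂ) * (cexp (-(a * I)) - cexp (-(b * I))) := by
    simp only [density]; push_cast; ring
  rw [h1]
  refine (norm_add_le _ _).trans ?_
  simp only [norm_mul, norm_exp_neg_mul_I, norm_real, Real.norm_eq_abs, RCLike.norm_ofNat]
  have h2 := norm_exp_sub_exp_le p hr hα₀ hα a b
  have h3 : 0 ≤ Mg := (abs_nonneg _).trans (hM b)
  calc _ ≤ 2 * (Hg * ‖circleMap p r a - circleMap p r b‖ ^ α) * 1 + 2 * Mg *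
        (2 * (r ^ (-α) * ‖circleMap p r a - circleMap p r b‖ ^ α)) := by
        gcongr
        · exact hH a b
        · exact hM b
    _ = _ := by ring

lemma norm_densityDeriv_sub_le (hr : 0 < r) (hα₀ : 0 < α) (hα : α < 1) {Mg Hg Mg' Hg' : ℝ}
    (hM : ∀ θ, |γ θ| ≤ Mg)
    (hH : ∀ a b, |γ a - γ b| ≤ Hg * ‖circleMap p r a - circleMap p r b‖ ^ α)
    (hM' : ∀ θ, |γ' θ| ≤ r * Mg')
    (hH' : ∀ a b, |γ' a - γ' b| ≤ r * Hg' * ‖circleMap p r a - circleMap p r b‖ ^ α) (a b : ℝ) :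
    ‖densityDeriv r γ γ' a - densityDeriv r γ γ' b‖ ≤
      (2 * Hg' + 2 * Hg / r + 8 * (Mg' + Mg / r) * r ^ (-α)) *
        ‖circleMap p r a - circleMap p r b‖ ^ α := by
  set e : ℝ → ℂ := fun a => cexp (-(a * I)) with he
  have he2 : ∀ a : ℝ, cexp (-(2 * a * I)) = e a * e a := fun a => by
    rw [he, ← exp_add]; ring_nf
  have hne : ∀ a, ‖e a‖ = 1 := norm_exp_neg_mul_I
  -- The difference of the squares of the exponentials is factored as (e_a + e_b)(e_a − e_b), so the
  -- bound for a single exponential serves again, with an extra factor 2.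
  have h1 : densityDeriv r γ γ' a - densityDeriv r γ γ' b = -I * 2 / r *
      ((((γ' a - γ' b : ℝ) : ℂ) - I * ((γ a - γ b : ℝ) : ℂ)) * (e a * e a) +
        ((γ' b : ℂ) - I * γ b) * ((e a + e b) * (e a - e b))) := by
    simp only [densityDeriv, he2]; push_cast; ring
  have h2 : ‖e a - e b‖ ≤ _ := norm_exp_sub_exp_le p hr hα₀ hα a b
  have h3 : 0 ≤ Mg := (abs_nonneg _).trans (hM b)
  have h3' : 0 ≤ r * Mg' := (abs_nonneg _).trans (hM' b)
  have h4 : ‖(((γ' a - γ' b : ℝ) : ℂ) - I * ((γ a - γ b : ℝ) : ℂ))‖ ≤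
      |γ' a - γ' b| + |γ a - γ b| := by
    refine (norm_sub_le _ _).trans_eq ?_
    rw [norm_mul, norm_I, one_mul, norm_real, norm_real, Real.norm_eq_abs, Real.norm_eq_abs]
  have h5 : ‖((γ' b : ℂ) - I * γ b)‖ ≤ |γ' b| + |γ b| := by
    refine (norm_sub_le _ _).trans_eq ?_
    rw [norm_mul, norm_I, one_mul, norm_real, norm_real, Real.norm_eq_abs, Real.norm_eq_abs]
  have h6 : ‖e a + e b‖ ≤ 2 := (norm_add_le _ _).trans_eq (by rw [hne, hne]; norm_num)
  set X := ‖circleMap p r a - circleMap p r b‖ ^ α with hX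
  rw [h1, norm_mul]
  have h7 : ‖-I * 2 / (r : ℂ)‖ = 2 / r := by simp [abs_of_pos hr]
  rw [h7]
  calc 2 / r * _ ≤ 2 / r * ((r * Hg' * X + Hg * X) * (1 * 1) +
        (r * Mg' + Mg) * (2 * (2 * (r ^ (-α) * X)))) := by
        gcongr
        refine (norm_add_le _ _).trans ?_
        rw [norm_mul, norm_mul, norm_mul, norm_mul, hne]
        gcongr
        · exact h4.trans (add_le_add (hH' a b) (hH a b))
        · exact h5.trans (add_le_add (hM' b) (hM b))
    _ = _ := by field_simp; ring

end Density

/-! ### Derivative bounds for the complex gradient in the whole domain. -/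

section DerivBounds

variable {c d : ℝ} {n : ℕ} {z : Fin (n + 1) → ℂ} {r : Fin (n + 1) → ℝ} {g u : ℂ → ℝ}

/-- Bounds for the boundary data and its derivative. -/
structure DataBound (z : Fin (n + 1) → ℂ) (r : Fin (n + 1) → ℝ) (g : ℂ → ℝ)
    (α Mg Hg Mg' Hg' : ℝ) : Prop where
  sup_nonneg : 0 ≤ Mg
  holder_nonneg : 0 ≤ Hg
  deriv_sup_nonneg : 0 ≤ Mg'
  deriv_holder_nonneg : 0 ≤ Hg'
  contDiff : ∀ k, ContDiff ℝ 1 fun θ : ℝ => g (circleMap (z k) (r k) θ)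
  abs_le : ∀ k θ, |g (circleMap (z k) (r k) θ)| ≤ Mg
  abs_sub_le : ∀ k a b, |g (circleMap (z k) (r k) a) - g (circleMap (z k) (r k) b)| ≤
    Hg * ‖circleMap (z k) (r k) a - circleMap (z k) (r k) b‖ ^ α
  abs_deriv_le : ∀ k θ, |deriv (fun θ : ℝ => g (circleMap (z k) (r k) θ)) θ| ≤ r k * Mg'
  abs_deriv_sub_le : ∀ k a b, |deriv (fun θ : ℝ => g (circleMap (z k) (r k) θ)) a -
      deriv (fun θ : ℝ => g (circleMap (z k) (r k) θ)) b| ≤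
    r k * Hg' * ‖circleMap (z k) (r k) a - circleMap (z k) (r k) b‖ ^ α

lemma ball_subset_domain {x : ℂ} {ρ : ℝ} (hx : ∀ k, ρ ≤ lev z r k x) :
    ball x ρ ⊆ domain z r := fun y hy => mem_domain_iff.2 fun k => by
  have h1 := abs_lev_sub_le (z := z) (r := r) k x y
  have h2 := le_abs_self (lev z r k x - lev z r k y)
  rw [mem_ball'] at hy
  linarith [hx k]

lemma Admissible.rpow_radius_le (h : Admissible c d z r) (hc : 0 < c) (hc1 : c ≤ 1) (hn : 1 ≤ n)
    {α : ℝ} (hα₀ : 0 < α) (hα : α < 1) (k : Fin (n + 1)) :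
    r k ^ (-α) ≤ c⁻¹ * d ^ (-α) := by
  have hd := h.d_pos
  calc r k ^ (-α) ≤ (c * d) ^ (-α) :=
        Real.rpow_le_rpow_of_nonpos (by positivity) (h.mul_le_radius hc hc1 hn k) (by linarith)
    _ = c ^ (-α) * d ^ (-α) := Real.mul_rpow hc.le hd.le
    _ ≤ c ^ (-1 : ℝ) * d ^ (-α) := by
        gcongr ?_ * _
        exact Real.rpow_le_rpow_of_exponent_ge hc hc1 (by linarith)
    _ = _ := by rw [Real.rpow_neg_one]

/-- The bounds near a circle. -/
lemma IsNeumannSolution.norm_deriv_le_of_lev_le (h : Admissible c d z r) (hc : 0 < c)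
    (hc1 : c ≤ 1) (hn : 1 ≤ n) (hu : IsNeumannSolution z r g u) {α Mg Hg Mg' Hg' : ℝ}
    (hα₀ : 0 < α) (hα : α < 1) (hg : DataBound z r g α Mg Hg Mg' Hg') {k : Fin (n + 1)} {x : ℂ}
    (hx₀ : 0 < lev z r k x) (hxd : lev z r k x ≤ d / 2) :
    ‖deriv (cgrad u) x‖ ≤
        4 / (1 - α) * (2 * Hg + 4 / c * Mg * d ^ (-α)) * lev z r k x ^ (α - 1) +
          8 * r 0 * l2norm (domain z r) (cgrad u) / (c ^ 2 * d ^ 3) ∧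
      ‖deriv (deriv (cgrad u)) x‖ ≤
        4 / (1 - α) * (2 * Hg' + 2 * Hg / (c * d) + 8 / c * (Mg' + Mg / (c * d)) * d ^ (-α)) *
            lev z r k x ^ (α - 1) +
          32 * r 0 * l2norm (domain z r) (cgrad u) / (c ^ 3 * d ^ 4) := by
  have hd := h.d_pos
  have hrk := h.radius_pos hc hn k
  have hcr := h.mul_le_radius hc hc1 hn k
  have hMg := hg.sup_nonneg
  have hHg := hg.holder_nonneg
  have hMg' := hg.deriv_sup_nonneg
  have hHg' := hg.deriv_holder_nonneg
  have hcd : 0 < c * d := by positivity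
  have hrα := h.rpow_radius_le hc hc1 hn hα₀ hα k
  set K := l2norm (domain z r) (cgrad u) with hK
  have hK0 : 0 ≤ K := Real.sqrt_nonneg _
  set γ : ℝ → ℝ := fun θ => g (circleMap (z k) (r k) θ) with hγ
  have hf := differentiableOn_cgrad hu.harmonic
  have hder := (hu.hasBoundaryFlux h hc hn k).hasDerivAt (side_eq k) hrk
    (h.two_mul_le_radius_of_side hc hn k) (hf.mono fun x hx => h.strip_subset hc hx.1 hx.2)
    (γ' := deriv γ) (fun θ => ((hg.contDiff k).differentiable (by simp) θ).hasDerivAt)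
    ((hg.contDiff k).continuous_deriv le_rfl)
    (by rw [show (2 * Real.pi) = 0 + 2 * Real.pi by ring, periodic_circleMap])
    hc hc1 hcr hα₀ hα (M := K / d)
    (N₀ := 2 * Hg + 4 / c * Mg * d ^ (-α))
    (N₁ := 2 * Hg' + 2 * Hg / (c * d) + 8 / c * (Mg' + Mg / (c * d)) * d ^ (-α))
    -- On the parallel circle at distance d all other circles are also at distance at least d, so f
    -- is bounded there by K/d.
    (fun x hx => norm_le_l2norm hu.integrable_sq hf hd (ball_subset_domain fun j => by
      by_cases hj : j = k
      · rw [hj]; exact hx.ge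
      · have h1 := h.le_lev_add_lev hc hj x
        have h2 : lev z r k x = d := hx
        linarith))
    (by positivity) (by positivity)
    (fun a b => (norm_density_sub_le (p := z k) hrk hα₀ hα (hg.abs_le k) (hg.abs_sub_le k) a b).trans
      (by
        gcongr ?_ * _
        calc 2 * Hg + 4 * Mg * r k ^ (-α) ≤ 2 * Hg + 4 * Mg * (c⁻¹ * d ^ (-α)) := by gcongr
          _ = _ := by ring))
    (fun a b => (norm_densityDeriv_sub_le (p := z k) hrk hα₀ hα (hg.abs_le k) (hg.abs_sub_le k)
      (hg.abs_deriv_le k) (hg.abs_deriv_sub_le k) a b).trans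
      (by
        gcongr ?_ * _
        calc 2 * Hg' + 2 * Hg / r k + 8 * (Mg' + Mg / r k) * r k ^ (-α) ≤
            2 * Hg' + 2 * Hg / (c * d) + 8 * (Mg' + Mg / (c * d)) * (c⁻¹ * d ^ (-α)) := by gcongr
          _ = _ := by ring))
    hx₀ hxd
  have hrs := h.radius_side_le hc k
  refine ⟨hder.1.trans ?_, hder.2.trans ?_⟩
  · change _ * lev z r k x ^ (α - 1) + _ ≤ _
    gcongr ?_ + ?_
    · rfl
    · calc 8 * (r k - side k * d) * (K / d) / (c * d) ^ 2 ≤ 8 * r 0 * (K / d) / (c * d) ^ 2 := by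
            gcongr
        _ = _ := by field_simp
  · change _ * lev z r k x ^ (α - 1) + _ ≤ _
    gcongr ?_ + ?_
    · rfl
    · calc 32 * (r k - side k * d) * (K / d) / (c * d) ^ 3 ≤ 32 * r 0 * (K / d) / (c * d) ^ 3 := by
            gcongr
        _ = _ := by field_simp

lemma IsNeumannSolution.norm_deriv_le_of_le_lev (hu : IsNeumannSolution z r g u) {x : ℂ} {ρ : ℝ}
    (hρ : 0 < ρ) (hx : ∀ k, ρ ≤ lev z r k x) :
    ‖cgrad u x‖ ≤ l2norm (domain z r) (cgrad u) / ρ ∧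
      ‖deriv (cgrad u) x‖ ≤ 4 * l2norm (domain z r) (cgrad u) / ρ ^ 2 ∧
      ‖deriv (deriv (cgrad u)) x‖ ≤ 32 * l2norm (domain z r) (cgrad u) / ρ ^ 3 := by
  have hf := differentiableOn_cgrad hu.harmonic
  have hb := ball_subset_domain hx
  exact ⟨norm_le_l2norm hu.integrable_sq hf hρ hb, norm_deriv_le_l2norm hu.integrable_sq hf hρ hb,
    norm_deriv_deriv_le_l2norm isOpen_domain hu.integrable_sq hf hρ hb⟩

/-- Within d/2 of some circle the local representation applies, and t^(α−1) decreases in t. At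
points with distance at least d/2 from all circles the interior estimate is absorbed into the
constant term, by d ≤ r 0 and c ≤ 1. -/
lemma IsNeumannSolution.derivBound_cgrad (h : Admissible c d z r) (hc : 0 < c)
    (hc1 : c ≤ 1) (hn : 1 ≤ n) (hu : IsNeumannSolution z r g u) {α Mg Hg Mg' Hg' : ℝ}
    (hα₀ : 0 < α) (hα : α < 1) (hg : DataBound z r g α Mg Hg Mg' Hg') :
    DerivBound z r d α (16 * r 0 * l2norm (domain z r) (cgrad u) / (c ^ 2 * d ^ 3))
      (4 / (1 - α) * (2 * Hg + 4 / c * Mg * d ^ (-α)))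
      (4 * l2norm (domain z r) (cgrad u) / d) (cgrad u) := by
  have hd := h.d_pos
  have hr0 := h.radius_zero_ge hc hn
  have hMg := hg.sup_nonneg
  have hHg := hg.holder_nonneg
  have hα' : 0 < 1 - α := by linarith
  set K := l2norm (domain z r) (cgrad u) with hK
  have hK0 : 0 ≤ K := Real.sqrt_nonneg _
  have hr0' : 0 < r 0 := by linarith
  refine ⟨by positivity, by positivity, fun x hx => differentiableAt_cgrad hu.harmonic hx,
    fun x hx t ht hxt => ?_, fun x hx hxd => ?_⟩
  · by_cases hfar : ∀ k, d / 2 ≤ lev z r k x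
    · have h1 := (hu.norm_deriv_le_of_le_lev (half_pos hd) hfar).2.1
      have h2 : 4 * K / (d / 2) ^ 2 ≤ 16 * r 0 * K / (c ^ 2 * d ^ 3) := by
        rw [div_le_div_iff₀ (by positivity) (by positivity)]
        have hc2 : c ^ 2 ≤ 1 := pow_le_one₀ hc.le hc1
        calc 4 * K * (c ^ 2 * d ^ 3) ≤ 4 * K * (1 * d ^ 3) := by gcongr
          _ = 4 * d * K * d ^ 2 := by ring
          _ ≤ 4 * r 0 * K * d ^ 2 := by gcongr; linarith
          _ = _ := by ring
      have h3 : 0 ≤ 4 / (1 - α) * (2 * Hg + 4 / c * Mg * d ^ (-α)) * t ^ (α - 1) := by positivity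
      linarith
    · push Not at hfar
      obtain ⟨k, hk⟩ := hfar
      have h1 := (hu.norm_deriv_le_of_lev_le h hc hc1 hn hα₀ hα hg (mem_domain_iff.1 hx k) hk.le).1
      have h2 : lev z r k x ^ (α - 1) ≤ t ^ (α - 1) :=
        Real.rpow_le_rpow_of_nonpos ht (hxt k) (by linarith)
      refine h1.trans ?_
      rw [add_comm]
      gcongr
      norm_num
  · exact ((hu.norm_deriv_le_of_le_lev (by positivity) hxd).1).trans_eq (by rw [← hK]; field_simp)

/-- The same division into near and far points, one derivative higher. The sup bound at distance d/4
is now the interior estimate for f'. -/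
lemma IsNeumannSolution.derivBound_deriv_cgrad (h : Admissible c d z r) (hc : 0 < c)
    (hc1 : c ≤ 1) (hn : 1 ≤ n) (hu : IsNeumannSolution z r g u) {α Mg Hg Mg' Hg' : ℝ}
    (hα₀ : 0 < α) (hα : α < 1) (hg : DataBound z r g α Mg Hg Mg' Hg') :
    DerivBound z r d α (128 * r 0 * l2norm (domain z r) (cgrad u) / (c ^ 3 * d ^ 4))
      (4 / (1 - α) * (2 * Hg' + 2 * Hg / (c * d) + 8 / c * (Mg' + Mg / (c * d)) * d ^ (-α)))
      (64 * l2norm (domain z r) (cgrad u) / d ^ 2) (deriv (cgrad u)) := by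
  have hd := h.d_pos
  have hr0 := h.radius_zero_ge hc hn
  have hMg := hg.sup_nonneg
  have hHg := hg.holder_nonneg
  have hMg' := hg.deriv_sup_nonneg
  have hHg' := hg.deriv_holder_nonneg
  have hα' : 0 < 1 - α := by linarith
  set K := l2norm (domain z r) (cgrad u) with hK
  have hK0 : 0 ≤ K := Real.sqrt_nonneg _
  have hr0' : 0 < r 0 := by linarith
  refine ⟨by positivity, by positivity, fun x hx =>
    ((differentiableOn_cgrad hu.harmonic).deriv isOpen_domain).differentiableAt
      (isOpen_domain.mem_nhds hx), fun x hx t ht hxt => ?_, fun x hx hxd => ?_⟩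
  · by_cases hfar : ∀ k, d / 2 ≤ lev z r k x
    · have h1 := (hu.norm_deriv_le_of_le_lev (half_pos hd) hfar).2.2
      have h2 : 32 * K / (d / 2) ^ 3 ≤ 128 * r 0 * K / (c ^ 3 * d ^ 4) := by
        rw [div_le_div_iff₀ (by positivity) (by positivity)]
        have hc2 : c ^ 3 ≤ 1 := pow_le_one₀ hc.le hc1
        calc 32 * K * (c ^ 3 * d ^ 4) ≤ 32 * K * (1 * d ^ 4) := by gcongr
          _ = 16 * (2 * d) * K * d ^ 3 := by ring
          _ ≤ 16 * r 0 * K * d ^ 3 := by gcongr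
          _ = _ := by ring
      have h3 : 0 ≤ 4 / (1 - α) * (2 * Hg' + 2 * Hg / (c * d) +
        8 / c * (Mg' + Mg / (c * d)) * d ^ (-α)) * t ^ (α - 1) := by positivity
      linarith
    · push Not at hfar
      obtain ⟨k, hk⟩ := hfar
      have h1 := (hu.norm_deriv_le_of_lev_le h hc hc1 hn hα₀ hα hg (mem_domain_iff.1 hx k) hk.le).2
      have h2 : lev z r k x ^ (α - 1) ≤ t ^ (α - 1) :=
        Real.rpow_le_rpow_of_nonpos ht (hxt k) (by linarith)
      refine h1.trans ?_
      rw [add_comm]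
      gcongr
      norm_num
  · exact ((hu.norm_deriv_le_of_le_lev (by positivity) hxd).2.1).trans_eq (by rw [← hK]; field_simp; ring)

end DerivBounds

/-! ### Pointwise control of the flux near a circle. -/

section BoundaryValue

variable {σ r d : ℝ} {p : ℂ} {f : ℂ → ℂ} {γ : ℝ → ℝ}

lemma exists_circleMap_eq (p x : ℂ) : ∃ θ ∈ Ioc 0 (2 * Real.pi), circleMap p ‖x - p‖ θ = x := by
  have h : x ∈ circleMap p ‖x - p‖ '' Ioc 0 (2 * Real.pi) := by
    rw [image_circleMap_Ioc, mem_sphere, dist_eq_norm, abs_norm]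
  exact h

lemma norm_circleMap_sub_circleMap_radius (p : ℂ) (a b θ : ℝ) :
    ‖circleMap p a θ - circleMap p b θ‖ = |a - b| := by
  have : circleMap p a θ - circleMap p b θ = ((a - b : ℝ) : ℂ) * cexp (θ * I) := by
    simp [circleMap]; ring
  rw [this, norm_mul, norm_exp_ofReal_mul_I, mul_one, norm_real, Real.norm_eq_abs]

/-- The flux density is bounded near the circle, up to a small error, by the bound for the
boundary flux. -/
lemma HasBoundaryFlux.abs_re_le (h : HasBoundaryFlux σ p r d f γ) (hσ : σ = 1 ∨ σ = -1)
    (hr : 0 < r) (hdr : σ = 1 → 2 * d ≤ r) {Mg M H α : ℝ} (hα : 0 ≤ α)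
    (hγM : ∀ θ, |γ θ| ≤ Mg) (hfc : ContinuousOn f {x | 0 < level σ p r x ∧ level σ p r x < 2 * d})
    (hH₀ : 0 ≤ H)
    (hM : ∀ x, 0 < level σ p r x → level σ p r x < 2 * d → ‖f x‖ ≤ M)
    (hH : ∀ x y, 0 < level σ p r x → level σ p r x < 2 * d → 0 < level σ p r y →
      level σ p r y < 2 * d → ‖f x - f y‖ ≤ H * dist x y ^ α)
    {x : ℂ} (hx₀ : 0 < level σ p r x) (hxd : level σ p r x < d) :
    |((x - p) * f x).re| ≤ r * Mg +
      (2 * level σ p r x * M + (r + d) * (H * (2 * level σ p r x) ^ α)) := by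
  set t := level σ p r x with ht
  have hd : 0 < d := hx₀.trans hxd
  have hσσ : |σ| = 1 := by rcases hσ with rfl | rfl <;> simp
  have hrad : ∀ s, 0 ≤ s → s < 2 * d → 0 < r - σ * s := fun s hs hs' => by
    rcases hσ with h0 | h0
    · have := hdr h0; rw [h0]; linarith
    · rw [h0]; linarith
  have hxp : ‖x - p‖ = r - σ * t := norm_sub_eq_of_level hσ p x
  obtain ⟨θ₀, hθ₀, hθx⟩ := exists_circleMap_eq p x
  rw [hxp] at hθx
  set b := circleMap p r θ₀ with hb
  have hbx : dist b x = t := by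
    rw [← hθx, dist_eq_norm, hb, norm_circleMap_sub_circleMap_radius,
      show r - (r - σ * t) = σ * t by ring, abs_mul, hσσ, one_mul, abs_of_pos hx₀]
  have hb0 : level σ p r b = 0 := by
    have := level_circleMap hσ p (t := 0) (r := r) (by linarith) θ₀
    simpa using this
  -- The weak condition is localised by a bump about the boundary point b nearest to x, with radius
  -- equal to the distance t of x from the circle.
  let φ : ContDiffBump b := ⟨t / 2, t, by linarith, by linarith⟩
  have hφ : ContDiff ℝ ∞ φ := φ.contDiff
  have hφd : ∀ y, d ≤ level σ p r y → φ y = 0 := fun y hy => by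
    refine φ.zero_of_le_dist ?_
    have h1 := abs_level_sub_le (r := r) hσ p y b
    rw [hb0, sub_zero] at h1
    exact (hxd.le.trans hy).trans ((le_abs_self _).trans h1)
  set err := 2 * t * M + (r + d) * (H * (2 * t) ^ α) with he₀
  set X := ((x - p) * f x).re with hX
  have hlim := h φ hφ hφd
  have hφc : Continuous φ := hφ.continuous
  have hcirc : Continuous fun q : ℝ × ℝ => φ (circleMap p (r - σ * q.1) q.2) := by
    simp only [circleMap]; fun_prop
  have hlim2 : Tendsto (fun s => ∫ θ in (0 : ℝ)..2 * Real.pi, φ (circleMap p (r - σ * s) θ))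
      (𝓝[>] 0) (𝓝 (∫ θ in (0 : ℝ)..2 * Real.pi, φ (circleMap p r θ))) := by
    have h1 := (intervalIntegral.continuous_parametric_intervalIntegral_of_continuous'
      (f := fun s θ => φ (circleMap p (r - σ * s) θ)) (μ := volume) hcirc 0
      (2 * Real.pi)).tendsto 0
    simp only [mul_zero, sub_zero] at h1
    exact h1.mono_left nhdsWithin_le_nhds
  set J := ∫ θ in (0 : ℝ)..2 * Real.pi, φ (circleMap p r θ) with hJ
  have hpi : (0 : ℝ) ≤ 2 * Real.pi := by positivity
  have hJpos : 0 < J := by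
    refine intervalIntegral.integral_pos (by positivity)
      (Continuous.continuousOn (hφc.comp (continuous_circleMap _ _))) (fun _ _ => φ.nonneg)
      ⟨θ₀, Ioc_subset_Icc_self hθ₀, φ.pos_of_mem_ball ?_⟩
    rw [← hb]; exact mem_ball_self hx₀
  have hlimle : |σ * r * ∫ θ in (0 : ℝ)..2 * Real.pi, γ θ * φ (circleMap p r θ)| ≤
      r * (Mg * J) := by
    rw [abs_mul, abs_mul, hσσ, one_mul, abs_of_pos hr]
    gcongr
    rw [hJ, ← intervalIntegral.integral_const_mul, ← Real.norm_eq_abs]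
    refine intervalIntegral.norm_integral_le_of_norm_le hpi (ae_of_all _ fun θ _ => ?_)
      (Continuous.intervalIntegrable (by fun_prop) _ _)
    rw [norm_mul, Real.norm_eq_abs, Real.norm_of_nonneg φ.nonneg]
    exact mul_le_mul_of_nonneg_right (hγM θ) φ.nonneg
  -- The flux density at x is compared with its average against the bump. On the support of the bump
  -- |x − w| ≤ 2t, so the Hölder continuity of f makes the difference at most err; as s → 0 the
  -- average is governed by γ.
  have key : ∀ᶠ s in 𝓝[>] (0 : ℝ), |X| * ∫ θ in (0 : ℝ)..2 * Real.pi, φ (circleMap p (r - σ * s) θ) ≤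
      |∫ θ in (0 : ℝ)..2 * Real.pi, ((circleMap p (r - σ * s) θ - p) *
        f (circleMap p (r - σ * s) θ)).re * φ (circleMap p (r - σ * s) θ)| +
      err * ∫ θ in (0 : ℝ)..2 * Real.pi, φ (circleMap p (r - σ * s) θ) := by
    filter_upwards [Ioo_mem_nhdsGT hx₀] with s hs
    have hs0 := (hrad s hs.1.le (by linarith [hs.2])).le
    have hlevw : ∀ θ, level σ p r (circleMap p (r - σ * s) θ) = s := level_circleMap hσ p hs0
    have hfs : Continuous fun θ => f (circleMap p (r - σ * s) θ) :=
      hfc.comp_continuous (continuous_circleMap _ _) fun θ => by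
        simp only [mem_ofPred_eq, hlevw]; exact ⟨hs.1, by linarith [hs.2]⟩
    have hcs : Continuous fun θ => φ (circleMap p (r - σ * s) θ) :=
      hφc.comp (continuous_circleMap _ _)
    have hFs : Continuous fun θ => ((circleMap p (r - σ * s) θ - p) *
        f (circleMap p (r - σ * s) θ)).re * φ (circleMap p (r - σ * s) θ) := by
      refine Continuous.mul (continuous_re.comp (Continuous.mul (by fun_prop) hfs)) hcs
    have hpt : ∀ θ, ‖X * φ (circleMap p (r - σ * s) θ) - ((circleMap p (r - σ * s) θ - p) *
        f (circleMap p (r - σ * s) θ)).re * φ (circleMap p (r - σ * s) θ)‖ ≤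
        err * φ (circleMap p (r - σ * s) θ) := fun θ => by
      set w := circleMap p (r - σ * s) θ with hw
      rw [← sub_mul, norm_mul, Real.norm_of_nonneg φ.nonneg]
      by_cases hwt : t ≤ dist w b
      · rw [φ.zero_of_le_dist hwt]; simp
      · push Not at hwt
        gcongr
        · exact φ.nonneg
        have hdw : dist x w ≤ 2 * t := by
          have := dist_triangle x b w
          rw [dist_comm x b, hbx, dist_comm b w] at this
          linarith
        have e1 : (x - p) * f x - (w - p) * f w = (x - w) * f w + (x - p) * (f x - f w) := by ring
        rw [hX, ← sub_re, e1, Real.norm_eq_abs]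
        refine (abs_re_le_norm _).trans ((norm_add_le _ _).trans ?_)
        rw [norm_mul, norm_mul, ← dist_eq_norm x w, he₀]
        have hls := hlevw θ
        have hxr : ‖x - p‖ ≤ r + d := by
          rw [hxp]
          rcases hσ with h0 | h0 <;> rw [h0] <;> linarith
        gcongr
        · exact hM w (by rw [hls]; exact hs.1) (by rw [hls]; linarith [hs.2])
        · refine (hH x w hx₀ (by linarith) (by rw [hls]; exact hs.1)
            (by rw [hls]; linarith [hs.2])).trans ?_
          gcongr
    have h2 := intervalIntegral.norm_integral_le_of_norm_le (μ := volume) hpi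
      (ae_of_all _ fun θ _ => hpt θ) ((hcs.const_mul err).intervalIntegrable 0 (2 * Real.pi))
    rw [intervalIntegral.integral_sub ((hcs.const_mul X).intervalIntegrable _ _)
      (hFs.intervalIntegrable _ _), intervalIntegral.integral_const_mul,
      intervalIntegral.integral_const_mul] at h2
    have h3 : 0 ≤ ∫ θ in (0 : ℝ)..2 * Real.pi, φ (circleMap p (r - σ * s) θ) :=
      intervalIntegral.integral_nonneg hpi fun _ _ => φ.nonneg
    have h4 := norm_sub_norm_le (X * ∫ θ in (0 : ℝ)..2 * Real.pi, φ (circleMap p (r - σ * s) θ))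
      (∫ θ in (0 : ℝ)..2 * Real.pi, ((circleMap p (r - σ * s) θ - p) *
        f (circleMap p (r - σ * s) θ)).re * φ (circleMap p (r - σ * s) θ))
    rw [norm_mul, Real.norm_of_nonneg h3, Real.norm_eq_abs, Real.norm_eq_abs] at h4
    linarith
  have hfin := le_of_tendsto_of_tendsto (hlim2.const_mul |X|)
    (hlim.abs.add (hlim2.const_mul err)) key
  have h5 : |X| * J ≤ (r * Mg + err) * J := by linarith
  exact le_of_mul_le_mul_right h5 hJpos

end BoundaryValue

/-! ### A trace inequality on circles parallel to the boundary. -/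

section Trace

variable {σ r d : ℝ} {p : ℂ} {u : ℂ → ℝ}

/-- Polar coordinates in terms of the signed distance to a circle. -/
lemma setIntegral_level (hσ : σ = 1 ∨ σ = -1) {a b : ℝ} (ha : 0 < r - σ * a) (hb : 0 < r - σ * b)
    (hab : a ≤ b) {F : ℂ → ℝ} (hF : ContinuousOn F {x | a ≤ level σ p r x ∧ level σ p r x ≤ b}) :
    ∫ x in {x | a < level σ p r x ∧ level σ p r x < b}, F x =
      ∫ t in a..b, ∫ θ in (0 : ℝ)..2 * Real.pi, (r - σ * t) * F (circleMap p (r - σ * t) θ) := by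
  rcases hσ with rfl | rfl
  · simp only [one_mul] at *
    have hset : {x | a < level 1 p r x ∧ level 1 p r x < b} = openAnnulus p (r - b) (r - a) := by
      ext x; simp only [openAnnulus, level, mem_ofPred_eq]
      constructor <;> rintro ⟨h1, h2⟩ <;> constructor <;> linarith
    rw [hset, setIntegral_annulus hb (by linarith) (hF.mono fun x hx => by
      have h1 := hx.1
      have h2 := hx.2
      simp only [level, mem_ofPred_eq]
      constructor <;> linarith),
      ← intervalIntegral.integral_comp_sub_left
        (fun ρ => ∫ θ in (0 : ℝ)..2 * Real.pi, ρ • F (circleMap p ρ θ))]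
    simp only [smul_eq_mul]
  · have e : ∀ s : ℝ, r - -1 * s = r + s := fun s => by ring
    simp only [e] at *
    have hset : {x | a < level (-1) p r x ∧ level (-1) p r x < b} =
        openAnnulus p (r + a) (r + b) := by
      ext x; simp only [openAnnulus, level, mem_ofPred_eq]
      constructor <;> rintro ⟨h1, h2⟩ <;> constructor <;> linarith
    rw [hset, setIntegral_annulus ha (by linarith) (hF.mono fun x hx => by
      have h1 := hx.1
      have h2 := hx.2
      simp only [level, mem_ofPred_eq]
      constructor <;> linarith),
      ← intervalIntegral.integral_comp_add_left
        (fun ρ => ∫ θ in (0 : ℝ)..2 * Real.pi, ρ • F (circleMap p ρ θ))]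
    simp only [smul_eq_mul]

/-- The fundamental theorem of calculus gives |v(a)| ≤ |v(t)| + ∫|v'|, which is then averaged over
t. -/
lemma sub_mul_abs_le {v v' : ℝ → ℝ} {a b : ℝ} (hab : a ≤ b)
    (hv : ∀ t ∈ Icc a b, HasDerivAt v (v' t) t) (hv' : ContinuousOn v' (Icc a b)) :
    (b - a) * |v a| ≤ (∫ t in a..b, |v t|) + (b - a) * ∫ t in a..b, |v' t| := by
  have hvc : ContinuousOn v (Icc a b) := fun t ht => (hv t ht).continuousAt.continuousWithinAt
  have h1 : ∀ t ∈ Icc a b, |v a| - (∫ t in a..b, |v' t|) ≤ |v t| := fun t ht => by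
    have hsub : uIcc a t ⊆ Icc a b := by
      rw [uIcc_of_le ht.1]; exact Icc_subset_Icc_right ht.2
    have h2 : ∫ τ in a..t, v' τ = v t - v a :=
      intervalIntegral.integral_eq_sub_of_hasDerivAt (fun τ hτ => hv τ (hsub hτ))
        (hv'.mono hsub).intervalIntegrable
    have h3 := intervalIntegral.norm_integral_le_integral_norm (μ := volume) (f := v') ht.1
    have h4 : ∫ τ in a..t, |v' τ| ≤ ∫ τ in a..b, |v' τ| :=
      intervalIntegral.integral_mono_interval le_rfl ht.1 ht.2 (ae_of_all _ fun _ => abs_nonneg _)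
        (hv'.abs.intervalIntegrable_of_Icc hab)
    rw [h2, Real.norm_eq_abs] at h3
    simp only [Real.norm_eq_abs] at h3
    have h5 := abs_sub_abs_le_abs_sub (v a) (v t)
    rw [abs_sub_comm] at h5
    linarith
  have h6 := intervalIntegral.integral_mono_on hab (intervalIntegrable_const (μ := volume))
    (hvc.abs.intervalIntegrable_of_Icc hab) h1
  rw [intervalIntegral.integral_const, smul_eq_mul] at h6
  linarith

lemma mul_abs_circleMap_le (hσ : σ = 1 ∨ σ = -1) {s s' : ℝ} (hss' : s ≤ s') {U : Set ℂ}
    (hU : IsOpen U) {θ : ℝ} (hmem : ∀ t ∈ Icc s s', circleMap p (r - σ * t) θ ∈ U)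
    (hu : ContDiffOn ℝ 1 u U) :
    (s' - s) * |u (circleMap p (r - σ * s) θ)| ≤
      ∫ t in s..s', (|u (circleMap p (r - σ * t) θ)| +
        (s' - s) * ‖fderiv ℝ u (circleMap p (r - σ * t) θ)‖) := by
  have hu' : ContinuousOn (fderiv ℝ u) U := hu.continuousOn_fderiv_of_isOpen hU le_rfl
  have hcd : ∀ t : ℝ, HasDerivAt (fun t : ℝ => circleMap p (r - σ * t) θ)
      (-(σ : ℂ) * cexp (θ * I)) t := fun t => by
    have h2 : HasDerivAt (fun t : ℝ => r - σ * t) (-(σ * 1)) t :=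
      ((hasDerivAt_id t).const_mul σ).const_sub r
    have h1 : HasDerivAt (fun t : ℝ => ((r - σ * t : ℝ) : ℂ)) (-(σ : ℂ)) t :=
      h2.ofReal_comp.congr_deriv (by push_cast; ring)
    exact (h1.mul_const (cexp (θ * I))).const_add p
  have hcc : Continuous fun t : ℝ => circleMap p (r - σ * t) θ := by
    simp only [circleMap]; fun_prop
  have hu1 : ContinuousOn (fun t => u (circleMap p (r - σ * t) θ)) (Icc s s') :=
    hu.continuousOn.comp hcc.continuousOn hmem
  have hu2 : ContinuousOn (fun t => fderiv ℝ u (circleMap p (r - σ * t) θ)) (Icc s s') :=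
    hu'.comp hcc.continuousOn hmem
  have hu3 : ContinuousOn (fun t => fderiv ℝ u (circleMap p (r - σ * t) θ)
      (-(σ : ℂ) * cexp (θ * I))) (Icc s s') := hu2.clm_apply continuousOn_const
  have h1 := sub_mul_abs_le (v := fun t => u (circleMap p (r - σ * t) θ)) hss'
    (fun t ht => ((hu.contDiffAt (hU.mem_nhds (hmem t ht))).differentiableAt
      (by simp)).hasFDerivAt.comp_hasDerivAt t (hcd t)) hu3
  rw [← intervalIntegral.integral_const_mul, ← intervalIntegral.integral_add
    (hu1.abs.intervalIntegrable_of_Icc hss')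
    ((hu3.abs.const_mul _).intervalIntegrable_of_Icc hss')] at h1
  refine h1.trans (intervalIntegral.integral_mono_on hss'
    ((hu1.abs.add (hu3.abs.const_mul _)).intervalIntegrable_of_Icc hss')
    ((hu1.abs.add (hu2.norm.const_mul _)).intervalIntegrable_of_Icc hss') fun t _ => ?_)
  have hs0 : 0 ≤ s' - s := sub_nonneg.2 hss'
  gcongr
  rw [← Real.norm_eq_abs]
  refine (ContinuousLinearMap.le_opNorm _ _).trans_eq ?_
  have : |σ| = 1 := by rcases hσ with h0 | h0 <;> simp [h0]
  rw [norm_mul, norm_exp_ofReal_mul_I, norm_neg, norm_real, Real.norm_eq_abs, this]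
  simp

lemma continuousOn_swap {X Y Z : Type*} [TopologicalSpace X] [TopologicalSpace Y]
    [TopologicalSpace Z] {f : X × Y → Z} {S : Set X} {T : Set Y} (hf : ContinuousOn f (S ×ˢ T)) :
    ContinuousOn (fun q : Y × X => f (q.2, q.1)) (T ×ˢ S) :=
  hf.comp (t := S ×ˢ T) continuous_swap.continuousOn fun _ hq => ⟨hq.2, hq.1⟩

/-- Fubini, and the comparison r ≤ 2 (r − σt), which replaces the constant radius by the weight of
the area element. -/
lemma integral_circleMap_swap_le {F : ℂ → ℝ} {a b s s' : ℝ} (hab : a ≤ b) (hss' : s ≤ s')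
    (hF₀ : ∀ x, 0 ≤ F x)
    (hF : ContinuousOn (fun q : ℝ × ℝ => F (circleMap p (r - σ * q.1) q.2)) (Icc s s' ×ˢ Icc a b))
    (hrad : ∀ t ∈ Icc s s', r ≤ 2 * (r - σ * t)) :
    r * ∫ θ in a..b, ∫ t in s..s', F (circleMap p (r - σ * t) θ) ≤
      2 * ∫ t in s..s', ∫ θ in a..b, (r - σ * t) * F (circleMap p (r - σ * t) θ) := by
  have hFs : ContinuousOn (fun q : ℝ × ℝ => F (circleMap p (r - σ * q.2) q.1))
      (Icc a b ×ˢ Icc s s') :=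
    continuousOn_swap (f := fun q => F (circleMap p (r - σ * q.1) q.2)) hF
  have hi1 : IntervalIntegrable (fun t => ∫ θ in a..b, F (circleMap p (r - σ * t) θ)) volume s s' :=
    intervalIntegrable_integral (f := fun q => F (circleMap p (r - σ * q.1) q.2)) hss' hab hF
  have hF' : ContinuousOn (fun q : ℝ × ℝ => (r - σ * q.1) * F (circleMap p (r - σ * q.1) q.2))
      (Icc s s' ×ˢ Icc a b) :=
    (by fun_prop : Continuous fun q : ℝ × ℝ => r - σ * q.1).continuousOn.mul hF
  have hi2 : IntervalIntegrable (fun t => ∫ θ in a..b,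
      (r - σ * t) * F (circleMap p (r - σ * t) θ)) volume s s' :=
    intervalIntegrable_integral
      (f := fun q => (r - σ * q.1) * F (circleMap p (r - σ * q.1) q.2)) hss' hab hF'
  have hsw : ∫ θ in a..b, ∫ t in s..s', F (circleMap p (r - σ * t) θ) =
      ∫ t in s..s', ∫ θ in a..b, F (circleMap p (r - σ * t) θ) := by
    refine intervalIntegral_intervalIntegral_swap
      (F := fun θ t => F (circleMap p (r - σ * t) θ)) ?_
    rw [uIoc_of_le hab, uIoc_of_le hss']
    exact (hFs.integrableOn_compact (isCompact_Icc.prod isCompact_Icc)).mono_set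
      (prod_mono Ioc_subset_Icc_self Ioc_subset_Icc_self)
  rw [hsw, ← intervalIntegral.integral_const_mul, ← intervalIntegral.integral_const_mul]
  have hpt : ∀ t ∈ Icc s s', r * ∫ θ in a..b, F (circleMap p (r - σ * t) θ) ≤
      2 * ∫ θ in a..b, (r - σ * t) * F (circleMap p (r - σ * t) θ) := fun t ht => by
    rw [intervalIntegral.integral_const_mul, ← mul_assoc]
    exact mul_le_mul_of_nonneg_right (hrad t ht)
      (intervalIntegral.integral_nonneg hab fun _ _ => hF₀ _)
  exact intervalIntegral.integral_mono_on hss' (hi1.const_mul r) (hi2.const_mul 2) hpt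

/-- The integral of `|u|` over a circle close to the boundary is bounded by integrals of `|u|` and
its gradient over a strip. -/
lemma integral_abs_circleMap_le (hσ : σ = 1 ∨ σ = -1) (hr : 0 < r) (hdr : σ = 1 → 2 * d ≤ r)
    {U : Set ℂ} (hU : IsOpen U) (hUs : ∀ x, 0 < level σ p r x → level σ p r x < 2 * d → x ∈ U)
    (hu : ContDiffOn ℝ 1 u U)
    (hi : IntegrableOn (fun x => |u x| + d * ‖fderiv ℝ u x‖)
      {x | 0 < level σ p r x ∧ level σ p r x < d}) {s : ℝ} (hs : 0 < s) (hsd : s < d / 2) :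
    r * ∫ θ in (0 : ℝ)..2 * Real.pi, |u (circleMap p (r - σ * s) θ)| ≤
      4 / d * ∫ x in {x | 0 < level σ p r x ∧ level σ p r x < d},
        (|u x| + d * ‖fderiv ℝ u x‖) := by
  have hd : 0 < d := by linarith
  have hpi : (0 : ℝ) ≤ 2 * Real.pi := by positivity
  -- The radial segments have length d/2, so they stay at distance less than d from the circle; on
  -- the inner side 2d ≤ r keeps the radius at least r/2.
  set s' := s + d / 2 with hs'
  have hss' : s ≤ s' := by linarith
  have hss : s' - s = d / 2 := by rw [hs']; ring
  have hrad : ∀ t ∈ Icc s s', r ≤ 2 * (r - σ * t) := fun t ht => by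
    have h1 := ht.1
    have h2 := ht.2
    rcases hσ with h0 | h0
    · have := hdr h0; rw [h0]; linarith
    · rw [h0]; linarith
  have hrad0 : ∀ t ∈ Icc s s', 0 < r - σ * t := fun t ht => by linarith [hrad t ht]
  have hlev : ∀ t ∈ Icc s s', ∀ θ, level σ p r (circleMap p (r - σ * t) θ) = t := fun t ht θ =>
    level_circleMap hσ p (hrad0 t ht).le θ
  have hmem : ∀ t ∈ Icc s s', ∀ θ, circleMap p (r - σ * t) θ ∈ U := fun t ht θ =>
    hUs _ (by rw [hlev t ht]; linarith [ht.1]) (by rw [hlev t ht]; linarith [ht.2])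
  have hu' : ContinuousOn (fderiv ℝ u) U := hu.continuousOn_fderiv_of_isOpen hU le_rfl
  obtain ⟨F, hF⟩ : ∃ F : ℂ → ℝ, F = fun x => |u x| + d / 2 * ‖fderiv ℝ u x‖ := ⟨_, rfl⟩
  have hF₀ : ∀ x, 0 ≤ F x := fun x => by rw [hF]; positivity
  have hFc : ContinuousOn F U := by
    rw [hF]; exact hu.continuousOn.abs.add (hu'.norm.const_mul _)
  have hcm : Continuous fun q : ℝ × ℝ => circleMap p (r - σ * q.1) q.2 := by
    simp only [circleMap]; fun_prop
  have hF2 : ContinuousOn (fun q : ℝ × ℝ => F (circleMap p (r - σ * q.1) q.2))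
      (Icc s s' ×ˢ Icc 0 (2 * Real.pi)) :=
    hFc.comp hcm.continuousOn fun q hq => hmem q.1 hq.1 q.2
  have hθ : d / 2 * ∫ θ in (0 : ℝ)..2 * Real.pi, |u (circleMap p (r - σ * s) θ)| ≤
      ∫ θ in (0 : ℝ)..2 * Real.pi, ∫ t in s..s', F (circleMap p (r - σ * t) θ) := by
    rw [← intervalIntegral.integral_const_mul]
    refine intervalIntegral.integral_mono_on hpi ?_ (intervalIntegrable_integral hpi hss'
      (f := fun q => F (circleMap p (r - σ * q.2) q.1))
      (continuousOn_swap (f := fun q => F (circleMap p (r - σ * q.1) q.2)) hF2)) fun θ _ => ?_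
    · have : Continuous fun θ => u (circleMap p (r - σ * s) θ) :=
        hu.continuousOn.comp_continuous (continuous_circleMap _ _) (hmem s (left_mem_Icc.2 hss'))
      exact (this.abs.const_mul _).intervalIntegrable _ _
    · have h1 := mul_abs_circleMap_le hσ hss' hU (fun t ht => hmem t ht θ) hu
      rw [hss] at h1
      rw [hF]
      exact h1
  have hsw := integral_circleMap_swap_le (p := p) (r := r) (σ := σ) (F := F) hpi hss' hF₀ hF2 hrad
  have hpolar := setIntegral_level (p := p) (F := F) hσ (hrad0 s (left_mem_Icc.2 hss'))
    (hrad0 s' (right_mem_Icc.2 hss')) hss' (hFc.mono fun x hx =>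
      hUs x (hs.trans_le hx.1) (lt_of_le_of_lt hx.2 (by linarith)))
  have hmono : ∫ x in {x | s < level σ p r x ∧ level σ p r x < s'}, F x ≤
      ∫ x in {x | 0 < level σ p r x ∧ level σ p r x < d}, (|u x| + d * ‖fderiv ℝ u x‖) := by
    have hsub : {x | s < level σ p r x ∧ level σ p r x < s'} ⊆
        {x | 0 < level σ p r x ∧ level σ p r x < d} := fun x hx =>
      ⟨hs.trans hx.1, hx.2.trans_le (by linarith)⟩
    calc _ ≤ ∫ x in {x | s < level σ p r x ∧ level σ p r x < s'},
          (|u x| + d * ‖fderiv ℝ u x‖) := by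
          refine integral_mono_of_nonneg (ae_of_all _ hF₀)
            (hi.mono_set hsub) (ae_of_all _ fun x => ?_)
          simp only [hF]
          gcongr
          linarith
      _ ≤ _ := setIntegral_mono_set hi (ae_of_all _ fun x => by
            change 0 ≤ |u x| + d * ‖fderiv ℝ u x‖; positivity)
          (LE.le.eventuallyLE hsub)
  have h2 := mul_le_mul_of_nonneg_left hθ hr.le
  rw [← hpolar] at hsw
  rw [div_mul_eq_mul_div, le_div_iff₀ hd]
  linarith

end Trace

/-! ### The energy identity on slightly smaller domains. -/

section Energy

variable {c d : ℝ} {n : ℕ} {z : Fin (n + 1) → ℂ} {r : Fin (n + 1) → ℝ} {g u : ℂ → ℝ}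

/-- On a disk a harmonic function is the real part of a holomorphic one. -/
lemma contDiffAt_of_harmonic {E : Set ℂ} (hE : IsOpen E) (hu : HarmonicOnNhd u E) {x : ℂ}
    (hx : x ∈ E) : ContDiffAt ℝ ∞ u x := by
  obtain ⟨R, hR, hball⟩ := Metric.isOpen_iff.1 hE x hx
  obtain ⟨F, hF, hFu⟩ := HarmonicOnNhd.exists_analyticOnNhd_ball_re_eq
    (z := x) (R := R) (fun y hy => hu y (hball hy))
  have h1 : ContDiffAt ℝ ∞ F x := (hF x (mem_ball_self hR)).contDiffAt.restrict_scalars ℝ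
  have h2 : ContDiffAt ℝ ∞ (fun y => (F y).re) x := reCLM.contDiff.contDiffAt.comp x h1
  refine h2.congr_of_eventuallyEq ?_
  filter_upwards [ball_mem_nhds x hR] with y hy using (hFu hy).symm

/-- The part of the domain at distance more than `s` from the boundary circles. -/
def innerDomain (z : Fin (n + 1) → ℂ) (r : Fin (n + 1) → ℝ) (s : ℝ) : Set ℂ :=
  {x | ∀ k, s < lev z r k x}

lemma isOpen_innerDomain (s : ℝ) : IsOpen (innerDomain z r s) := by
  have : innerDomain z r s = ⋂ k, {x | s < lev z r k x} := by
    ext x; simp [innerDomain]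
  rw [this]
  exact isOpen_iInter_of_finite fun k => isOpen_lt continuous_const (continuous_lev k)

lemma innerDomain_subset {s : ℝ} (hs : 0 ≤ s) : innerDomain z r s ⊆ domain z r :=
  fun _ hx => mem_domain_iff.2 fun k => hs.trans_lt (hx k)

lemma integrableOn_innerDomain {s : ℝ} (hs : 0 < s) {F : ℂ → ℝ}
    (hF : ContinuousOn F (domain z r)) : IntegrableOn F (innerDomain z r s) := by
  set S : Set ℂ := ⋂ k, {x | s ≤ lev z r k x} with hS
  have hcl : IsClosed S :=
    isClosed_iInter fun k => isClosed_le continuous_const (continuous_lev k)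
  have hsub : S ⊆ domain z r := fun x hx => mem_domain_iff.2 fun k =>
    hs.trans_le (mem_iInter.1 hx k)
  have hcomp : IsCompact S :=
    Metric.isCompact_of_isClosed_isBounded hcl ((isBounded_domain z r).subset hsub)
  exact ((hF.mono hsub).integrableOn_compact hcomp).mono_set fun x hx =>
    mem_iInter.2 fun k => (hx k).le

lemma sq_norm_cgrad (u : ℂ → ℝ) (x : ℂ) :
    ‖cgrad u x‖ ^ 2 = (cgrad u x * (fderiv ℝ u x 1 + I * fderiv ℝ u x I)).re := by
  rw [re_cgrad_mul, ← normSq_eq_norm_sq, normSq_apply, cgrad, toComplex]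
  simp

/-- The energy in the part of the domain at distance more than `s` from the boundary. -/
lemma IsNeumannSolution.setIntegral_innerDomain (h : Admissible c d z r) (hc : 0 < c)
    (hn : 1 ≤ n) (hu : IsNeumannSolution z r g u) {s : ℝ} (hs : 0 < s) (hsd : s < d / 4) :
    ∫ x in innerDomain z r s, ‖cgrad u x‖ ^ 2 =
      ∑ k, side k * ∫ θ in (0 : ℝ)..2 * Real.pi,
        ((circleMap (z k) (r k - side k * s) θ - z k) *
          cgrad u (circleMap (z k) (r k - side k * s) θ)).re *
            u (circleMap (z k) (r k - side k * s) θ) := by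
  have hd := h.d_pos
  have hr := h.radius_pos hc hn
  have hopen := isOpen_domain (z := z) (r := r)
  have huE : ∀ x ∈ domain z r, ContDiffAt ℝ ∞ u x := fun x hx =>
    contDiffAt_of_harmonic hopen hu.harmonic hx
  have hfE := differentiableOn_cgrad hu.harmonic
  have hcut : ∀ k, ∃ χ : ℂ → ℝ, ContDiff ℝ ∞ χ ∧ (∀ x, lev z r k x ≤ d / 4 → χ x = 1) ∧
      (∀ x, d / 2 ≤ lev z r k x → χ x = 0) := fun k =>
    exists_cutoff (side_eq k) (z k) (hr k) (by linarith) (by linarith) fun h1 => by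
      linarith [h.two_mul_le_radius_of_side hc hn k h1]
  choose χ hχ hχ1 hχ0 using hcut
  -- The function u need not be smooth up to the boundary and cannot be a test function itself. It
  -- is split into φ, which vanishes near all circles, and the pieces χ k * u, each supported near
  -- one circle.
  obtain ⟨φ, hφ⟩ : ∃ φ : ℂ → ℝ, φ = fun x => (1 - ∑ k, χ k x) * u x := ⟨_, rfl⟩
  have hφ0 : ∀ k x, lev z r k x ≤ d / 4 → φ x = 0 := fun k x hx => by
    rw [hφ]
    simp only
    rw [Finset.sum_eq_single k, hχ1 k x hx, sub_self, zero_mul]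
    · intro j _ hj
      have := h.le_lev_add_lev hc hj x
      exact hχ0 j x (by linarith)
    · simp
  have hφ0' : ∀ k x, lev z r k x < d / 4 → φ =ᶠ[𝓝 x] fun _ => 0 := fun k x hx => by
    filter_upwards [(isOpen_lt (continuous_lev k) continuous_const).mem_nhds hx] with y hy
    exact hφ0 k y (le_of_lt hy)
  have hφs : ContDiff ℝ ∞ φ := contDiff_iff_contDiffAt.2 fun x => by
    by_cases hx : ∀ k, d / 8 < lev z r k x
    · have hxE : x ∈ domain z r := mem_domain_iff.2 fun k => by linarith [hx k]
      rw [hφ]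
      exact (contDiffAt_const.sub
        (ContDiff.sum fun k _ => hχ k).contDiffAt).mul (huE x hxE)
    · push Not at hx
      obtain ⟨k, hk⟩ := hx
      exact contDiffAt_const.congr_of_eventuallyEq (hφ0' k x (by linarith))
  have hχu : ∀ k, ContDiffOn ℝ 1 (fun x => χ k x * u x) (domain z r) := fun k x hx =>
    (((hχ k).contDiffAt.mul (huE x hx)).of_le (by simp)).contDiffWithinAt
  obtain ⟨P, hP⟩ : ∃ P : (ℂ → ℝ) → ℂ → ℝ, P = fun (φ : ℂ → ℝ) x =>
    (cgrad u x * (fderiv ℝ φ x 1 + I * fderiv ℝ φ x I)).re := ⟨_, rfl⟩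
  have hPc : ∀ φ : ℂ → ℝ, ContDiffOn ℝ 1 φ (domain z r) → ContinuousOn (P φ) (domain z r) :=
    fun φ hφ => by
      have h1 : ContinuousOn (fderiv ℝ φ) (domain z r) :=
        hφ.continuousOn_fderiv_of_isOpen hopen le_rfl
      have h2 := hfE.continuousOn
      rw [hP]
      refine continuous_re.comp_continuousOn (h2.mul ?_)
      fun_prop
  have hsplit : ∀ x ∈ innerDomain z r s, ‖cgrad u x‖ ^ 2 =
      P φ x + ∑ k, P (fun x => χ k x * u x) x := fun x hx => by
    have hxE := innerDomain_subset hs.le hx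
    have h1 : u = fun x => φ x + ∑ k, χ k x * u x := by
      ext y; rw [hφ]; simp only; rw [← Finset.sum_mul]; ring
    have hdk : ∀ k ∈ (Finset.univ : Finset (Fin (n + 1))),
        DifferentiableAt ℝ (fun x => χ k x * u x) x := fun k _ =>
      ((hχu k).contDiffAt (hopen.mem_nhds hxE)).differentiableAt (by simp)
    have h2 : fderiv ℝ u x = fderiv ℝ φ x + ∑ k, fderiv ℝ (fun x => χ k x * u x) x := by
      conv_lhs => rw [h1]
      rw [fderiv_fun_add (hφs.contDiffAt.differentiableAt (by simp))
        (DifferentiableAt.fun_sum hdk), fderiv_fun_sum hdk]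
    rw [sq_norm_cgrad, h2, hP]
    simp only [add_apply, sum_apply, ofReal_add, ofReal_sum]
    rw [← re_sum, ← add_re, ← Finset.mul_sum, Finset.sum_add_distrib, ← Finset.mul_sum]
    congr 1; ring
  -- The smooth piece vanishes on the boundary, so the weak formulation gives 0; it also vanishes on
  -- the part of the domain that was removed.
  have hzero : ∫ x in innerDomain z r s, P φ x = 0 := by
    have h1 : ∫ x in innerDomain z r s, P φ x = ∫ x in domain z r, P φ x := by
      refine (setIntegral_eq_of_subset_of_forall_sdiff_eq_zero hopen.measurableSet
        (innerDomain_subset hs.le) fun x hx => ?_).symm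
      have h2 := hx.2
      simp only [innerDomain, mem_ofPred_eq, not_forall, not_lt] at h2
      obtain ⟨k, hk⟩ := h2
      rw [hP]
      simp [(hφ0' k x (by linarith)).fderiv_eq]
    rw [h1, hP]
    simp only [re_cgrad_mul]
    rw [hu.neumann φ hφs]
    refine Finset.sum_eq_zero fun k _ => ?_
    have : ∀ θ, φ (circleMap (z k) (r k) θ) = 0 := fun θ => hφ0 k _ (by
      have := level_circleMap (side_eq k) (z k) (r := r k) (t := 0) (by simpa using (hr k).le) θ
      rw [mul_zero, sub_zero] at this
      rw [lev, this]; linarith)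
    simp [this]
  have hterm : ∀ k, ∫ x in innerDomain z r s, P (fun x => χ k x * u x) x =
      side k * ∫ θ in (0 : ℝ)..2 * Real.pi,
        ((circleMap (z k) (r k - side k * s) θ - z k) *
          cgrad u (circleMap (z k) (r k - side k * s) θ)).re *
            u (circleMap (z k) (r k - side k * s) θ) := fun k => by
    have hlev : Continuous (lev z r k) := continuous_lev k
    have hpos : ∀ t, 0 ≤ t → t < 2 * d → 0 < r k - side k * t := fun t ht ht' => by
      rcases side_eq k with h0 | h0
      · have := h.two_mul_le_radius_of_side hc hn k h0; rw [h0]; linarith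
      · rw [h0]; linarith [hr k]
    have hsub : {x | s < lev z r k x ∧ lev z r k x < d} ⊆ innerDomain z r s := fun x hx j => by
      by_cases hj : j = k
      · rw [hj]; exact hx.1
      · have h1 := h.le_lev_add_lev hc hj x
        linarith [hx.2]
    have h1 : ∫ x in innerDomain z r s, P (fun x => χ k x * u x) x =
        ∫ x in {x | s < lev z r k x ∧ lev z r k x < d}, P (fun x => χ k x * u x) x := by
      refine setIntegral_eq_of_subset_of_forall_sdiff_eq_zero
        (isOpen_innerDomain s).measurableSet hsub fun x hx => ?_
      have h2 : d / 2 < lev z r k x := by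
        by_contra hcon
        exact hx.2 ⟨hx.1 k, by linarith⟩
      have h3 : (fun x => χ k x * u x) =ᶠ[𝓝 x] fun _ => 0 := by
        filter_upwards [(isOpen_lt continuous_const hlev).mem_nhds h2] with y hy
        rw [hχ0 k y (le_of_lt hy), zero_mul]
      rw [hP]
      simp [h3.fderiv_eq]
    have h2 := green_level (p := z k) (f := cgrad u) (φ := fun x => χ k x * u x) (side_eq k)
      (hpos s hs.le (by linarith)) (hpos d hd.le (by linarith)) (by linarith) hopen
      (fun x hx hx' => h.strip_subset hc (k := k) (hs.trans_le hx)
        (lt_of_le_of_lt hx' (by linarith)))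
      hfE (hχu k) (fun x hx => by
        rw [hχ0 k x (by rw [lev, hx]; linarith), zero_mul])
    have h3 : ∀ θ, χ k (circleMap (z k) (r k - side k * s) θ) = 1 := fun θ => hχ1 k _ (by
      rw [lev, level_circleMap (side_eq k) (z k) (hpos s hs.le (by linarith)).le]; linarith)
    simp only [h3, one_mul] at h2
    rw [h1, hP]
    exact h2
  rw [setIntegral_congr_fun (isOpen_innerDomain s).measurableSet hsplit, integral_add
    (integrableOn_innerDomain hs (hPc φ (hφs.of_le (by simp)).contDiffOn))
    (integrable_finsetSum _ fun k _ => integrableOn_innerDomain hs (hPc _ (hχu k))), hzero, zero_add,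
    integral_finsetSum _ fun k _ => integrableOn_innerDomain hs (hPc _ (hχu k))]
  exact Finset.sum_congr rfl fun k _ => hterm k

end Energy

/-! ### The energy estimate. -/

section EnergyBound

variable {c d : ℝ} {n : ℕ} {z : Fin (n + 1) → ℂ} {r : Fin (n + 1) → ℝ} {g u : ℂ → ℝ}

/-- The part of the domain at distance less than `d` from the `k`-th circle. -/
def strip (z : Fin (n + 1) → ℂ) (r : Fin (n + 1) → ℝ) (d : ℝ) (k : Fin (n + 1)) : Set ℂ :=
  {x | 0 < lev z r k x ∧ lev z r k x < d}

lemma isOpen_strip (k : Fin (n + 1)) : IsOpen (strip z r d k) :=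
  (isOpen_lt continuous_const (continuous_lev k)).and (isOpen_lt (continuous_lev k) continuous_const)

lemma Admissible.strip_subset_domain (h : Admissible c d z r) (hc : 0 < c) (k : Fin (n + 1)) :
    strip z r d k ⊆ domain z r := fun _ hx =>
  h.strip_subset hc hx.1 (by linarith [hx.2, h.d_pos])

lemma IsNeumannSolution.integrable_trace (hu : IsNeumannSolution z r g u) :
    IntegrableOn (fun x => |u x| + d * ‖fderiv ℝ u x‖) (domain z r) :=
  (hu.memLp.integrable (by norm_num)).abs.add
    ((hu.memLp_deriv.integrable (by norm_num)).norm.const_mul d)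

/-- Let s → 0 in the energy identity: the flux on the circle at distance s is at most r k * Mg plus
an error, and the trace inequality bounds the integral of |u|. The Hölder regularity of f is used
only qualitatively: its constants M and H, which involve the energy, occur in the error and
disappear in the limit, so the argument is not circular. -/
lemma IsNeumannSolution.energy_le_sum (h : Admissible c d z r) (hc : 0 < c) (hc1 : c ≤ 1)
    (hn : 1 ≤ n) (hu : IsNeumannSolution z r g u) {α Mg Hg Mg' Hg' : ℝ} (hα₀ : 0 < α) (hα : α < 1)
    (hg : DataBound z r g α Mg Hg Mg' Hg') :
    ∫ x in domain z r, ‖cgrad u x‖ ^ 2 ≤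
      Mg * ∑ k, 4 / d * ∫ x in strip z r d k, (|u x| + d * ‖fderiv ℝ u x‖) := by
  have hd := h.d_pos
  have hr := h.radius_pos hc hn
  have hopen := isOpen_domain (z := z) (r := r)
  have hMg := hg.sup_nonneg
  have hDB := hu.derivBound_cgrad h hc hc1 hn hα₀ hα hg
  have hK : 0 ≤ 4 * l2norm (domain z r) (cgrad u) / d := by
    have : 0 ≤ l2norm (domain z r) (cgrad u) := Real.sqrt_nonneg _
    positivity
  obtain ⟨M, hM⟩ : ∃ M, ∀ x ∈ domain z r, ‖cgrad u x‖ ≤ M :=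
    ⟨_, fun x hx => hDB.sup_le h hc hc1 hn hα₀ hα hx⟩
  obtain ⟨H, hH₀, hH⟩ : ∃ H, 0 ≤ H ∧ ∀ x ∈ domain z r, ∀ y ∈ domain z r,
      ‖cgrad u x - cgrad u y‖ ≤ H * dist x y ^ α := by
    refine ⟨_, ?_, fun x hx y hy => hDB.holder_le h hc hc1 hn hα₀ hα hK hx hy⟩
    have := hDB.A_nonneg
    have := hDB.N_nonneg
    positivity
  obtain ⟨J, hJ⟩ : ∃ J : Fin (n + 1) → ℝ, J = fun k =>
    4 / d * ∫ x in strip z r d k, (|u x| + d * ‖fderiv ℝ u x‖) := ⟨_, rfl⟩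
  have hJ₀ : ∀ k, 0 ≤ J k := fun k => by
    rw [hJ]
    exact mul_nonneg (by positivity) (integral_nonneg fun x => by
      change 0 ≤ |u x| + d * ‖fderiv ℝ u x‖; positivity)
  obtain ⟨e, he⟩ : ∃ e : Fin (n + 1) → ℝ → ℝ, e = fun k s =>
    2 * s * M + (r k + d) * (H * (2 * s) ^ α) := ⟨_, rfl⟩
  have hstrip : ∀ k x, 0 < lev z r k x → lev z r k x < 2 * d → x ∈ domain z r := fun k x h1 h2 =>
    h.strip_subset hc h1 h2
  have hterm : ∀ s ∈ Ioo 0 (d / 4), ∀ k, side k * ∫ θ in (0 : ℝ)..2 * Real.pi,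
        ((circleMap (z k) (r k - side k * s) θ - z k) *
          cgrad u (circleMap (z k) (r k - side k * s) θ)).re *
            u (circleMap (z k) (r k - side k * s) θ) ≤ (Mg + e k s / r k) * J k := by
    intro s hs k
    have hpi : (0 : ℝ) ≤ 2 * Real.pi := by positivity
    have hrad : 0 < r k - side k * s := by
      rcases side_eq k with h0 | h0
      · have := h.two_mul_le_radius_of_side hc hn k h0; rw [h0]; linarith [hs.2]
      · rw [h0]; linarith [hr k, hs.1]
    have hlev : ∀ θ, level (side k) (z k) (r k) (circleMap (z k) (r k - side k * s) θ) = s :=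
      level_circleMap (side_eq k) (z k) hrad.le
    have hmem : ∀ θ, circleMap (z k) (r k - side k * s) θ ∈ domain z r := fun θ =>
      hstrip k _ (by rw [lev, hlev]; exact hs.1) (by rw [lev, hlev]; linarith [hs.2])
    have hb : ∀ θ, |((circleMap (z k) (r k - side k * s) θ - z k) *
          cgrad u (circleMap (z k) (r k - side k * s) θ)).re| ≤ r k * Mg + e k s := fun θ => by
      have h1 := (hu.hasBoundaryFlux h hc hn k).abs_re_le (side_eq k) (hr k)
        (h.two_mul_le_radius_of_side hc hn k) hα₀.le (hg.abs_le k)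
        ((differentiableOn_cgrad hu.harmonic).continuousOn.mono fun x hx => hstrip k x hx.1 hx.2)
        hH₀ (fun x h1 h2 => hM x (hstrip k x h1 h2))
        (fun x y h1 h2 h3 h4 => hH x (hstrip k x h1 h2) y (hstrip k y h3 h4))
        (x := circleMap (z k) (r k - side k * s) θ) (by rw [hlev]; exact hs.1)
        (by rw [hlev]; linarith [hs.2])
      rw [hlev] at h1
      rw [he]
      exact h1
    have huc : ContinuousOn u (domain z r) := fun x hx =>
      (contDiffAt_of_harmonic hopen hu.harmonic hx).continuousAt.continuousWithinAt
    have hcu : Continuous fun θ => u (circleMap (z k) (r k - side k * s) θ) :=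
      huc.comp_continuous (continuous_circleMap _ _) hmem
    have htr := integral_abs_circleMap_le (p := z k) (side_eq k) (hr k)
      (h.two_mul_le_radius_of_side hc hn k) hopen (hstrip k)
      (fun x hx => ((contDiffAt_of_harmonic hopen hu.harmonic hx).of_le
        (by simp)).contDiffWithinAt)
      ((hu.integrable_trace (d := d)).mono_set (h.strip_subset_domain hc k)) hs.1
      (by linarith [hs.2])
    have htr' : r k * ∫ θ in (0 : ℝ)..2 * Real.pi, |u (circleMap (z k) (r k - side k * s) θ)| ≤
      J k := by rw [hJ]; exact htr
    have h2 : |∫ θ in (0 : ℝ)..2 * Real.pi,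
        ((circleMap (z k) (r k - side k * s) θ - z k) *
          cgrad u (circleMap (z k) (r k - side k * s) θ)).re *
            u (circleMap (z k) (r k - side k * s) θ)| ≤ ∫ θ in (0 : ℝ)..2 * Real.pi,
        (r k * Mg + e k s) * |u (circleMap (z k) (r k - side k * s) θ)| := by
      rw [← Real.norm_eq_abs]
      refine intervalIntegral.norm_integral_le_of_norm_le hpi (ae_of_all _ fun θ _ => ?_)
        ((hcu.abs.const_mul _).intervalIntegrable _ _)
      rw [norm_mul, Real.norm_eq_abs, Real.norm_eq_abs]
      exact mul_le_mul_of_nonneg_right (hb θ) (abs_nonneg _)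
    rw [intervalIntegral.integral_const_mul] at h2
    have h3 : 0 ≤ (r k * Mg + e k s) / r k := div_nonneg ((abs_nonneg _).trans (hb 0)) (hr k).le
    have hσ : |side k| = 1 := by rcases side_eq k with h0 | h0 <;> simp [h0]
    calc _ ≤ |side k * ∫ θ in (0 : ℝ)..2 * Real.pi,
        ((circleMap (z k) (r k - side k * s) θ - z k) *
          cgrad u (circleMap (z k) (r k - side k * s) θ)).re *
            u (circleMap (z k) (r k - side k * s) θ)| := le_abs_self _
      _ ≤ (r k * Mg + e k s) * ∫ θ in (0 : ℝ)..2 * Real.pi,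
          |u (circleMap (z k) (r k - side k * s) θ)| := by rw [abs_mul, hσ, one_mul]; exact h2
      _ = (r k * Mg + e k s) / r k * (r k * ∫ θ in (0 : ℝ)..2 * Real.pi,
          |u (circleMap (z k) (r k - side k * s) θ)|) := by
          have := (hr k).ne'; field_simp
      _ ≤ (r k * Mg + e k s) / r k * J k := by gcongr
      _ = _ := by have := (hr k).ne'; field_simp
  have hlim1 : Tendsto (fun s => ∫ x in innerDomain z r s, ‖cgrad u x‖ ^ 2) (𝓝[>] 0)
      (𝓝 (∫ x in domain z r, ‖cgrad u x‖ ^ 2)) := by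
    refine tendsto_setIntegral_of_eventually_mem (fun s => (isOpen_innerDomain s).measurableSet)
      hopen.measurableSet (fun s hs => innerDomain_subset hs.le) (fun x hx => ?_) hu.integrable_sq
    refine eventually_all.2 fun k => ?_
    filter_upwards [Ioo_mem_nhdsGT (mem_domain_iff.1 hx k)] with s hs using hs.2
  have he0 : ∀ k, Tendsto (e k) (𝓝[>] 0) (𝓝 0) := fun k => by
    have h1 : Continuous (e k) := by
      rw [he]
      have : Continuous fun s : ℝ => (2 * s) ^ α :=
        (continuous_const_mul (2 : ℝ)).rpow_const fun _ => Or.inr hα₀.le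
      fun_prop
    have h2 := (h1.tendsto 0).mono_left (nhdsWithin_le_nhds (s := Ioi 0))
    have h3 : e k 0 = 0 := by rw [he]; simp [Real.zero_rpow hα₀.ne']
    rwa [h3] at h2
  have hlim2 : Tendsto (fun s => ∑ k, (Mg + e k s / r k) * J k) (𝓝[>] 0)
      (𝓝 (∑ k, (Mg + 0 / r k) * J k)) :=
    tendsto_finsetSum _ fun k _ => (((he0 k).div_const _).const_add _).mul_const _
  have hfin := le_of_tendsto_of_tendsto hlim1 hlim2 (by
    filter_upwards [Ioo_mem_nhdsGT (by positivity : 0 < d / 4)] with s hs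
    rw [hu.setIntegral_innerDomain h hc hn hs.1 hs.2]
    exact Finset.sum_le_sum fun k _ => hterm s hs k)
  simp only [zero_div, add_zero, ← Finset.mul_sum] at hfin
  rw [hJ] at hfin
  simpa only [← Finset.mul_sum] using hfin

/-- Cauchy–Schwarz, from the nonnegativity of ∫(V F − a)² with V the measure of S and a the integral
of F. -/
lemma sq_setIntegral_le {S : Set ℂ} {F : ℂ → ℝ} (hS : volume S ≠ ⊤)
    (hF : IntegrableOn F S) (hF2 : IntegrableOn (fun x => F x ^ 2) S) :
    (∫ x in S, F x) ^ 2 ≤ volume.real S * ∫ x in S, F x ^ 2 := by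
  set V := volume.real S with hV
  set a := ∫ x in S, F x with ha
  have hc : ∀ b : ℝ, IntegrableOn (fun _ => b) S := fun b => integrableOn_const hS
  have h1 : 0 ≤ ∫ x in S, (V * F x - a) ^ 2 := integral_nonneg fun x => sq_nonneg _
  have h2 : ∫ x in S, (V * F x - a) ^ 2 = V ^ 2 * (∫ x in S, F x ^ 2) - 2 * V * a * a + V * a ^ 2 := by
    have e1 : ∀ x, (V * F x - a) ^ 2 = V ^ 2 * F x ^ 2 - 2 * V * a * F x + a ^ 2 := fun x => by ring
    simp only [e1]
    have i1 : IntegrableOn (fun x => V ^ 2 * F x ^ 2) S := hF2.const_mul _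
    have i2 : IntegrableOn (fun x => 2 * V * a * F x) S := hF.const_mul _
    have i3 : IntegrableOn (fun x => V ^ 2 * F x ^ 2 - 2 * V * a * F x) S := i1.sub i2
    rw [integral_add i3 (hc _), integral_sub i1 i2, integral_const_mul, integral_const_mul,
      setIntegral_const, smul_eq_mul]
  have hV0 : 0 ≤ V := measureReal_nonneg
  rcases hV0.eq_or_lt with h0 | h0
  · have : volume S = 0 := by
      rw [hV, measureReal_def, eq_comm, ENNReal.toReal_eq_zero_iff] at h0
      exact h0.resolve_right hS
    rw [ha, setIntegral_measure_zero _ this, ← h0]; simp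
  · rw [h2] at h1
    have h3 : 0 ≤ V * (V * (∫ x in S, F x ^ 2) - a ^ 2) := by linarith
    have := nonneg_of_mul_nonneg_right h3 h0
    linarith

lemma Admissible.volume_strip_le (h : Admissible c d z r) (hc : 0 < c) (hn : 1 ≤ n)
    (k : Fin (n + 1)) : volume.real (strip z r d k) ≤ 4 * Real.pi * d * r 0 := by
  have hd := h.d_pos
  have hr0 := h.radius_zero_ge hc hn
  have hrk := h.radius_pos hc hn k
  have hpos : 0 < r k - side k * d := by
    rcases side_eq k with h0 | h0
    · have := h.two_mul_le_radius_of_side hc hn k h0; rw [h0]; linarith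
    · rw [h0]; linarith
  have h1 := setIntegral_level (p := z k) (F := fun _ => 1) (r := r k) (a := 0) (b := d) (side_eq k)
    (by simpa using hrk) hpos hd.le continuousOn_const
  rw [setIntegral_const, smul_eq_mul, mul_one] at h1
  change volume.real (strip z r d k) = _ at h1
  rw [h1]
  simp only [mul_one, intervalIntegral.integral_const, sub_zero, smul_eq_mul]
  rw [intervalIntegral.integral_const_mul, intervalIntegral.integral_sub
    (by simp) (Continuous.intervalIntegrable (by fun_prop) _ _),
    intervalIntegral.integral_const_mul, integral_id, intervalIntegral.integral_const]
  have hs := h.radius_side_le hc k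
  have h2 : r k - side k * (d / 2) ≤ 2 * r 0 := by
    rcases side_eq k with h0 | h0 <;> rw [h0] at hs ⊢ <;> linarith
  have hpi := Real.pi_pos
  calc _ = 2 * Real.pi * d * (r k - side k * (d / 2)) := by simp only [smul_eq_mul]; ring
    _ ≤ 2 * Real.pi * d * (2 * r 0) := by gcongr
    _ = _ := by ring

/-- The energy estimate. -/
lemma IsNeumannSolution.energy_le (h : Admissible c d z r) (hc : 0 < c) (hc1 : c ≤ 1)
    (hn : 1 ≤ n) (hu : IsNeumannSolution z r g u) {α Mg Hg Mg' Hg' : ℝ} (hα₀ : 0 < α) (hα : α < 1)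
    (hg : DataBound z r g α Mg Hg Mg' Hg') :
    l2norm (domain z r) (cgrad u) ^ 2 ≤ Mg * (32 / d * √(n * d * r 0) *
      (√(∫ x in domain z r, u x ^ 2) + d * l2norm (domain z r) (cgrad u))) := by
  have hd := h.d_pos
  have hr0 := h.radius_zero_ge hc hn
  have hopen := isOpen_domain (z := z) (r := r)
  set K := l2norm (domain z r) (cgrad u) with hK
  set U := √(∫ x in domain z r, u x ^ 2) with hU
  have hK0 : 0 ≤ K := Real.sqrt_nonneg _
  have hU0 : 0 ≤ U := Real.sqrt_nonneg _
  have hK2 : K ^ 2 = ∫ x in domain z r, ‖cgrad u x‖ ^ 2 :=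
    Real.sq_sqrt (integral_nonneg fun x => by positivity)
  have hU2 : U ^ 2 = ∫ x in domain z r, u x ^ 2 :=
    Real.sq_sqrt (integral_nonneg fun x => by positivity)
  have h1 := hu.energy_le_sum h hc hc1 hn hα₀ hα hg
  rw [← hK2] at h1
  refine h1.trans (mul_le_mul_of_nonneg_left ?_ hg.sup_nonneg)
  obtain ⟨F, hF⟩ : ∃ F : ℂ → ℝ, F = fun x => |u x| + d * ‖fderiv ℝ u x‖ := ⟨_, rfl⟩
  have hFi : IntegrableOn F (domain z r) := by rw [hF]; exact hu.integrable_trace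
  have hui : IntegrableOn (fun x => u x ^ 2) (domain z r) := hu.memLp.integrable_sq
  have hF2le : ∀ x, F x ^ 2 ≤ 2 * u x ^ 2 + 2 * d ^ 2 * ‖cgrad u x‖ ^ 2 := fun x => by
    rw [hF, norm_cgrad]
    have := sq_nonneg (|u x| - d * ‖fderiv ℝ u x‖)
    rw [← sq_abs (u x)]
    simp only
    linarith [add_sq (|u x|) (d * ‖fderiv ℝ u x‖), sub_sq (|u x|) (d * ‖fderiv ℝ u x‖),
      mul_pow d (‖fderiv ℝ u x‖) 2]
  have hdom : IntegrableOn (fun x => 2 * u x ^ 2 + 2 * d ^ 2 * ‖cgrad u x‖ ^ 2) (domain z r) :=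
    (hui.const_mul 2).add (hu.integrable_sq.const_mul (2 * d ^ 2))
  have hF2i : IntegrableOn (fun x => F x ^ 2) (domain z r) := by
    refine hdom.mono' (hFi.aestronglyMeasurable.pow 2) (ae_of_all _ fun x => ?_)
    rw [Real.norm_of_nonneg (sq_nonneg _)]
    exact hF2le x
  -- Two signed distances add up to at least 2d, so no point is at distance less than d from two
  -- circles.
  have hdisj : Pairwise (Function.onFun Disjoint (strip z r d)) := fun j k hjk =>
    disjoint_left.2 fun x hx hx' => by
      have := h.le_lev_add_lev hc hjk x
      linarith [hx.2, hx'.2]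
  set S := ⋃ k, strip z r d k with hS
  have hSE : S ⊆ domain z r := iUnion_subset fun k => h.strip_subset_domain hc k
  have hSt : volume S ≠ ⊤ := ((measure_mono hSE).trans_lt (volume_domain_lt_top z r)).ne
  have hsum : ∑ k, ∫ x in strip z r d k, F x = ∫ x in S, F x := by
    rw [hS, integral_iUnion_fintype (fun k => (isOpen_strip k).measurableSet) hdisj
      fun k => hFi.mono_set (h.strip_subset_domain hc k)]
  -- There are n + 1 ≤ 2n strips, each of area at most 4πd r 0.
  have hvol : volume.real S ≤ 8 * Real.pi * (n * d * r 0) := by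
    have e1 : volume.real S ≤ ∑ k, volume.real (strip z r d k) :=
      measureReal_iUnion_fintype_le _
    have e2 : ∑ k, volume.real (strip z r d k) ≤ ∑ _k : Fin (n + 1), 4 * Real.pi * d * r 0 :=
      Finset.sum_le_sum fun k _ => h.volume_strip_le hc hn k
    rw [Finset.sum_const, Finset.card_univ, Fintype.card_fin, nsmul_eq_mul] at e2
    have hn' : (1 : ℝ) ≤ n := by exact_mod_cast hn
    have hpos : 0 ≤ 4 * Real.pi * d * r 0 := by
      have := Real.pi_pos
      have : 0 < r 0 := by linarith
      positivity
    push_cast at e2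
    nlinarith
  have hCS := sq_setIntegral_le hSt (hFi.mono_set hSE) (hF2i.mono_set hSE)
  have hF2S : ∫ x in S, F x ^ 2 ≤ 2 * (U + d * K) ^ 2 := by
    calc _ ≤ ∫ x in domain z r, F x ^ 2 := setIntegral_mono_set hF2i
          (ae_of_all _ fun x => sq_nonneg _) (LE.le.eventuallyLE hSE)
      _ ≤ ∫ x in domain z r, (2 * u x ^ 2 + 2 * d ^ 2 * ‖cgrad u x‖ ^ 2) :=
          integral_mono hF2i hdom hF2le
      _ = 2 * U ^ 2 + 2 * d ^ 2 * K ^ 2 := by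
          rw [integral_add (hui.const_mul 2) (hu.integrable_sq.const_mul (2 * d ^ 2)),
            integral_const_mul, integral_const_mul, hK2, hU2]
      _ ≤ _ := by
          have : 0 ≤ U * (d * K) := by positivity
          nlinarith
  set R := √(n * d * r 0) with hR
  have hnd : 0 ≤ n * d * r 0 := by
    have : 0 < r 0 := by linarith
    positivity
  have hR2 : R ^ 2 = n * d * r 0 := Real.sq_sqrt hnd
  -- The constant 8 comes from 8π · 2 ≤ 64, by π ≤ 4.
  have hfin : ∫ x in S, F x ≤ 8 * R * (U + d * K) := by
    have hR0 : 0 ≤ R := Real.sqrt_nonneg _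
    refine le_of_sq_le_sq ?_ (by positivity)
    calc _ ≤ volume.real S * ∫ x in S, F x ^ 2 := hCS
      _ ≤ (8 * Real.pi * (n * d * r 0)) * (2 * (U + d * K) ^ 2) := by
          gcongr
      _ ≤ (8 * 4 * (n * d * r 0)) * (2 * (U + d * K) ^ 2) := by
          gcongr
          exact Real.pi_le_four
      _ = _ := by rw [← hR2]; ring
  rw [← Finset.mul_sum]
  have : ∑ k, ∫ x in strip z r d k, (|u x| + d * ‖fderiv ℝ u x‖) = ∫ x in S, F x := by
    rw [← hsum, hF]
  rw [this]
  calc 4 / d * ∫ x in S, F x ≤ 4 / d * (8 * R * (U + d * K)) := by gcongr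
    _ = _ := by ring

end EnergyBound

/-! ### The Poincaré constant and a lower bound for it. -/

section Poincare

variable {E : Set ℂ} {u : ℂ → ℝ}

/-- All integrands vanish off the compact support of η inside E, so integration by parts takes place
in the whole plane, whatever u is outside E. -/
lemma hasWeakDerivOn_of_contDiffOn (hE : IsOpen E) (hu : ContDiffOn ℝ 1 u E) :
    HasWeakDerivOn E u (fderiv ℝ u) := by
  intro η hη hηc hηE v
  have hη' : Continuous (fderiv ℝ η) := hη.continuous_fderiv (by simp)
  have hu' : ContinuousOn (fderiv ℝ u) E := hu.continuousOn_fderiv_of_isOpen hE le_rfl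
  have hη0 : ∀ x, x ∉ tsupport η → η x = 0 := fun x hx => image_eq_zero_of_notMem_tsupport hx
  have hη0' : ∀ x, x ∉ tsupport η → fderiv ℝ η x = 0 := fun x hx =>
    Function.notMem_support.1 fun h => hx (support_fderiv_subset ℝ h)
  have hint : ∀ F : ℂ → ℝ, ContinuousOn F E → (∀ x, x ∉ tsupport η → F x = 0) → Integrable F :=
    fun F hF h0 => (integrableOn_iff_integrable_of_support_subset fun x hx => by
      by_contra hcon; exact hx (h0 x hcon)).1 ((hF.mono hηE).integrableOn_compact hηc)
  have h1 := integral_mul_fderiv_eq_neg_fderiv_mul_of_integrable (μ := (volume : Measure ℂ))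
    (f := u) (g := η) (v := v)
    (hint _ ((hu'.clm_apply continuousOn_const).mul hη.continuous.continuousOn)
      fun x hx => by rw [hη0 x hx, mul_zero])
    (hint _ (hu.continuousOn.mul (hη'.clm_apply continuous_const).continuousOn)
      fun x hx => by rw [hη0' x hx]; simp)
    (hint _ (hu.continuousOn.mul hη.continuous.continuousOn)
      fun x hx => by rw [hη0 x hx, mul_zero])
    (fun x hx => (hu.contDiffAt (hE.mem_nhds (hηE hx))).differentiableAt (by simp))
    fun x _ => hη.contDiffAt.differentiableAt (by simp)
  rw [setIntegral_eq_integral_of_forall_compl_eq_zero fun x hx => by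
      rw [hη0' x fun h => hx (hηE h)]; simp,
    setIntegral_eq_integral_of_forall_compl_eq_zero fun x hx => by
      rw [hη0 x fun h => hx (hηE h), mul_zero]]
  exact h1

lemma HasWeakDerivOn.const_smul {φ : ℂ → ℝ} {G : ℂ → ℂ →L[ℝ] ℝ} (h : HasWeakDerivOn E φ G)
    (a : ℝ) : HasWeakDerivOn E (a • φ) (a • G) := by
  intro η hη hηc hηE v
  have h1 := h η hη hηc hηE v
  simp only [Pi.smul_apply, smul_eq_mul, smul_apply, mul_assoc]
  rw [integral_const_mul, integral_const_mul, h1]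
  ring

/-- The Poincaré inequality. -/
lemma eLpNorm_le_poincareConst {φ : ℂ → ℝ} {G : ℂ → ℂ →L[ℝ] ℝ}
    (hφ : MemLp φ 2 (volume.restrict E)) (hG : MemLp G 2 (volume.restrict E))
    (h : HasWeakDerivOn E φ G) (h0 : ∫ x in E, φ x = 0)
    (hG0 : eLpNorm G 2 (volume.restrict E) ≠ 0) :
    eLpNorm φ 2 (volume.restrict E) ≤ poincareConst E * eLpNorm G 2 (volume.restrict E) := by
  set N := eLpNorm G 2 (volume.restrict E) with hN
  have hNt : N ≠ ⊤ := hG.eLpNorm_ne_top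
  set a : ℝ := (N.toReal)⁻¹ with ha
  have ha0 : 0 < a := inv_pos.2 (ENNReal.toReal_pos hG0 hNt)
  have hae : ‖a‖ₑ = N⁻¹ := by
    rw [Real.enorm_of_nonneg ha0.le, ha, ENNReal.ofReal_inv_of_pos (ENNReal.toReal_pos hG0 hNt),
      ENNReal.ofReal_toReal hNt]
  have h1 : eLpNorm (a • φ) 2 (volume.restrict E) ≤ poincareConst E := by
    refine le_sSup ⟨a • φ, a • G, hφ.const_smul a, hG.const_smul a, h.const_smul a, ?_, ?_, rfl⟩
    · have h1 := eLpNorm_const_smul a G 2 (volume.restrict E)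
      rw [h1, hae, ← hN, ENNReal.inv_mul_cancel hG0 hNt]
    · simp only [Pi.smul_apply, smul_eq_mul]
      rw [integral_const_mul, h0, mul_zero]
  rw [eLpNorm_const_smul, hae] at h1
  calc _ = N * (N⁻¹ * eLpNorm φ 2 (volume.restrict E)) := by
        rw [← mul_assoc, ENNReal.mul_inv_cancel hG0 hNt, one_mul]
    _ ≤ N * poincareConst E := by gcongr
    _ = _ := mul_comm _ _

lemma eLpNorm_two_eq {F : Type*} [NormedAddCommGroup F] {f : ℂ → F}
    (hf : MemLp f 2 (volume.restrict E)) :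
    eLpNorm f 2 (volume.restrict E) = ENNReal.ofReal (√(∫ x in E, ‖f x‖ ^ 2)) := by
  rw [hf.eLpNorm_eq_integral_rpow_norm (by simp) (by simp), Real.sqrt_eq_rpow]
  simp

/-- A fixed function with zero mean, scaled to a ball of radius `d`, bounds the Poincaré constant
from below. -/
lemma exists_mul_le_poincareConst : ∃ κ : ℝ, 0 < κ ∧ ∀ (E : Set ℂ) (x₀ : ℂ) (d : ℝ), 0 < d →
    IsOpen E → volume E ≠ ⊤ → ball x₀ d ⊆ E → ENNReal.ofReal (κ * d) ≤ poincareConst E := by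
  -- The radius 1/4 lets the translates of the bump by ±1/2 be disjoint and lie in the unit disk;
  -- their difference has zero mean.
  let β : ContDiffBump (0 : ℂ) := ⟨1 / 8, 1 / 4, by norm_num, by norm_num⟩
  have hβ : ContDiff ℝ ∞ β := β.contDiff
  obtain ⟨L₀, hL₀⟩ := (β.hasCompactSupport.fderiv (𝕜 := ℝ)).exists_bound_of_continuous
    (hβ.continuous_fderiv (by simp))
  set L := max L₀ 1 with hL
  have hL1 : 1 ≤ L := le_max_right _ _
  have hLip : ∀ x y, |β x - β y| ≤ L * ‖x - y‖ := fun x y =>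
    convex_univ.norm_image_sub_le_of_norm_fderiv_le (𝕜 := ℝ)
      (fun w _ => hβ.contDiffAt.differentiableAt (by simp))
      (fun w _ => (hL₀ w).trans (le_max_left _ _)) (mem_univ y) (mem_univ x)
  -- The test function has L² norm at least d/8, from a disk of radius d/8 on which it equals 1. Its
  -- gradient has L² norm at most 4L, since it is at most 2L/d on a disk of area πd².
  refine ⟨(8 * (4 * L))⁻¹, by positivity, fun E x₀ d hd hE hEt hball => ?_⟩
  have hfin : IsFiniteMeasure (volume.restrict E) :=
    ⟨by rw [Measure.restrict_apply_univ]; exact lt_top_iff_ne_top.2 hEt⟩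
  obtain ⟨T, hT⟩ : ∃ T : ℝ → ℂ → ℂ, T = fun s x => ((d⁻¹ : ℝ) : ℂ) * (x - (x₀ + (s * d : ℝ))) :=
    ⟨_, rfl⟩
  have hTc : ∀ s, ContDiff ℝ ∞ (T s) := fun s => by rw [hT]; fun_prop
  have hTn : ∀ s x, ‖T s x‖ = d⁻¹ * ‖x - (x₀ + (s * d : ℝ))‖ := fun s x => by
    rw [hT]; simp only; rw [norm_mul, norm_real, Real.norm_of_nonneg (by positivity)]
  have hTs : ∀ s x y, ‖T s x - T s y‖ = d⁻¹ * ‖x - y‖ := fun s x y => by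
    rw [hT]; simp only; rw [← mul_sub, norm_mul, norm_real, Real.norm_of_nonneg (by positivity)]
    congr 2; ring
  obtain ⟨φ, hφ⟩ : ∃ φ : ℂ → ℝ, φ = fun x => β (T (1 / 2) x) - β (T (-(1 / 2)) x) := ⟨_, rfl⟩
  have hφs : ContDiff ℝ ∞ φ := by
    rw [hφ]; exact (hβ.comp (hTc _)).sub (hβ.comp (hTc _))
  have hβ0 : ∀ s : ℝ, |s| = 1 / 2 → ∀ x, x ∉ ball x₀ d → β (T s x) = 0 := fun s hs x hx => by
    refine β.zero_of_le_dist ?_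
    rw [dist_zero_right, hTn]
    have h1 : d ≤ ‖x - x₀‖ := by rwa [mem_ball, not_lt, dist_eq_norm] at hx
    have h2 : ‖((s * d : ℝ) : ℂ)‖ = d / 2 := by
      rw [norm_real, norm_mul, Real.norm_eq_abs, hs, Real.norm_of_nonneg hd.le]; ring
    have h3 := norm_sub_norm_le (x - x₀) ((s * d : ℝ) : ℂ)
    rw [sub_sub, h2] at h3
    have h4 : d / 2 ≤ ‖x - (x₀ + ((s * d : ℝ) : ℂ))‖ := by linarith
    calc (1 / 4 : ℝ) ≤ d⁻¹ * (d / 2) := by rw [show d⁻¹ * (d / 2) = 1 / 2 by field_simp]; norm_num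
      _ ≤ _ := by gcongr
  have hφ0 : ∀ x, x ∉ ball x₀ d → φ x = 0 := fun x hx => by
    rw [hφ]; simp only
    rw [hβ0 _ (by norm_num [abs_of_pos]) x hx, hβ0 _ (by norm_num [abs_of_pos]) x hx, sub_zero]
  have hφ1 : ∀ x ∈ ball (x₀ + ((1 / 2 * d : ℝ) : ℂ)) (d / 8), φ x = 1 := fun x hx => by
    have h1 : β (T (1 / 2) x) = 1 := β.one_of_mem_closedBall (by
      rw [mem_closedBall, dist_zero_right, hTn, ← dist_eq_norm]
      calc d⁻¹ * dist x (x₀ + ((1 / 2 * d : ℝ) : ℂ)) ≤ d⁻¹ * (d / 8) := by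
            gcongr; exact (mem_ball.1 hx).le
        _ = 1 / 8 := by field_simp)
    have h2 : β (T (-(1 / 2)) x) = 0 := β.zero_of_le_dist (by
      rw [dist_zero_right, hTn]
      have h3 := norm_sub_norm_le ((d : ℝ) : ℂ) ((x₀ + ((1 / 2 * d : ℝ) : ℂ)) - x)
      have h4 : ((d : ℝ) : ℂ) - ((x₀ + ((1 / 2 * d : ℝ) : ℂ)) - x) =
        x - (x₀ + ((-(1 / 2) * d : ℝ) : ℂ)) := by push_cast; ring
      rw [h4, norm_real, Real.norm_of_nonneg hd.le, ← dist_eq_norm, dist_comm] at h3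
      have h5 := mem_ball.1 hx
      calc (1 / 4 : ℝ) ≤ d⁻¹ * (d / 2) := by
            rw [show d⁻¹ * (d / 2) = 1 / 2 by field_simp]; norm_num
        _ ≤ _ := by gcongr; linarith)
    rw [hφ]; simp only; rw [h1, h2, sub_zero]
  have hφd : ∀ x, ‖fderiv ℝ φ x‖ ≤ 2 * L / d := fun x => by
    have hlip : LipschitzWith (2 * L / d).toNNReal φ := LipschitzWith.of_dist_le_mul fun x y => by
      rw [Real.coe_toNNReal _ (by positivity), Real.dist_eq, dist_eq_norm, hφ]
      have h1 := hLip (T (1 / 2) x) (T (1 / 2) y)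
      have h2 := hLip (T (-(1 / 2)) x) (T (-(1 / 2)) y)
      rw [hTs] at h1 h2
      simp only
      rw [show ∀ a b c e : ℝ, a - b - (c - e) = (a - c) - (b - e) from fun a b c e => by ring]
      refine (abs_sub _ _).trans ((add_le_add h1 h2).trans_eq ?_)
      field_simp; ring
    exact (norm_fderiv_le_of_lipschitz ℝ hlip).trans_eq (Real.coe_toNNReal _ (by positivity))
  have hφd0 : ∀ x, x ∉ closedBall x₀ d → fderiv ℝ φ x = 0 := fun x hx => by
    have : φ =ᶠ[𝓝 x] fun _ => 0 := by
      filter_upwards [isClosed_closedBall.isOpen_compl.mem_nhds hx] with y hy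
      exact hφ0 y fun h => hy (ball_subset_closedBall h)
    rw [this.fderiv_eq]; simp
  have hφ' : Continuous (fderiv ℝ φ) := hφs.continuous_fderiv (by simp)
  have hφL : MemLp φ 2 (volume.restrict E) := by
    refine MemLp.of_bound hφs.continuous.aestronglyMeasurable 1 (ae_of_all _ fun x => ?_)
    rw [hφ, Real.norm_eq_abs, abs_le]
    have h1 := β.nonneg' (T (1 / 2) x)
    have h2 := β.nonneg' (T (-(1 / 2)) x)
    have h3 := β.le_one (x := T (1 / 2) x)
    have h4 := β.le_one (x := T (-(1 / 2)) x)
    constructor <;> simp only <;> linarith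
  have hφL' : MemLp (fderiv ℝ φ) 2 (volume.restrict E) :=
    MemLp.of_bound hφ'.aestronglyMeasurable _ (ae_of_all _ hφd)
  have hmean : ∫ x in E, φ x = 0 := by
    rw [setIntegral_eq_integral_of_forall_compl_eq_zero fun x hx => hφ0 x fun h => hx (hball h)]
    have hi : ∀ s, ∫ x, β (T s x) = ∫ x, β (((d⁻¹ : ℝ) : ℂ) * x) := fun s => by
      rw [hT]
      exact integral_sub_right_eq_self (fun x => β (((d⁻¹ : ℝ) : ℂ) * x)) (x₀ + ((s * d : ℝ) : ℂ))
    have hβi : ∀ s : ℝ, |s| = 1 / 2 → Integrable fun x => β (T s x) := fun s hs =>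
      (integrableOn_iff_integrable_of_support_subset (s := closedBall x₀ d) fun x hx => by
        by_contra hcon
        exact hx (hβ0 s hs x fun h => hcon (ball_subset_closedBall h))).1
        ((hβ.comp (hTc s)).continuous.continuousOn.integrableOn_compact (isCompact_closedBall _ _))
    rw [hφ, integral_sub (hβi _ (by norm_num [abs_of_pos])) (hβi _ (by norm_num [abs_of_pos])),
      hi, hi, sub_self]
  -- If the gradient vanished in E it would vanish everywhere and φ would be constant, but φ takes
  -- the values 1 and 0.
  have hne : eLpNorm (fderiv ℝ φ) 2 (volume.restrict E) ≠ 0 := fun h0 => by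
    rw [eLpNorm_eq_zero_iff hφL'.1 (by simp)] at h0
    have h1 : EqOn (fderiv ℝ φ) 0 E := Measure.eqOn_open_of_ae_eq h0 hE hφ'.continuousOn
      continuousOn_const
    have h2 : ∀ x, fderiv ℝ φ x = 0 := fun x => by
      by_cases hx : x ∈ ball x₀ d
      · exact h1 (hball hx)
      · have : x ∈ closure (ball x₀ d)ᶜ := subset_closure hx
        by_cases hx' : x ∈ closedBall x₀ d
        · have h3 : x ∈ closure (ball x₀ d) := by rwa [closure_ball x₀ hd.ne']
          exact (isClosed_eq hφ' continuous_const).closure_subset_iff.2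
            (fun y hy => h1 (hball hy)) h3
        · exact hφd0 x hx'
    have h3 : φ (x₀ + ((1 / 2 * d : ℝ) : ℂ)) = φ (x₀ + (d : ℂ)) :=
      is_const_of_fderiv_eq_zero (𝕜 := ℝ) (hφs.differentiable (by simp)) h2 _ _
    rw [hφ1 _ (mem_ball_self (by positivity)), hφ0 _ (by simp [abs_of_pos hd])] at h3
    exact one_ne_zero h3
  have hP := eLpNorm_le_poincareConst hφL hφL'
    (hasWeakDerivOn_of_contDiffOn hE (hφs.of_le (by simp)).contDiffOn) hmean hne
  have hvol : ∀ (a : ℂ) {ρ : ℝ}, 0 < ρ → volume.real (closedBall a ρ) = Real.pi * ρ ^ 2 ∧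
      volume.real (ball a ρ) = Real.pi * ρ ^ 2 := fun a ρ hρ => by
    rw [measureReal_def, measureReal_def, Complex.volume_closedBall, Complex.volume_ball]
    simp [ENNReal.toReal_ofReal hρ.le, mul_comm]
  have hlow : ENNReal.ofReal (d / 8) ≤ eLpNorm φ 2 (volume.restrict E) := by
    rw [eLpNorm_two_eq hφL]
    refine ENNReal.ofReal_le_ofReal (Real.le_sqrt_of_sq_le ?_)
    have hsub : ball (x₀ + ((1 / 2 * d : ℝ) : ℂ)) (d / 8) ⊆ E := by
      refine (ball_subset_ball' ?_).trans hball
      rw [dist_eq_norm, add_sub_cancel_left, norm_real, Real.norm_of_nonneg (by positivity)]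
      linarith
    have h1 : ∫ x in ball (x₀ + ((1 / 2 * d : ℝ) : ℂ)) (d / 8), ‖φ x‖ ^ 2 =
        Real.pi * (d / 8) ^ 2 := by
      rw [setIntegral_congr_fun measurableSet_ball (g := fun _ => (1 : ℝ)) fun x hx => by
        simp only; rw [hφ1 x hx]; simp, setIntegral_const, (hvol _ (by positivity)).2]
      simp
    have h2 : ∫ x in ball (x₀ + ((1 / 2 * d : ℝ) : ℂ)) (d / 8), ‖φ x‖ ^ 2 ≤
        ∫ x in E, ‖φ x‖ ^ 2 :=
      setIntegral_mono_set (hφL.integrable_norm_pow (p := 2) (by norm_num))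
        (ae_of_all _ fun x => by simp only [Pi.zero_apply]; positivity)
        (LE.le.eventuallyLE hsub)
    rw [h1] at h2
    have := Real.pi_gt_three
    nlinarith [sq_nonneg (d / 8)]
  have hupp : eLpNorm (fderiv ℝ φ) 2 (volume.restrict E) ≤ ENNReal.ofReal (4 * L) := by
    rw [eLpNorm_two_eq hφL']
    refine ENNReal.ofReal_le_ofReal (Real.sqrt_le_iff.2 ⟨by positivity, ?_⟩)
    have hi : Integrable ((closedBall x₀ d).indicator fun _ => (2 * L / d) ^ 2) :=
      (integrableOn_const measure_closedBall_lt_top.ne).integrable_indicator measurableSet_closedBall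
    calc ∫ x in E, ‖fderiv ℝ φ x‖ ^ 2 ≤
          ∫ x in E, (closedBall x₀ d).indicator (fun _ => (2 * L / d) ^ 2) x := by
          refine integral_mono_of_nonneg (ae_of_all _ fun x => by
            simp only [Pi.zero_apply]; positivity) hi.integrableOn (ae_of_all _ fun x => ?_)
          by_cases hx : x ∈ closedBall x₀ d
          · simp only [indicator_of_mem hx]
            gcongr
            exact hφd x
          · simp only [indicator_of_notMem hx, hφd0 x hx]; simp
      _ ≤ ∫ x, (closedBall x₀ d).indicator (fun _ => (2 * L / d) ^ 2) x :=
          setIntegral_le_integral hi (ae_of_all _ fun x => indicator_nonneg (fun _ _ => by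
            positivity) x)
      _ = Real.pi * (2 * L) ^ 2 := by
          rw [integral_indicator measurableSet_closedBall, setIntegral_const, (hvol x₀ hd).1,
            smul_eq_mul]
          field_simp
      _ ≤ 4 * (2 * L) ^ 2 := by gcongr; exact Real.pi_le_four
      _ = _ := by ring
  have hfinal : ENNReal.ofReal (d / 8) ≤ poincareConst E * ENNReal.ofReal (4 * L) :=
    hlow.trans (hP.trans (by gcongr))
  calc ENNReal.ofReal ((8 * (4 * L))⁻¹ * d) = ENNReal.ofReal (d / 8) / ENNReal.ofReal (4 * L) := by
        rw [← ENNReal.ofReal_div_of_pos (by positivity)]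
        congr 1; field_simp
    _ ≤ _ := ENNReal.div_le_of_le_mul hfinal

end Poincare

/-! ### Extended norms and pointwise bounds. -/

section Norms

variable {F : Type*} [NormedAddCommGroup F] {S : Set ℂ} {f : ℂ → F} {α : ℝ≥0}

lemma supNorm_le {M : ℝ} (h : ∀ x ∈ S, ‖f x‖ ≤ M) : supNorm S f ≤ ENNReal.ofReal M :=
  iSup₂_le fun x hx => by
    rw [← ofReal_norm]; exact ENNReal.ofReal_le_ofReal (h x hx)

lemma norm_le_toReal_supNorm (hS : supNorm S f ≠ ⊤) {x : ℂ} (hx : x ∈ S) :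
    ‖f x‖ ≤ (supNorm S f).toReal := by
  rw [← toReal_enorm]
  exact ENNReal.toReal_mono hS (le_iSup₂ (f := fun x (_ : x ∈ S) => ‖f x‖ₑ) x hx)

lemma holderSeminorm_le {H : ℝ} (hH : 0 ≤ H)
    (h : ∀ x ∈ S, ∀ y ∈ S, ‖f x - f y‖ ≤ H * dist x y ^ (α : ℝ)) :
    holderSeminorm α S f ≤ ENNReal.ofReal H := by
  refine HolderWith.eHolderNorm_le (C := H.toNNReal) fun x y => ?_
  have h1 := h x x.2 y y.2
  have h2 : ENNReal.ofReal (dist x y) ^ (α : ℝ) = ENNReal.ofReal (dist x y ^ (α : ℝ)) :=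
    ENNReal.ofReal_rpow_of_nonneg dist_nonneg α.2
  rw [edist_dist, edist_dist, h2]
  change _ ≤ ENNReal.ofReal H * _
  rw [← ENNReal.ofReal_mul hH, dist_eq_norm]
  exact ENNReal.ofReal_le_ofReal h1

lemma norm_sub_le_toReal_holderSeminorm (hS : holderSeminorm α S f ≠ ⊤) {x y : ℂ} (hx : x ∈ S)
    (hy : y ∈ S) : ‖f x - f y‖ ≤ (holderSeminorm α S f).toReal * dist x y ^ (α : ℝ) := by
  have h1 := (eHolderNorm_ne_top.1 hS).holderWith.dist_le ⟨x, hx⟩ ⟨y, hy⟩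
  rw [dist_eq_norm] at h1
  exact h1

end Norms

/-! ### Finiteness of the norms of the boundary data. -/

section Data

variable {n : ℕ} {z : Fin (n + 1) → ℂ} {r : Fin (n + 1) → ℝ} {g : ℂ → ℝ} {α : ℝ≥0}

/-- Arc length s on a circle of radius ρ is the angle s/ρ. -/
lemma arcDeriv_circleMap {p : ℂ} {ρ : ℝ} {θ : ℝ}
    (hg : Differentiable ℝ fun θ : ℝ => g (circleMap p ρ θ)) :
    arcDeriv p ρ g (circleMap p ρ θ) = deriv (fun θ : ℝ => g (circleMap p ρ θ)) θ / ρ := by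
  have h1 : (fun s : ℝ => g (p + (circleMap p ρ θ - p) * cexp (((s / ρ : ℝ) : ℂ) * I))) =
      fun s : ℝ => (fun θ : ℝ => g (circleMap p ρ θ)) (θ + s / ρ) := by
    ext s
    have : p + (circleMap p ρ θ - p) * cexp (((s / ρ : ℝ) : ℂ) * I) =
        circleMap p ρ (θ + s / ρ) := by
      rw [circleMap, circleMap, add_sub_cancel_left, mul_assoc, ← exp_add]
      push_cast; ring_nf
    simp only [this]
  have h2 : HasDerivAt (fun s : ℝ => θ + s / ρ) (1 / ρ) 0 :=
    ((hasDerivAt_id (0 : ℝ)).div_const ρ).const_add θ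
  have h3 : HasDerivAt (fun θ : ℝ => g (circleMap p ρ θ))
      (deriv (fun θ : ℝ => g (circleMap p ρ θ)) θ) (θ + 0 / ρ) := by
    rw [zero_div, add_zero]; exact (hg θ).hasDerivAt
  have h4 : HasDerivAt (fun s : ℝ => (fun θ : ℝ => g (circleMap p ρ θ)) (θ + s / ρ))
      (deriv (fun θ : ℝ => g (circleMap p ρ θ)) θ * (1 / ρ)) 0 := 
    HasDerivAt.comp (h₂ := fun θ : ℝ => g (circleMap p ρ θ)) 0 h3 h2
  rw [arcDeriv, h1, h4.deriv, mul_one_div]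

lemma exists_circleMap_eq_of_mem_sphere {p x : ℂ} {ρ : ℝ} (hx : x ∈ sphere p ρ) :
    ∃ θ ∈ Ioc 0 (2 * Real.pi), circleMap p ρ θ = x := by
  have h := exists_circleMap_eq p x
  rwa [← dist_eq_norm, mem_sphere.1 hx] at h

lemma exists_abs_le_of_continuous {γ : ℝ → ℝ} (hγ : Continuous γ) :
    ∃ M, ∀ θ ∈ Icc 0 (2 * Real.pi), |γ θ| ≤ M := by
  obtain ⟨M, hM⟩ := isCompact_Icc.exists_bound_of_continuousOn (s := Icc 0 (2 * Real.pi))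
    hγ.continuousOn
  exact ⟨M, fun θ hθ => hM θ hθ⟩

lemma supNorm_ne_top_of_continuous {p : ℂ} {ρ : ℝ} {f : ℂ → ℝ}
    (hf : Continuous fun θ : ℝ => f (circleMap p ρ θ)) : supNorm (sphere p ρ) f ≠ ⊤ := by
  obtain ⟨M, hM⟩ := exists_abs_le_of_continuous hf
  refine ne_top_of_le_ne_top ENNReal.ofReal_ne_top (supNorm_le (M := M) fun x hx => ?_)
  obtain ⟨θ, hθ, rfl⟩ := exists_circleMap_eq_of_mem_sphere hx
  exact hM θ (Ioc_subset_Icc_self hθ)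

/-- The class C^{1,α} is defined by g' alone, so the finiteness of the Hölder seminorm of g has to
be derived. A C¹ function is Lipschitz in the angle, the angle is comparable with the chord, and the
chord is bounded by 2ρ. -/
lemma holderSeminorm_ne_top_of_contDiff {p : ℂ} {ρ : ℝ} (hρ : 0 < ρ) (hα : α < 1)
    (hg : ContDiff ℝ 1 fun θ : ℝ => g (circleMap p ρ θ)) :
    holderSeminorm α (sphere p ρ) g ≠ ⊤ := by
  set γ : ℝ → ℝ := fun θ => g (circleMap p ρ θ) with hγ
  have hpi := Real.pi_pos
  obtain ⟨M, hM⟩ := isCompact_Icc.exists_bound_of_continuousOn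
    (s := Icc (-(4 * Real.pi)) (4 * Real.pi)) (hg.continuous_deriv le_rfl).continuousOn
  have hM0 : 0 ≤ M := (norm_nonneg _).trans (hM 0 ⟨by linarith, by linarith⟩)
  have hα0 : (0 : ℝ) ≤ α := α.2
  have hα1 : (α : ℝ) < 1 := hα
  refine ne_top_of_le_ne_top ENNReal.ofReal_ne_top (holderSeminorm_le
    (H := M * (Real.pi / 2 / ρ * (2 * ρ) ^ (1 - (α : ℝ)))) (by positivity) fun x hx y hy => ?_)
  obtain ⟨a, ha, rfl⟩ := exists_circleMap_eq_of_mem_sphere hx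
  obtain ⟨b, hb, rfl⟩ := exists_circleMap_eq_of_mem_sphere hy
  -- The angle of the second point is shifted by a multiple of 2π so that the angles differ by at
  -- most π, as the comparison with the chord requires.
  obtain ⟨b', hb', hbb, hab⟩ : ∃ b', circleMap p ρ b' = circleMap p ρ b ∧
      b' ∈ Icc (-(4 * Real.pi)) (4 * Real.pi) ∧ |a - b'| ≤ Real.pi := by
    rcases le_total (a - b) Real.pi with h1 | h1
    · rcases le_total (-Real.pi) (a - b) with h2 | h2
      · exact ⟨b, rfl, ⟨by linarith [hb.1], by linarith [hb.2]⟩, abs_le.2 ⟨h2, h1⟩⟩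
      · refine ⟨b - 2 * Real.pi, (periodic_circleMap p ρ).sub_eq b, ⟨by linarith [hb.1],
          by linarith [hb.2]⟩, abs_le.2 ⟨by linarith [ha.1, hb.2], by linarith⟩⟩
    · refine ⟨b + 2 * Real.pi, periodic_circleMap p ρ b, ⟨by linarith [hb.1],
        by linarith [hb.2]⟩, abs_le.2 ⟨by linarith, by linarith [ha.2, hb.1]⟩⟩
  rw [← hb']
  have h1 : ‖γ a - γ b'‖ ≤ M * ‖a - b'‖ :=
    (convex_Icc (-(4 * Real.pi)) (4 * Real.pi)).norm_image_sub_le_of_norm_deriv_le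
      (fun w _ => hg.contDiffAt.differentiableAt (by simp)) hM hbb
      ⟨by linarith [ha.1], by linarith [ha.2]⟩
  refine h1.trans ?_
  rw [mul_assoc]
  gcongr
  have h2 := mul_abs_le_norm_circleMap_sub p hρ.le hab
  rw [dist_eq_norm]
  set x := ‖circleMap p ρ a - circleMap p ρ b'‖ with hx
  have hx0 : 0 ≤ x := norm_nonneg _
  have hx2 : x ≤ 2 * ρ := by
    rw [hx, norm_circleMap_sub_circleMap p hρ.le]
    have := Real.abs_sin_le_one ((a - b') / 2)
    nlinarith
  have h3 : x ≤ (2 * ρ) ^ (1 - (α : ℝ)) * x ^ (α : ℝ) := by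
    rcases hx0.eq_or_lt with h0 | h0
    · rw [← h0]; positivity
    · calc x = x ^ (1 - (α : ℝ)) * x ^ (α : ℝ) := by rw [← Real.rpow_add h0]; simp
        _ ≤ _ := by
          gcongr
  calc ‖a - b'‖ = Real.pi / 2 / ρ * (2 / Real.pi * ρ * |a - b'|) := by
        rw [Real.norm_eq_abs]; field_simp
    _ ≤ Real.pi / 2 / ρ * ((2 * ρ) ^ (1 - (α : ℝ)) * x ^ (α : ℝ)) := by
        exact mul_le_mul_of_nonneg_left (h2.trans h3) (by positivity)
    _ = _ := by ring

lemma IsC1Holder.continuous_arcDeriv (hg : IsC1Holder α z r g) (k : Fin (n + 1)) :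
    Continuous fun θ : ℝ => arcDeriv (z k) (r k) g (circleMap (z k) (r k) θ) := by
  simp only [arcDeriv_circleMap ((hg.1 k).differentiable (by simp))]
  exact ((hg.1 k).continuous_deriv le_rfl).div_const _

lemma IsC1Holder.bdrySup_ne_top (hg : IsC1Holder α z r g) : bdrySup z r g ≠ ⊤ := by
  have h1 : bdrySup z r g ≤ ⨆ k, supNorm (sphere (z k) (r k)) g := by
    refine iSup₂_le fun x hx => ?_
    obtain ⟨k, hk⟩ := mem_iUnion.1 hx
    exact (le_iSup₂ (f := fun x (_ : x ∈ sphere (z k) (r k)) => ‖g x‖ₑ) x hk).trans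
      (le_iSup (fun k => supNorm (sphere (z k) (r k)) g) k)
  refine ne_top_of_le_ne_top ?_ h1
  exact iSup_ne_top fun k => supNorm_ne_top_of_continuous (hg.1 k).continuous

lemma IsC1Holder.bdryDerivSup_ne_top (hg : IsC1Holder α z r g) : bdryDerivSup z r g ≠ ⊤ :=
  iSup_ne_top fun k => supNorm_ne_top_of_continuous (hg.continuous_arcDeriv k)

lemma IsC1Holder.bdryHolder_ne_top (hr : ∀ k, 0 < r k) (hα : α < 1) (hg : IsC1Holder α z r g) :
    bdryHolder α z r g ≠ ⊤ :=
  iSup_ne_top fun k => holderSeminorm_ne_top_of_contDiff (hr k) hα (hg.1 k)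

lemma IsC1Holder.dataBound (hr : ∀ k, 0 < r k) (hα : α < 1) (hg : IsC1Holder α z r g) :
    DataBound z r g α (bdrySup z r g).toReal (bdryHolder α z r g).toReal
      (bdryDerivSup z r g).toReal (bdryDerivHolder α z r g).toReal := by
  have hH := hg.bdryHolder_ne_top hr hα
  have hS' := hg.bdryDerivSup_ne_top
  have hH' := hg.2
  have hmem : ∀ k θ, circleMap (z k) (r k) θ ∈ sphere (z k) (r k) := fun k θ =>
    circleMap_mem_sphere _ (hr k).le θ
  have harc : ∀ k θ, deriv (fun θ : ℝ => g (circleMap (z k) (r k) θ)) θ =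
      r k * arcDeriv (z k) (r k) g (circleMap (z k) (r k) θ) := fun k θ => by
    rw [arcDeriv_circleMap ((hg.1 k).differentiable (by simp)), mul_div_cancel₀ _ (hr k).ne']
  refine ⟨ENNReal.toReal_nonneg, ENNReal.toReal_nonneg, ENNReal.toReal_nonneg,
    ENNReal.toReal_nonneg, hg.1, fun k θ => ?_, fun k a b => ?_, fun k θ => ?_, fun k a b => ?_⟩
  · exact norm_le_toReal_supNorm hg.bdrySup_ne_top (mem_iUnion.2 ⟨k, hmem k θ⟩)
  · have h1 := le_iSup (fun k => holderSeminorm α (sphere (z k) (r k)) g) k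
    have h2 := norm_sub_le_toReal_holderSeminorm (ne_top_of_le_ne_top hH h1) (hmem k a) (hmem k b)
    rw [← Real.norm_eq_abs, ← dist_eq_norm (circleMap (z k) (r k) a)]
    exact h2.trans (by gcongr; exact h1)
  · have h1 := le_iSup (fun k => supNorm (sphere (z k) (r k)) (arcDeriv (z k) (r k) g)) k
    have h2 := norm_le_toReal_supNorm (ne_top_of_le_ne_top hS' h1) (hmem k θ)
    rw [harc, abs_mul, abs_of_pos (hr k), ← Real.norm_eq_abs]
    exact mul_le_mul_of_nonneg_left (h2.trans (ENNReal.toReal_mono hS' h1)) (hr k).le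
  · have h1 := le_iSup (fun k => holderSeminorm α (sphere (z k) (r k))
      (arcDeriv (z k) (r k) g)) k
    have h2 := norm_sub_le_toReal_holderSeminorm (ne_top_of_le_ne_top hH' h1) (hmem k a) (hmem k b)
    rw [harc, harc, ← mul_sub, abs_mul, abs_of_pos (hr k), ← Real.norm_eq_abs, mul_assoc,
      ← dist_eq_norm (circleMap (z k) (r k) a)]
    exact mul_le_mul_of_nonneg_left (h2.trans (by gcongr; exact h1))
      (hr k).le

end Data

/-! ### The energy in terms of the constant B. -/

section EnergyConst

variable {n : ℕ} {z : Fin (n + 1) → ℂ} {r : Fin (n + 1) → ℝ} {c d : ℝ}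

/-- This disk touches the outer circle from inside, so its points have distance between 0 and 2d
from that circle. It serves in the lower bounds for the area and for the Poincaré constant. -/
lemma Admissible.ball_subset (h : Admissible c d z r) (hc : 0 < c) (hn : 1 ≤ n) :
    ball (z 0 + ((r 0 - d : ℝ) : ℂ)) d ⊆ domain z r := fun x hx => by
  have hd := h.d_pos
  have hr0 := h.radius_zero_ge hc hn
  rw [mem_ball, dist_eq_norm] at hx
  have hnorm : ‖((r 0 - d : ℝ) : ℂ)‖ = r 0 - d := by
    rw [norm_real, Real.norm_of_nonneg (by linarith)]
  have h1 := norm_add_le (x - (z 0 + ((r 0 - d : ℝ) : ℂ))) ((r 0 - d : ℝ) : ℂ)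
  have h2 := norm_sub_le (x - z 0) (x - (z 0 + ((r 0 - d : ℝ) : ℂ)))
  rw [show x - (z 0 + ((r 0 - d : ℝ) : ℂ)) + ((r 0 - d : ℝ) : ℂ) = x - z 0 by ring, hnorm] at h1
  rw [show x - z 0 - (x - (z 0 + ((r 0 - d : ℝ) : ℂ))) = ((r 0 - d : ℝ) : ℂ) by ring, hnorm] at h2
  refine h.strip_subset hc (k := 0) ?_ ?_ <;> rw [lev_zero] <;> linarith

lemma Admissible.le_volume_rpow (h : Admissible c d z r) (hc : 0 < c) (hn : 1 ≤ n) :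
    ENNReal.ofReal d ≤ volume (domain z r) ^ (1 / 2 : ℝ) := by
  have hd := h.d_pos
  have h1 : ENNReal.ofReal (d ^ 2) ≤ volume (domain z r) := by
    refine le_trans ?_ (measure_mono (h.ball_subset hc hn))
    rw [Complex.volume_ball, ENNReal.ofReal_pow hd.le]
    refine le_mul_of_one_le_right (zero_le) ?_
    have : (1 : ℝ≥0) ≤ NNReal.pi := by
      rw [← NNReal.coe_le_coe]; simpa using Real.pi_gt_three.le.trans' (by norm_num)
    exact_mod_cast this
  calc ENNReal.ofReal d = ENNReal.ofReal (d ^ 2) ^ (1 / 2 : ℝ) := by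
        rw [ENNReal.ofReal_rpow_of_pos (by positivity), ← Real.sqrt_eq_rpow, Real.sqrt_sq hd.le]
    _ ≤ _ := ENNReal.rpow_le_rpow h1 (by norm_num)

/-- The energy is bounded by the constant `B` and the supremum of the boundary data. -/
lemma exists_energy_bound : ∃ C₀ : ℝ, 0 < C₀ ∧ ∀ (n : ℕ) (_ : 1 ≤ n) (z : Fin (n + 1) → ℂ)
    (r : Fin (n + 1) → ℝ) (c d : ℝ) (_ : 0 < c) (_ : c ≤ 1) (_ : Admissible c d z r)
    (g u : ℂ → ℝ) (_ : IsNeumannSolution z r g u) (_ : ∫ x in domain z r, u x = 0)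
    (α Mg Hg Mg' Hg' : ℝ) (_ : 0 < α) (_ : α < 1) (_ : DataBound z r g α Mg Hg Mg' Hg'),
    ENNReal.ofReal (d ^ 2 * l2norm (domain z r) (cgrad u)) ≤
      ENNReal.ofReal C₀ * constB d z r * ENNReal.ofReal Mg := by
  obtain ⟨κ, hκ, hP⟩ := exists_mul_le_poincareConst
  refine ⟨32 * (1 + 1 / κ) / κ, by positivity, fun n hn z r c d hc hc1 h g u hu hu0 α Mg Hg Mg' Hg'
    hα₀ hα hg => ?_⟩
  have hd := h.d_pos
  have hr0 := h.radius_pos hc hn 0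
  have hMg := hg.sup_nonneg
  have hopen := isOpen_domain (z := z) (r := r)
  have hE := hu.energy_le h hc hc1 hn hα₀ hα hg
  have hlow := hP _ _ d hd hopen (volume_domain_lt_top z r).ne (h.ball_subset hc hn)
  have hvol := h.le_volume_rpow hc hn
  set K := l2norm (domain z r) (cgrad u) with hK
  set U := √(∫ x in domain z r, u x ^ 2) with hU
  set P := poincareConst (domain z r) with hPdef
  have hK0 : 0 ≤ K := Real.sqrt_nonneg _
  rcases hK0.eq_or_lt with hK1 | hK1
  · rw [← hK1]; simp
  -- Vanishing data would force K = 0. Positivity is needed below, where a product with an infinite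
  -- factor has to be infinite.
  have hMg1 : 0 < Mg := by
    rcases hMg.eq_or_lt with h0 | h0
    · rw [← h0, zero_mul] at hE
      have : 0 < K ^ 2 := by positivity
      linarith
    · exact h0
  have hn0 : (0 : ℝ) < n := by exact_mod_cast hn
  have hnE : ((n : ℝ≥0∞)) ^ (1 / 2 : ℝ) = ENNReal.ofReal (√n) := by
    rw [Real.sqrt_eq_rpow, ← ENNReal.ofReal_rpow_of_pos hn0, ENNReal.ofReal_natCast]
  have hrE : ENNReal.ofReal (r 0 ^ (1 / 2 : ℝ)) = ENNReal.ofReal (√(r 0)) := by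
    rw [Real.sqrt_eq_rpow]
  have hdE : ENNReal.ofReal (d ^ (-(1 / 2) : ℝ)) = ENNReal.ofReal (√d)⁻¹ := by
    rw [Real.rpow_neg hd.le, Real.sqrt_eq_rpow]
  -- Only part of B is used: |E|^(1/2) is replaced by d, and the summand 1 is dropped.
  have hB : ENNReal.ofReal d * P * (ENNReal.ofReal (√d)⁻¹ * P) * ENNReal.ofReal (√n) *
      ENNReal.ofReal (√(r 0)) ≤ constB d z r := by
    rw [constB, hnE, hrE, hdE]
    gcongr
    exact le_self_add
  refine le_trans ?_ (mul_le_mul_left (mul_le_mul_right hB _) _)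
  have hsd : 0 < √d := Real.sqrt_pos.2 hd
  have hsn : 0 < √(n : ℝ) := Real.sqrt_pos.2 hn0
  have hsr : 0 < √(r 0) := Real.sqrt_pos.2 hr0
  have hC : 0 < 32 * (1 + 1 / κ) / κ := by positivity
  -- If the Poincaré inequality fails, B is infinite and there is nothing to prove.
  by_cases hPt : P = ⊤
  · have e1 : ∀ x : ℝ, 0 < x → ENNReal.ofReal x ≠ 0 := fun x hx => (ENNReal.ofReal_pos.2 hx).ne'
    rw [hPt, ENNReal.mul_top (e1 _ hd), ENNReal.mul_top (e1 _ (by positivity)), ENNReal.top_mul_top,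
      ENNReal.top_mul (e1 _ hsn), ENNReal.top_mul (e1 _ hsr), ENNReal.mul_top (e1 _ hC),
      ENNReal.top_mul (e1 _ hMg1)]
    exact le_top
  set p := P.toReal with hp
  have hPp : P = ENNReal.ofReal p := (ENNReal.ofReal_toReal hPt).symm
  have hp0 : 0 ≤ p := ENNReal.toReal_nonneg
  have hκp : κ * d ≤ p := by
    rw [hPp] at hlow
    exact (ENNReal.ofReal_le_ofReal_iff hp0).1 hlow
  have hKE : eLpNorm (fderiv ℝ u) 2 (volume.restrict (domain z r)) = ENNReal.ofReal K := by
    rw [eLpNorm_two_eq hu.memLp_deriv, hK, l2norm]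
    simp only [norm_cgrad]
  have hUE : eLpNorm u 2 (volume.restrict (domain z r)) = ENNReal.ofReal U := by
    rw [eLpNorm_two_eq hu.memLp, hU]
    simp only [Real.norm_eq_abs, sq_abs]
  have hUp : U ≤ p * K := by
    have h1 := eLpNorm_le_poincareConst hu.memLp hu.memLp_deriv
      (hasWeakDerivOn_of_contDiffOn hopen fun x hx =>
        ((contDiffAt_of_harmonic hopen hu.harmonic hx).of_le (by simp)).contDiffWithinAt) hu0
      (by rw [hKE]; exact (ENNReal.ofReal_pos.2 hK1).ne')
    rw [hKE, hUE, ← hPdef, hPp, ← ENNReal.ofReal_mul hp0] at h1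
    exact (ENNReal.ofReal_le_ofReal_iff (by positivity)).1 h1
  -- The lower bound for the Poincaré constant absorbs both the gradient term d K of the trace
  -- inequality and a further factor d, so that only C_P² remains.
  have hdp : d ≤ p / κ := by rw [le_div_iff₀ hκ]; linarith
  have hKle : K ≤ Mg * (32 / d * √(n * d * r 0) * (p + d)) := by
    have h1 : K * K ≤ Mg * (32 / d * √(n * d * r 0) * (p + d)) * K := by
      calc K * K = K ^ 2 := by ring
        _ ≤ _ := hE
        _ ≤ Mg * (32 / d * √(n * d * r 0) * (p * K + d * K)) := by gcongr
        _ = _ := by ring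
    exact le_of_mul_le_mul_right h1 hK1
  rw [Real.sqrt_mul (by positivity), Real.sqrt_mul hn0.le] at hKle
  rw [hPp]
  simp only [← ENNReal.ofReal_mul hd.le, ← ENNReal.ofReal_mul (inv_nonneg.2 hsd.le)]
  rw [← ENNReal.ofReal_mul (by positivity), ← ENNReal.ofReal_mul (by positivity),
    ← ENNReal.ofReal_mul (by positivity), ← ENNReal.ofReal_mul (by positivity),
    ← ENNReal.ofReal_mul (by positivity)]
  refine ENNReal.ofReal_le_ofReal ?_
  have hds : √d * √d = d := Real.mul_self_sqrt hd.le
  calc d ^ 2 * K ≤ d ^ 2 * (Mg * (32 / d * (√n * √d * √(r 0)) * (p + d))) := by gcongr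
    _ = 32 * Mg * (√n * √d * √(r 0)) * (d * (p + d)) := by field_simp
    _ ≤ 32 * Mg * (√n * √d * √(r 0)) * (p / κ * (p + p / κ)) := by gcongr
    _ = 32 * (1 + 1 / κ) / κ * ((√d * √d) * p * ((√d)⁻¹ * p) * √n * √(r 0)) * Mg := by
        field_simp
    _ = _ := by rw [hds]

end EnergyConst

/-! ### Collecting the constants. -/

section Constants

variable {c α d R K Mg Hg Mg' Hg' : ℝ}

/-- Every coefficient below has the form 1/(c^m x) with m ≤ 4 and x one of 1, α, α(1 − α); a single
quantity dominates them all. -/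
lemma one_div_mul_le (hc : 0 < c) (hc1 : c ≤ 1) (hα₀ : 0 < α) (hα : α < 1) {m : ℕ} (hm : m ≤ 4)
    {x : ℝ} (hx : α * (1 - α) ≤ x) : 1 / (c ^ m * x) ≤ 1 / (c ^ 4 * (α * (1 - α))) := by
  have hα' : 0 < 1 - α := by linarith
  have h1 : c ^ 4 ≤ c ^ m := pow_le_pow_of_le_one hc.le hc1 hm
  exact one_div_le_one_div_of_le (by positivity) (mul_le_mul h1 hx (by positivity) (by positivity))

/-- The constant in the estimates, up to the factor that comes from the energy estimate. -/
noncomputable def schauderConst (c α : ℝ) : ℝ := 6144 * (1 / (c ^ 4 * (α * (1 - α))))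

lemma rpow_facts (hα : α < 1) (hd : 0 < d) (hdR : d ≤ R) :
    d ^ (-α) = (d ^ α)⁻¹ ∧ d ^ (1 - α) = d / d ^ α ∧ d ^ (α - 1) = d ^ α / d ∧
      R ^ (2 - α) = R ^ 2 / R ^ α ∧ d ^ (-1 - α) = d⁻¹ * (d ^ α)⁻¹ ∧ d / d ^ α ≤ R / R ^ α := by
  have hR : 0 < R := hd.trans_le hdR
  refine ⟨Real.rpow_neg hd.le α, ?_, ?_, ?_, ?_, ?_⟩
  · rw [Real.rpow_sub hd, Real.rpow_one]
  · rw [Real.rpow_sub hd, Real.rpow_one]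
  · rw [Real.rpow_sub hR]; norm_num
  · rw [Real.rpow_sub hd, Real.rpow_neg_one]; rfl
  · have := Real.rpow_le_rpow hd.le hdR (by linarith : 0 ≤ 1 - α)
    rwa [Real.rpow_sub hd, Real.rpow_sub hR, Real.rpow_one, Real.rpow_one] at this

lemma rpow_neg_ofNat (hd : 0 < d) (m : ℕ) [m.AtLeastTwo] :
    d ^ (-(OfNat.ofNat m : ℝ)) = (d ^ m)⁻¹ := by
  rw [Real.rpow_neg hd.le]
  congr 1
  exact Real.rpow_ofNat d m

/-- The energy enters as d² K, the quantity bounded by B, which accounts for the power d^(−4). The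
surplus powers of d are traded for powers of R by d ≤ R; the next three lemmas proceed in the same
way. -/
lemma sup_gradient_le (hc : 0 < c) (hc1 : c ≤ 1) (hα₀ : 0 < α) (hα : α < 1) (hd : 0 < d) (hdR : d ≤ R)
    (hK : 0 ≤ K) (hMg : 0 ≤ Mg) (hHg : 0 ≤ Hg) :
    4 * K / d + 16 * R * K / (c ^ 2 * d ^ 3) * d +
        4 / (1 - α) * (2 * Hg + 4 / c * Mg * d ^ (-α)) * d ^ α / α ≤
      schauderConst c α * (1 * Mg + d ^ (-4 : ℝ) * R * (d ^ 2 * K) + R ^ α * Hg) := by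
  obtain ⟨e1, e2, e3, e4, e5, e6⟩ := rpow_facts hα hd hdR
  have hR : 0 < R := hd.trans_le hdR
  have haA : d ^ α ≤ R ^ α := Real.rpow_le_rpow hd.le hdR hα₀.le
  have ha : 0 < d ^ α := Real.rpow_pos_of_pos hd α
  have hA : 0 < R ^ α := Real.rpow_pos_of_pos hR α
  have hα' : 0 < 1 - α := by linarith
  have hαα : 0 < α * (1 - α) := by positivity
  have hα1 : α * (1 - α) ≤ 1 := by nlinarith
  have hα2 : α * (1 - α) ≤ α := by nlinarith
  have hα3 : α * (1 - α) ≤ 1 - α := by nlinarith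
  have q1 := one_div_mul_le hc hc1 hα₀ hα (m := 0) (by norm_num) hα1
  have q2 := one_div_mul_le hc hc1 hα₀ hα (m := 2) (by norm_num) hα1
  have q3 := one_div_mul_le hc hc1 hα₀ hα (m := 0) (by norm_num) le_rfl
  have q4 := one_div_mul_le hc hc1 hα₀ hα (m := 1) (by norm_num) le_rfl
  rw [schauderConst, rpow_neg_ofNat hd 4, e1]
  set Q := 1 / (c ^ 4 * (α * (1 - α))) with hQ
  have hQ0 : 0 < Q := by positivity
  -- The real powers become independent variables, so that the rest is an identity of rational
  -- functions.
  generalize d ^ α = a at *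
  generalize R ^ α = A at *
  have hT : K / d ≤ R * K / d ^ 2 := by
    rw [div_le_div_iff₀ hd (by positivity)]
    have : 0 ≤ K * d * (R - d) := mul_nonneg (by positivity) (by linarith)
    linarith
  have hT0 : 0 ≤ R * K / d ^ 2 := by positivity
  calc _ = 4 * (1 / (c ^ 0 * 1)) * (K / d) + 16 * (1 / (c ^ 2 * 1)) * (R * K / d ^ 2) +
        8 * (1 / (c ^ 0 * (α * (1 - α)))) * (a * Hg) +
        16 * (1 / (c ^ 1 * (α * (1 - α)))) * Mg := by field_simp; ring
    _ ≤ 4 * Q * (R * K / d ^ 2) + 16 * Q * (R * K / d ^ 2) + 8 * Q * (A * Hg) + 16 * Q * Mg := by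
        gcongr
    _ ≤ 6144 * Q * (Mg + R * K / d ^ 2 + A * Hg) := by
        have h1 : 0 ≤ Q * (R * K / d ^ 2) := by positivity
        have h2 : 0 ≤ Q * (A * Hg) := by positivity
        have h3 : 0 ≤ Q * Mg := by positivity
        linarith
    _ = _ := by field_simp

lemma holder_gradient_le (hc : 0 < c) (hc1 : c ≤ 1) (hα₀ : 0 < α) (hα : α < 1) (hd : 0 < d) (hdR : d ≤ R)
    (hK : 0 ≤ K) (hMg : 0 ≤ Mg) (hHg : 0 ≤ Hg) :
    32 / (c * α) * (16 * R * K / (c ^ 2 * d ^ 3) * d ^ (1 - α) +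
        4 / (1 - α) * (2 * Hg + 4 / c * Mg * d ^ (-α)) + 4 * K / d * d ^ (-α)) ≤
      schauderConst c α * (d ^ (-α) * Mg + d ^ (-5 : ℝ) * R ^ (2 - α) * (d ^ 2 * K) + Hg) := by
  obtain ⟨e1, e2, e3, e4, e5, e6⟩ := rpow_facts hα hd hdR
  have hR : 0 < R := hd.trans_le hdR
  have haA : d ^ α ≤ R ^ α := Real.rpow_le_rpow hd.le hdR hα₀.le
  have ha : 0 < d ^ α := Real.rpow_pos_of_pos hd α
  have hA : 0 < R ^ α := Real.rpow_pos_of_pos hR α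
  have hα' : 0 < 1 - α := by linarith
  have hαα : 0 < α * (1 - α) := by positivity
  have hα1 : α * (1 - α) ≤ 1 := by nlinarith
  have hα2 : α * (1 - α) ≤ α := by nlinarith
  have hα3 : α * (1 - α) ≤ 1 - α := by nlinarith
  have q1 := one_div_mul_le hc hc1 hα₀ hα (m := 1) (by norm_num) hα2
  have q2 := one_div_mul_le hc hc1 hα₀ hα (m := 3) (by norm_num) hα2
  have q3 := one_div_mul_le hc hc1 hα₀ hα (m := 1) (by norm_num) le_rfl
  have q4 := one_div_mul_le hc hc1 hα₀ hα (m := 2) (by norm_num) le_rfl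
  rw [schauderConst, rpow_neg_ofNat hd 5, e1, e2, e4]
  set Q := 1 / (c ^ 4 * (α * (1 - α))) with hQ
  have hQ0 : 0 < Q := by positivity
  generalize d ^ α = a at *
  generalize R ^ α = A at *
  -- This is d^(1−α) ≤ R^(1−α).
  have hT1 : R * (d / a) * K / d ^ 3 ≤ R ^ 2 / A * K / d ^ 3 := by
    rw [show R ^ 2 / A = R * (R / A) by ring]; gcongr
  have hT2 : d * (d / a) * K / d ^ 3 ≤ R ^ 2 / A * K / d ^ 3 := by
    rw [show R ^ 2 / A = R * (R / A) by ring]; gcongr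
  have hT0 : 0 ≤ R ^ 2 / A * K / d ^ 3 := by positivity
  calc _ = 512 * (1 / (c ^ 3 * α)) * (R * (d / a) * K / d ^ 3) +
        256 * (1 / (c ^ 1 * (α * (1 - α)))) * Hg +
        512 * (1 / (c ^ 2 * (α * (1 - α)))) * (a⁻¹ * Mg) +
        128 * (1 / (c ^ 1 * α)) * (d * (d / a) * K / d ^ 3) := by field_simp; ring
    _ ≤ 512 * Q * (R ^ 2 / A * K / d ^ 3) + 256 * Q * Hg + 512 * Q * (a⁻¹ * Mg) +
        128 * Q * (R ^ 2 / A * K / d ^ 3) := by gcongr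
    _ ≤ 6144 * Q * (a⁻¹ * Mg + R ^ 2 / A * K / d ^ 3 + Hg) := by
        have h1 : 0 ≤ Q * (R ^ 2 / A * K / d ^ 3) := by positivity
        have h2 : 0 ≤ Q * Hg := by positivity
        have h3 : 0 ≤ Q * (a⁻¹ * Mg) := by positivity
        linarith
    _ = _ := by field_simp

lemma sup_hessian_le (hc : 0 < c) (hc1 : c ≤ 1) (hα₀ : 0 < α) (hα : α < 1) (hd : 0 < d) (hdR : d ≤ R)
    (hK : 0 ≤ K) (hMg : 0 ≤ Mg) (hHg : 0 ≤ Hg) (hMg' : 0 ≤ Mg') (hHg' : 0 ≤ Hg') :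
    64 * K / d ^ 2 + 128 * R * K / (c ^ 3 * d ^ 4) * d +
        4 / (1 - α) * (2 * Hg' + 2 * Hg / (c * d) + 8 / c * (Mg' + Mg / (c * d)) * d ^ (-α)) *
          d ^ α / α ≤
      schauderConst c α * (d ^ (-1 : ℝ) * Mg + d ^ (-5 : ℝ) * R * (d ^ 2 * K) +
        (d ^ (α - 1) * Hg + Mg' + R ^ α * Hg')) := by
  obtain ⟨e1, e2, e3, e4, e5, e6⟩ := rpow_facts hα hd hdR
  have hR : 0 < R := hd.trans_le hdR
  have haA : d ^ α ≤ R ^ α := Real.rpow_le_rpow hd.le hdR hα₀.le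
  have ha : 0 < d ^ α := Real.rpow_pos_of_pos hd α
  have hA : 0 < R ^ α := Real.rpow_pos_of_pos hR α
  have hα' : 0 < 1 - α := by linarith
  have hαα : 0 < α * (1 - α) := by positivity
  have hα1 : α * (1 - α) ≤ 1 := by nlinarith
  have hα2 : α * (1 - α) ≤ α := by nlinarith
  have hα3 : α * (1 - α) ≤ 1 - α := by nlinarith
  have q1 := one_div_mul_le hc hc1 hα₀ hα (m := 0) (by norm_num) hα1
  have q2 := one_div_mul_le hc hc1 hα₀ hα (m := 3) (by norm_num) hα1
  have q3 := one_div_mul_le hc hc1 hα₀ hα (m := 0) (by norm_num) le_rfl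
  have q4 := one_div_mul_le hc hc1 hα₀ hα (m := 1) (by norm_num) le_rfl
  have q5 := one_div_mul_le hc hc1 hα₀ hα (m := 2) (by norm_num) le_rfl
  rw [schauderConst, rpow_neg_ofNat hd 5, Real.rpow_neg_one, e1, e3]
  set Q := 1 / (c ^ 4 * (α * (1 - α))) with hQ
  have hQ0 : 0 < Q := by positivity
  generalize d ^ α = a at *
  generalize R ^ α = A at *
  have hT : K / d ^ 2 ≤ R * K / d ^ 3 := by
    rw [div_le_div_iff₀ (by positivity) (by positivity)]
    have : 0 ≤ K * d ^ 2 * (R - d) := mul_nonneg (by positivity) (by linarith)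
    linarith
  have hT0 : 0 ≤ R * K / d ^ 3 := by positivity
  calc _ = 64 * (1 / (c ^ 0 * 1)) * (K / d ^ 2) + 128 * (1 / (c ^ 3 * 1)) * (R * K / d ^ 3) +
        8 * (1 / (c ^ 0 * (α * (1 - α)))) * (a * Hg') +
        8 * (1 / (c ^ 1 * (α * (1 - α)))) * (a / d * Hg) +
        32 * (1 / (c ^ 1 * (α * (1 - α)))) * Mg' +
        32 * (1 / (c ^ 2 * (α * (1 - α)))) * (d⁻¹ * Mg) := by field_simp; ring
    _ ≤ 64 * Q * (R * K / d ^ 3) + 128 * Q * (R * K / d ^ 3) + 8 * Q * (A * Hg') +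
        8 * Q * (a / d * Hg) + 32 * Q * Mg' + 32 * Q * (d⁻¹ * Mg) := by gcongr
    _ ≤ 6144 * Q * (d⁻¹ * Mg + R * K / d ^ 3 + (a / d * Hg + Mg' + A * Hg')) := by
        have h1 : 0 ≤ Q * (R * K / d ^ 3) := by positivity
        have h2 : 0 ≤ Q * (A * Hg') := by positivity
        have h3 : 0 ≤ Q * (a / d * Hg) := by positivity
        have h4 : 0 ≤ Q * Mg' := by positivity
        have h5 : 0 ≤ Q * (d⁻¹ * Mg) := by positivity
        linarith
    _ = _ := by field_simp

lemma holder_hessian_le (hc : 0 < c) (hc1 : c ≤ 1) (hα₀ : 0 < α) (hα : α < 1) (hd : 0 < d) (hdR : d ≤ R)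
    (hK : 0 ≤ K) (hMg : 0 ≤ Mg) (hHg : 0 ≤ Hg) (hMg' : 0 ≤ Mg') (hHg' : 0 ≤ Hg') :
    32 / (c * α) * (128 * R * K / (c ^ 3 * d ^ 4) * d ^ (1 - α) +
        4 / (1 - α) * (2 * Hg' + 2 * Hg / (c * d) + 8 / c * (Mg' + Mg / (c * d)) * d ^ (-α)) +
        64 * K / d ^ 2 * d ^ (-α)) ≤
      schauderConst c α * (d ^ (-1 - α) * Mg + d ^ (-6 : ℝ) * R ^ (2 - α) * (d ^ 2 * K) +
        (d ^ (-1 : ℝ) * Hg + d ^ (-α) * Mg' + Hg')) := by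
  obtain ⟨e1, e2, e3, e4, e5, e6⟩ := rpow_facts hα hd hdR
  have hR : 0 < R := hd.trans_le hdR
  have haA : d ^ α ≤ R ^ α := Real.rpow_le_rpow hd.le hdR hα₀.le
  have ha : 0 < d ^ α := Real.rpow_pos_of_pos hd α
  have hA : 0 < R ^ α := Real.rpow_pos_of_pos hR α
  have hα' : 0 < 1 - α := by linarith
  have hαα : 0 < α * (1 - α) := by positivity
  have hα1 : α * (1 - α) ≤ 1 := by nlinarith
  have hα2 : α * (1 - α) ≤ α := by nlinarith
  have hα3 : α * (1 - α) ≤ 1 - α := by nlinarith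
  have q1 := one_div_mul_le hc hc1 hα₀ hα (m := 1) (by norm_num) hα2
  have q2 := one_div_mul_le hc hc1 hα₀ hα (m := 4) (by norm_num) hα2
  have q3 := one_div_mul_le hc hc1 hα₀ hα (m := 1) (by norm_num) le_rfl
  have q4 := one_div_mul_le hc hc1 hα₀ hα (m := 2) (by norm_num) le_rfl
  have q5 := one_div_mul_le hc hc1 hα₀ hα (m := 3) (by norm_num) le_rfl
  rw [schauderConst, rpow_neg_ofNat hd 6, Real.rpow_neg_one, e1, e2, e4, e5]
  set Q := 1 / (c ^ 4 * (α * (1 - α))) with hQ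
  have hQ0 : 0 < Q := by positivity
  generalize d ^ α = a at *
  generalize R ^ α = A at *
  have hT1 : R * (d / a) * K / d ^ 4 ≤ R ^ 2 / A * K / d ^ 4 := by
    rw [show R ^ 2 / A = R * (R / A) by ring]; gcongr
  have hT2 : d * (d / a) * K / d ^ 4 ≤ R ^ 2 / A * K / d ^ 4 := by
    rw [show R ^ 2 / A = R * (R / A) by ring]; gcongr
  have hT0 : 0 ≤ R ^ 2 / A * K / d ^ 4 := by positivity
  calc _ = 4096 * (1 / (c ^ 4 * α)) * (R * (d / a) * K / d ^ 4) +
        256 * (1 / (c ^ 1 * (α * (1 - α)))) * Hg' +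
        256 * (1 / (c ^ 2 * (α * (1 - α)))) * (d⁻¹ * Hg) +
        1024 * (1 / (c ^ 2 * (α * (1 - α)))) * (a⁻¹ * Mg') +
        1024 * (1 / (c ^ 3 * (α * (1 - α)))) * (d⁻¹ * a⁻¹ * Mg) +
        2048 * (1 / (c ^ 1 * α)) * (d * (d / a) * K / d ^ 4) := by field_simp; ring
    _ ≤ 4096 * Q * (R ^ 2 / A * K / d ^ 4) + 256 * Q * Hg' + 256 * Q * (d⁻¹ * Hg) +
        1024 * Q * (a⁻¹ * Mg') + 1024 * Q * (d⁻¹ * a⁻¹ * Mg) +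
        2048 * Q * (R ^ 2 / A * K / d ^ 4) := by gcongr
    -- The sum 4096 + 2048 is the largest coefficient in the four estimates and determines the
    -- number in `schauderConst`.
    _ ≤ 6144 * Q * (d⁻¹ * a⁻¹ * Mg + R ^ 2 / A * K / d ^ 4 + (d⁻¹ * Hg + a⁻¹ * Mg' + Hg')) := by
        have h1 : 0 ≤ Q * (R ^ 2 / A * K / d ^ 4) := by positivity
        have h2 : 0 ≤ Q * Hg' := by positivity
        have h3 : 0 ≤ Q * (d⁻¹ * Hg) := by positivity
        have h4 : 0 ≤ Q * (a⁻¹ * Mg') := by positivity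
        have h5 : 0 ≤ Q * (d⁻¹ * a⁻¹ * Mg) := by positivity
        linarith
    _ = _ := by field_simp

end Constants

/-- The real estimate in terms of D = d² K is combined with the energy bound in [0, ∞], where B may
be infinite. The factor S (1 + C₀) dominates both S and S C₀. -/
lemma le_of_le_ofReal {X B : ℝ≥0∞} {C₀ S Mg p q w D : ℝ} (hC₀ : 0 ≤ C₀) (hS : 0 ≤ S)
    (hMg : 0 ≤ Mg) (hp : 0 ≤ p) (hq : 0 ≤ q) (hw : 0 ≤ w) (hD₀ : 0 ≤ D)
    (hX : X ≤ ENNReal.ofReal (S * (p * Mg + q * D + w)))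
    (hD : ENNReal.ofReal D ≤ ENNReal.ofReal C₀ * B * ENNReal.ofReal Mg) :
    X ≤ ENNReal.ofReal (S * (1 + C₀)) * (ENNReal.ofReal p + B * ENNReal.ofReal q) *
        ENNReal.ofReal Mg + ENNReal.ofReal (S * (1 + C₀)) * ENNReal.ofReal w := by
  have h1 : ENNReal.ofReal S ≤ ENNReal.ofReal (S * (1 + C₀)) :=
    ENNReal.ofReal_le_ofReal (by nlinarith [mul_nonneg hS hC₀])
  have h2 : ENNReal.ofReal S * ENNReal.ofReal C₀ ≤ ENNReal.ofReal (S * (1 + C₀)) := by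
    rw [← ENNReal.ofReal_mul hS]
    exact ENNReal.ofReal_le_ofReal (by nlinarith)
  calc X ≤ ENNReal.ofReal S * (ENNReal.ofReal p * ENNReal.ofReal Mg +
        ENNReal.ofReal q * ENNReal.ofReal D + ENNReal.ofReal w) := by
        refine hX.trans_eq ?_
        rw [ENNReal.ofReal_mul hS, ENNReal.ofReal_add (by positivity) hw,
          ENNReal.ofReal_add (by positivity) (by positivity), ENNReal.ofReal_mul hp,
          ENNReal.ofReal_mul hq]
    _ ≤ ENNReal.ofReal S * (ENNReal.ofReal p * ENNReal.ofReal Mg +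
        ENNReal.ofReal q * (ENNReal.ofReal C₀ * B * ENNReal.ofReal Mg) + ENNReal.ofReal w) := by
        gcongr
    _ = ENNReal.ofReal S * ENNReal.ofReal p * ENNReal.ofReal Mg +
        ENNReal.ofReal S * ENNReal.ofReal C₀ * (B * ENNReal.ofReal q) * ENNReal.ofReal Mg +
        ENNReal.ofReal S * ENNReal.ofReal w := by ring
    _ ≤ ENNReal.ofReal (S * (1 + C₀)) * ENNReal.ofReal p * ENNReal.ofReal Mg +
        ENNReal.ofReal (S * (1 + C₀)) * (B * ENNReal.ofReal q) * ENNReal.ofReal Mg +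
        ENNReal.ofReal (S * (1 + C₀)) * ENNReal.ofReal w := by gcongr
    _ = _ := by ring

/-- The estimates in terms of the energy. -/
lemma IsNeumannSolution.schauder_estimates {n : ℕ} {z : Fin (n + 1) → ℂ} {r : Fin (n + 1) → ℝ}
    {c d : ℝ} {g u : ℂ → ℝ} (h : Admissible c d z r) (hc : 0 < c) (hc1 : c ≤ 1) (hn : 1 ≤ n)
    (hu : IsNeumannSolution z r g u) {α : ℝ≥0} (hα₀ : (0 : ℝ) < α) (hα : (α : ℝ) < 1)
    {Mg Hg Mg' Hg' : ℝ} (hg : DataBound z r g α Mg Hg Mg' Hg') {K : ℝ}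
    (hK : K = l2norm (domain z r) (cgrad u)) :
    supNorm (domain z r) (fderiv ℝ u) ≤ ENNReal.ofReal (schauderConst c α *
      (1 * Mg + d ^ (-4 : ℝ) * r 0 * (d ^ 2 * K) + r 0 ^ (α : ℝ) * Hg)) ∧
    holderSeminorm α (domain z r) (fderiv ℝ u) ≤ ENNReal.ofReal (schauderConst c α *
      (d ^ (-α : ℝ) * Mg + d ^ (-5 : ℝ) * r 0 ^ (2 - α : ℝ) * (d ^ 2 * K) + Hg)) ∧
    supNorm (domain z r) (fderiv ℝ (fderiv ℝ u)) ≤ ENNReal.ofReal (schauderConst c α *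
      (d ^ (-1 : ℝ) * Mg + d ^ (-5 : ℝ) * r 0 * (d ^ 2 * K) +
        (d ^ (α - 1 : ℝ) * Hg + Mg' + r 0 ^ (α : ℝ) * Hg'))) ∧
    holderSeminorm α (domain z r) (fderiv ℝ (fderiv ℝ u)) ≤ ENNReal.ofReal (schauderConst c α *
      (d ^ (-1 - α : ℝ) * Mg + d ^ (-6 : ℝ) * r 0 ^ (2 - α : ℝ) * (d ^ 2 * K) +
        (d ^ (-1 : ℝ) * Hg + d ^ (-α : ℝ) * Mg' + Hg'))) := by
  have hd := h.d_pos
  have hr0 := h.radius_pos hc hn 0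
  have hdr : d ≤ r 0 := by linarith [h.radius_zero_ge hc hn]
  have hK₀ : 0 ≤ K := by rw [hK]; exact Real.sqrt_nonneg _
  have hB₁ := hu.derivBound_cgrad h hc hc1 hn hα₀ hα hg
  have hB₂ := hu.derivBound_deriv_cgrad h hc hc1 hn hα₀ hα hg
  rw [← hK] at hB₁ hB₂
  have hMg := hg.sup_nonneg
  have hHg := hg.holder_nonneg
  have hMg' := hg.deriv_sup_nonneg
  have hHg' := hg.deriv_holder_nonneg
  have hα' : 0 < 1 - (α : ℝ) := by linarith
  have hS₀ : 0 ≤ schauderConst c α := by unfold schauderConst; positivity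
  refine ⟨supNorm_le fun x hx => ?_, holderSeminorm_le (by positivity) fun x hx y hy => ?_,
    supNorm_le fun x hx => ?_, holderSeminorm_le (by positivity) fun x hx y hy => ?_⟩
  · rw [← norm_cgrad]
    exact (hB₁.sup_le h hc hc1 hn hα₀ hα hx).trans
      (sup_gradient_le hc hc1 hα₀ hα hd hdr hK₀ hMg hHg)
  · rw [norm_fderiv_sub]
    exact (hB₁.holder_le h hc hc1 hn hα₀ hα (by positivity) hx hy).trans
      (mul_le_mul_of_nonneg_right (holder_gradient_le hc hc1 hα₀ hα hd hdr hK₀ hMg hHg)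
        (by positivity))
  · exact (norm_fderiv_fderiv_le hu.harmonic hx).trans ((hB₂.sup_le h hc hc1 hn hα₀ hα hx).trans
      (sup_hessian_le hc hc1 hα₀ hα hd hdr hK₀ hMg hHg hMg' hHg'))
  · exact (norm_fderiv_fderiv_sub_le hu.harmonic hx hy).trans
      ((hB₂.holder_le h hc hc1 hn hα₀ hα (by positivity) hx hy).trans
      (mul_le_mul_of_nonneg_right (holder_hessian_le hc hc1 hα₀ hα hd hdr hK₀ hMg hHg hMg' hHg')
        (by positivity)))

end PerforatedDisk

/-! ### The four estimates with the constant B. -/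

theorem mainTheorem5 (α : ℝ≥0) (hα₀ : 0 < α) (hα₁ : α < 1) (c : ℝ) (hc : 0 < c) :
    ∃ C : ℝ≥0, ∀ (n : ℕ) (_ : 1 ≤ n) (z : Fin (n + 1) → ℂ) (r : Fin (n + 1) → ℝ) (d : ℝ)
      (_ : PerforatedDisk.Admissible c d z r) (g u : ℂ → ℝ)
      (_ : PerforatedDisk.IsC1Holder α z r g)
      (_ : PerforatedDisk.IsNeumannSolution z r g u)
      (_ : ∫ x in PerforatedDisk.domain z r, u x = 0),
      (PerforatedDisk.supNorm (PerforatedDisk.domain z r) (fderiv ℝ u) < ⊤ ∧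
        PerforatedDisk.holderSeminorm α (PerforatedDisk.domain z r) (fderiv ℝ u) < ⊤ ∧
        PerforatedDisk.supNorm (PerforatedDisk.domain z r) (fderiv ℝ (fderiv ℝ u)) < ⊤ ∧
        PerforatedDisk.holderSeminorm α (PerforatedDisk.domain z r)
          (fderiv ℝ (fderiv ℝ u)) < ⊤) ∧
      PerforatedDisk.supNorm (PerforatedDisk.domain z r) (fderiv ℝ u) ≤
        C * (1 + PerforatedDisk.constB d z r * ENNReal.ofReal (d ^ (-4 : ℝ) * r 0)) *
            PerforatedDisk.bdrySup z r g +
          C * ENNReal.ofReal (r 0 ^ (α : ℝ)) * PerforatedDisk.bdryHolder α z r g ∧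
      PerforatedDisk.holderSeminorm α (PerforatedDisk.domain z r) (fderiv ℝ u) ≤
        C * (ENNReal.ofReal (d ^ (-α : ℝ)) + PerforatedDisk.constB d z r *
              ENNReal.ofReal (d ^ (-5 : ℝ) * r 0 ^ (2 - α : ℝ))) *
            PerforatedDisk.bdrySup z r g +
          C * PerforatedDisk.bdryHolder α z r g ∧
      PerforatedDisk.supNorm (PerforatedDisk.domain z r) (fderiv ℝ (fderiv ℝ u)) ≤
        C * (ENNReal.ofReal (d ^ (-1 : ℝ)) + PerforatedDisk.constB d z r *
              ENNReal.ofReal (d ^ (-5 : ℝ) * r 0)) *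
            PerforatedDisk.bdrySup z r g +
          C * ENNReal.ofReal (d ^ (α - 1 : ℝ)) * PerforatedDisk.bdryHolder α z r g +
          C * PerforatedDisk.bdryDerivSup z r g +
          C * ENNReal.ofReal (r 0 ^ (α : ℝ)) * PerforatedDisk.bdryDerivHolder α z r g ∧
      PerforatedDisk.holderSeminorm α (PerforatedDisk.domain z r) (fderiv ℝ (fderiv ℝ u)) ≤
        C * (ENNReal.ofReal (d ^ (-1 - α : ℝ)) + PerforatedDisk.constB d z r *
              ENNReal.ofReal (d ^ (-6 : ℝ) * r 0 ^ (2 - α : ℝ))) *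
            PerforatedDisk.bdrySup z r g +
          C * ENNReal.ofReal (d ^ (-1 : ℝ)) * PerforatedDisk.bdryHolder α z r g +
          C * ENNReal.ofReal (d ^ (-α : ℝ)) * PerforatedDisk.bdryDerivSup z r g +
          C * PerforatedDisk.bdryDerivHolder α z r g := by
  obtain ⟨C₀, hC₀, hEn⟩ := PerforatedDisk.exists_energy_bound
  have hα₀' : (0 : ℝ) < α := hα₀
  have hα₁' : (α : ℝ) < 1 := hα₁
  -- The geometric assumption gets weaker as c decreases, so c may be replaced by min c 1, and the
  -- estimates for c ≤ 1 apply.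
  obtain ⟨e, he⟩ : ∃ e, e = min c 1 := ⟨_, rfl⟩
  have he₀ : 0 < e := by rw [he]; exact lt_min hc one_pos
  have he₁ : e ≤ 1 := by rw [he]; exact min_le_right _ _
  have hα' : 0 < 1 - (α : ℝ) := by linarith
  have hS₀ : 0 ≤ PerforatedDisk.schauderConst e α := by
    unfold PerforatedDisk.schauderConst; positivity
  refine ⟨(PerforatedDisk.schauderConst e α * (1 + C₀)).toNNReal,
    fun n hn z r d hA g u hg hu hu0 => ?_⟩
  have h : PerforatedDisk.Admissible e d z r := hA.mono (by rw [he]; exact min_le_left _ _)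
  have hd := h.d_pos
  have hr := h.radius_pos he₀ hn
  have hr0 := hr 0
  have hdata := hg.dataBound hr hα₁
  have hMg := hdata.sup_nonneg
  have hHg := hdata.holder_nonneg
  have hMg' := hdata.deriv_sup_nonneg
  have hHg' := hdata.deriv_holder_nonneg
  obtain ⟨K, hK⟩ : ∃ K, K = PerforatedDisk.l2norm (PerforatedDisk.domain z r)
    (PerforatedDisk.cgrad u) := ⟨_, rfl⟩
  have hK₀ : 0 ≤ K := by rw [hK]; exact Real.sqrt_nonneg _
  have hD := hEn n hn z r e d he₀ he₁ h g u hu hu0 α _ _ _ _ hα₀' hα₁' hdata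
  rw [← hK] at hD
  obtain ⟨b₁, b₂, b₃, b₄⟩ := hu.schauder_estimates h he₀ he₁ hn hα₀' hα₁' hdata hK
  -- All norms of the data are finite and can be treated as real numbers; B stays in [0, ∞].
  rw [← ENNReal.ofReal_toReal hg.bdrySup_ne_top,
    ← ENNReal.ofReal_toReal (hg.bdryHolder_ne_top hr hα₁),
    ← ENNReal.ofReal_toReal hg.bdryDerivSup_ne_top, ← ENNReal.ofReal_toReal hg.2]
  generalize (PerforatedDisk.bdrySup z r g).toReal = Mg at *
  generalize (PerforatedDisk.bdryHolder α z r g).toReal = Hg at *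
  generalize (PerforatedDisk.bdryDerivSup z r g).toReal = Mg' at *
  generalize (PerforatedDisk.bdryDerivHolder α z r g).toReal = Hg' at *
  have hD₀ : 0 ≤ d ^ 2 * K := by positivity
  refine ⟨⟨b₁.trans_lt ENNReal.ofReal_lt_top, b₂.trans_lt ENNReal.ofReal_lt_top,
    b₃.trans_lt ENNReal.ofReal_lt_top, b₄.trans_lt ENNReal.ofReal_lt_top⟩, ?_, ?_, ?_, ?_⟩
  · refine (PerforatedDisk.le_of_le_ofReal hC₀.le hS₀ hMg (by positivity) (by positivity)
      (by positivity) hD₀ b₁ hD).trans_eq ?_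
    rw [ENNReal.ofReal_one, ENNReal.ofReal_mul (p := r 0 ^ (α : ℝ)) (by positivity), ← mul_assoc]
    rfl
  · exact PerforatedDisk.le_of_le_ofReal hC₀.le hS₀ hMg (by positivity) (by positivity)
      (by positivity) hD₀ b₂ hD
  · refine (PerforatedDisk.le_of_le_ofReal hC₀.le hS₀ hMg (by positivity) (by positivity)
      (by positivity) hD₀ b₃ hD).trans_eq ?_
    rw [ENNReal.ofReal_add (by positivity) (by positivity),
      ENNReal.ofReal_add (by positivity) (by positivity),
      ENNReal.ofReal_mul (p := r 0 ^ (α : ℝ)) (by positivity),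
      ENNReal.ofReal_mul (p := d ^ ((α : ℝ) - 1)) (by positivity)]
    simp only [ENNReal.ofReal]
    ring
  · refine (PerforatedDisk.le_of_le_ofReal hC₀.le hS₀ hMg (by positivity) (by positivity)
      (by positivity) hD₀ b₄ hD).trans_eq ?_
    rw [ENNReal.ofReal_add (by positivity) (by positivity),
      ENNReal.ofReal_add (by positivity) (by positivity),
      ENNReal.ofReal_mul (p := d ^ (-1 : ℝ)) (by positivity),
      ENNReal.ofReal_mul (p := d ^ (-α : ℝ)) (by positivity)]
    simp only [ENNReal.ofReal]
    ring
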